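/- Let $\mathcal X$ be a finite set, let $r(x,y)\ge 0$ ($x,y\in\mathcal X$, $r(x,x)=0$) be the jump rates of an irreducible continuous-time Markov jump process, let $\pi$ be its unique invariant distribution, and let $(X_t)_{t\ge 0}$ be the stationary process with initial distribution $\pi$; write $\mathbb E_\pi$ for its expectation. Let $r^*(x,y)=\pi(y)r(y,x)/\pi(x)$. Let $T>0$, $\omega=2\pi/T$ (here $\pi$ is the number), let $\tau:\mathbb R\to\mathbb R$ be bounded, measurable and $T$-periodic, and let $E:\mathcal X\times\mathcal X\to\mathbb R$. For $\lambda\in\mathbb R$ let $(X^\lambda_t)_{t\ge0}$ be the càdlàg Markov jump process with time-dependent rates $r(x,y)\,e^{\lambda\tau(s)E(x,y)}$ whose initial distribution $\pi_\lambda$ is the invariant distribution of the chain $(X^\lambda_{nT})_{n\ge0}$ (the oscillatory steady state, OSS); write $\mathbb E_{\pi_\lambda}$ for its expectation. Put $E^*(x,y)=E(y,x)$ and $$E^*_{r^*}(x)=\sum_y r^*(x,y)E(y,x),\qquad E_r(x)=\sum_y r(x,y)E(x,y),$$ $$\Psi(x)=E^*_{r^*}(x)-E_r(x).$$ For $\beta(s,x,y)$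 write $\beta_r(s,x)=\sum_y\beta(s,x,y)r(x,y)$. Then the following derivatives exist, all expectations and integrals below being absolutely convergent (the double integrals jointly in both variables). (1) For $v:\mathcal X\to\mathbb R$ and $t\ge0$, $$\partial_{\lambda=0}\mathbb E_{\pi_\lambda}[v(X^\lambda_t)]=\int_0^\infty \tau(t-s)\,\mathbb E_\pi[v(X_s)\Psi(X_0)]\,ds.$$ (2) For $t\ge0$ and $v:[0,t]\times\mathcal X\to\mathbb R$ measurable with $\int_0^t|v(s,x)|\,ds<\infty$ for all $x$, $$\partial_{\lambda=0}\mathbb E_{\pi_\lambda}\Big[\int_0^t v(s,X^\lambda_s)\,ds\Big]=\int_0^t du\int_0^\infty ds\,\tau(u-s)\,\mathbb E_\pi[v(u,X_s)\Psi(X_0)].$$ (3) For $t\ge0$ and $\alpha:[0,t]\times\mathcal X\times\mathcal X\to\mathbb R$ measurable with $\mathbb E_\pi\big[\int_0^t|\alpha|_r(s,X_s)\,ds\big]<\infty$, where the sum below runs over the jump times in $(0,t]$, $$\partial_{\lambda=0}\mathbb E_{\pi_\lambda}\Big[\sum_{s\in(0,t]}\alpha(s,X^\lambda_{s-},X^\lambda_s)\Big]=\int_0^t\tau(s)\,\mathbb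 E_\pi[(\alpha E)_r(s,X_s)]\,ds+\int_0^t ds\int_0^\infty du\,\tau(s-u)\,\mathbb E_\pi[\alpha_r(s,X_u)\Psi(X_0)].$$ (4) For $v:\mathcal X\to\mathbb R$ the map $t\mapsto f_\lambda(t)=\mathbb E_{\pi_\lambda}[v(X^\lambda_t)]$ is $T$-periodic on $[0,\infty)$ and integrable on $[0,T]$, and, writing $c_k(f)=\frac1T\int_0^Te^{-ik\omega t}f(t)\,dt$ and $\hat\tau_k=c_k(\tau)$, for every $k\in\mathbb Z$ $$\partial_{\lambda=0}c_k(f_\lambda)=\int_0^\infty\hat\tau_k\,e^{-ik\omega s}\,\mathbb E_\pi[v(X_s)\Psi(X_0)]\,ds.$$ -/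

import Mathlib

open MeasureTheory ProbabilityTheory Filter Set Topology
open scoped NNReal ENNReal

noncomputable section

namespace OSSResponse

variable {𝒳 : Type*} {Ω : Type*}

/-- The jump rates allow one to go from any state to any other by jumps of positive rate. -/
def IsIrreducible (r : 𝒳 → 𝒳 → ℝ) : Prop :=
  ∀ x y, Relation.ReflTransGen (fun a b => 0 < r a b) x y

/-- The (time-dependent) jump rates `r x y * exp (l * g s x y)`. -/
def perturbedRate (r : 𝒳 → 𝒳 → ℝ) (g : ℝ → 𝒳 → 𝒳 → ℝ) (l : ℝ) (s : ℝ) (x y : 𝒳) : ℝ :=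
  r x y * Real.exp (l * g s x y)

section Finite

variable [Fintype 𝒳]

/-- `π` is an invariant probability distribution for the jump rates `r`. -/
structure IsInvariantDistribution (r : 𝒳 → 𝒳 → ℝ) (π : 𝒳 → ℝ) : Prop where
  nonneg : ∀ x, 0 ≤ π x
  sum_eq_one : ∑ x, π x = 1
  balance : ∀ x, π x * ∑ y, r x y = ∑ y, π y * r y x

/-- The generator `∑ y, r x y * (f y - f x)`. -/
def generator (r : 𝒳 → 𝒳 → ℝ) (f : 𝒳 → ℝ) (x : 𝒳) : ℝ :=
  ∑ y, r x y * (f y - f x)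

/-- The contraction `β_r x = ∑ y, β x y * r x y`. -/
def contraction (r β : 𝒳 → 𝒳 → ℝ) (x : 𝒳) : ℝ :=
  ∑ y, β x y * r x y

end Finite

/-- The jump rates of the stationary time-reversed process. -/
def reversedRate (π : 𝒳 → ℝ) (r : 𝒳 → 𝒳 → ℝ) (x y : 𝒳) : ℝ :=
  π y * r y x / π x

/-- The function `E^*_{r^*} - E_r`, where `E^* x y = E y x`. -/
def responseFunction [Fintype 𝒳] (π : 𝒳 → ℝ) (r E : 𝒳 → 𝒳 → ℝ) (x : 𝒳) : ℝ :=
  contraction (reversedRate π r) (fun a b => E b a) x - contraction r E x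

/-- Right-continuous paths with left limits at every positive time. -/
def IsCadlagPath [TopologicalSpace 𝒳] (ξ : ℝ≥0 → 𝒳) : Prop :=
  (∀ t, ContinuousWithinAt ξ (Ici t) t) ∧
    ∀ t, 0 < t → ∃ x, Tendsto ξ (𝓝[<] t) (𝓝 x)

/-- The sum of `α s (ξ_{s-}) (ξ_s)` over the jump times `s ∈ (0, t]` of the path `ξ`.
A càdlàg path in a finite discrete space has finitely many of them. -/
def jumpSum [TopologicalSpace 𝒳] (α : ℝ → 𝒳 → 𝒳 → ℝ) (t : ℝ≥0) (ξ : ℝ≥0 → 𝒳) : ℝ :=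
  ∑ᶠ s ∈ {s : ℝ≥0 | 0 < s ∧ s ≤ t ∧ Function.leftLim ξ s ≠ ξ s},
    α s (Function.leftLim ξ s) (ξ s)

section Jump

variable [Fintype 𝒳] [TopologicalSpace 𝒳] [DiscreteTopology 𝒳] [MeasurableSpace 𝒳]
  [BorelSpace 𝒳] [MeasurableSpace Ω]

/-- `X` is, under `P`, a (time-inhomogeneous) Markov jump process with jump rate `q s x y` from
`x` to `y` at time `s`: it has càdlàg paths and solves the martingale problem of the generators
`generator (q s)`, with respect to its own filtration. On a finite state space, for bounded
measurable rates, this determines the law of the process from the law of `X 0`. -/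
structure IsMarkovJumpProcess (q : ℝ → 𝒳 → 𝒳 → ℝ) (P : Measure Ω) (X : ℝ≥0 → Ω → 𝒳) :
    Prop where
  stronglyMeasurable : ∀ t, StronglyMeasurable (X t)
  cadlag : ∀ ω, IsCadlagPath (fun t => X t ω)
  martingale : ∀ f : 𝒳 → ℝ,
    Martingale
      (fun (t : ℝ≥0) ω =>
        f (X t ω) - f (X 0 ω) - ∫ u in (0 : ℝ)..t, generator (q u) f (X u.toNNReal ω))
      (Filtration.natural X stronglyMeasurable) P

/-- `X` is, under `P`, an oscillatory steady state: a Markov jump process with (`T`-periodic)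
rates `q` whose initial distribution is invariant for the chain `(X (n * T))`. -/
structure IsOscillatorySteadyState (q : ℝ → 𝒳 → 𝒳 → ℝ) (T : ℝ) (P : Measure Ω)
    (X : ℝ≥0 → Ω → 𝒳) : Prop where
  isMarkovJumpProcess : IsMarkovJumpProcess q P X
  map_eq : P.map (X T.toNNReal) = P.map (X 0)

/-- `X` is, under `P`, the homogeneous Markov jump process with rates `r` and initial
distribution `π`. -/
structure IsHomogeneousProcess (r : 𝒳 → 𝒳 → ℝ) (π : 𝒳 → ℝ) (P : Measure Ω)
    (X : ℝ≥0 → Ω → 𝒳) : Prop where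
  isMarkovJumpProcess : IsMarkovJumpProcess (fun _ => r) P X
  initial : ∀ x, P.real {ω | X 0 ω = x} = π x

end Jump

/-- The expectation of `f (X_s) * h (X_0)`. -/
def correlation [MeasurableSpace Ω] (P : Measure Ω) (X : ℝ≥0 → Ω → 𝒳) (f h : 𝒳 → ℝ) (s : ℝ) : ℝ :=
  ∫ ω, f (X s.toNNReal ω) * h (X 0 ω) ∂P

/-- The expectation of `∫_0^t |α|_r (s, X_s) ds` is finite. -/
def IsPathIntegrable [Fintype 𝒳] [MeasurableSpace Ω] (r : 𝒳 → 𝒳 → ℝ) (P : Measure Ω)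
    (X : ℝ≥0 → Ω → 𝒳) (t : ℝ≥0) (α : ℝ → 𝒳 → 𝒳 → ℝ) : Prop :=
  ∫⁻ ω, (∫⁻ s in Ioc (0 : ℝ) t,
    ENNReal.ofReal (contraction r (fun x y => |α s x y|) (X s.toNNReal ω))) ∂P < ∞

/-- The `k`-th Fourier coefficient `(1/T) ∫_0^T e^{-ikωt} f(t) dt`, with `ω = 2π/T`. -/
def fourierCoefficient (T : ℝ) (k : ℤ) (f : ℝ → ℝ) : ℂ :=
  (1 / T : ℂ) * ∫ t in (0 : ℝ)..T,
    Complex.exp (-(Complex.I * k * (2 * Real.pi / T : ℝ) * t)) * (f t : ℂ)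

end OSSResponse

end

noncomputable section

namespace OSSResponse

/-! Every expectation in the theorem depends on the oscillatory steady state only through its
one-dimensional laws `p l t`. Testing the martingale problem on indicators shows that these laws
solve the forward equation `p' = forwardOperator (q l t) p` in integrated form
(`IsMarkovJumpProcess.law_eq_add_integral`). Invariance under the period map gives `p l T = p l 0`,
so the laws are periodic solutions.

The analytic core is the stability of periodic solutions. Irreducibility yields a Poincaré
inequality, hence exponential decay of the unperturbed semigroup on vectors of zero sum
(`exists_norm_semigroup_le`). Thus `1 - e^{TA}` is invertible on such vectors, and a periodic
zero-sum solution of `d' = A d + forcing` is bounded by a constant times the supremum of the forcing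
(`exists_norm_le_of_periodic`). This is used twice. The forcing of `p - π` is `O(l)`, so `p - π =
O(l)`. Let `ρ t = ∫_0^∞ τ (t - s) e^{sA} w ds`, where `w` is the forward operator of the rates `r *
E` applied to `π`; it is the periodic solution of `ρ' = A ρ + τ w`. The forcing of `p - π - l ρ` is
then `O(l ^ 2)`, so this difference is `O(l ^ 2)` uniformly in time
(`exists_norm_sub_linearResponse_le`).

Dividing by `π` identifies `w` with `π Ψ` (`forwardOperator_mul_apply`), and conditioning on the
initial state turns pairings with `e^{sA} w` into the stationary correlations
(`IsHomogeneousProcess.correlation_eq`). Fixed-time and integrated observables and Fourier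
coefficients then follow by Fubini.

Sums over jumps require the intensity of the jumps, `q s x y * law s x ds`. It is obtained from the
forward equation alone: jumps are counted along finer and finer grids, two-time probabilities are
estimated with quadratic error, and the limit is taken under the expectation
(`IsMarkovJumpProcess.lintegral_jumpMeasure_Ioc`, `IsMarkovJumpProcess.bind_stoppedJumpMeasure`).
The exponential factor in the rate then contributes the instantaneous term `τ E π` beside `ρ`. -/

/-- Gronwall's inequality in integral form. -/
theorem le_mul_exp_of_le_add_integral {f : ℝ → ℝ} {a L b : ℝ} (hf : Continuous f) (hL : 0 ≤ L)
    (h : ∀ t ∈ Icc 0 b, f t ≤ a + L * ∫ u in (0 : ℝ)..t, f u) {t : ℝ} (ht : t ∈ Icc 0 b) :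
    f t ≤ a * Real.exp (L * t) := by
  have hF (s : ℝ) : HasDerivAt (fun s => ∫ u in (0 : ℝ)..s, f u) (f s) s :=
    intervalIntegral.integral_hasDerivAt_right (hf.intervalIntegrable _ _)
      (hf.stronglyMeasurableAtFilter _ _) hf.continuousAt
  -- The derivative of `G` is `-L e^{-Ls}` times the gap in the hypothesis, so `G` decreases from `G
  -- 0 = a`.
  set G : ℝ → ℝ := fun s => Real.exp (-L * s) * (a + L * ∫ u in (0 : ℝ)..s, f u) with hG
  have hG' (s : ℝ) : HasDerivAt G
      (Real.exp (-L * s) * (-L) * (a + L * ∫ u in (0 : ℝ)..s, f u)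
        + Real.exp (-L * s) * (L * f s)) s := by
    have h1 : HasDerivAt (fun s : ℝ => Real.exp (-L * s)) (Real.exp (-L * s) * (-L)) s := by
      simpa using ((hasDerivAt_id s).const_mul (-L)).exp
    exact h1.mul (((hF s).const_mul L).const_add a)
  have hanti : AntitoneOn G (Icc 0 b) := by
    refine antitoneOn_of_deriv_nonpos (convex_Icc 0 b)
      (fun s _ => (hG' s).continuousAt.continuousWithinAt)
      (fun s _ => (hG' s).differentiableAt.differentiableWithinAt) fun s hs => ?_
    rw [(hG' s).deriv]
    have hs' := h s (interior_subset hs)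
    have : Real.exp (-L * s) * (-L) * (a + L * ∫ u in (0 : ℝ)..s, f u)
        + Real.exp (-L * s) * (L * f s)
        = -(Real.exp (-L * s) * L * ((a + L * ∫ u in (0 : ℝ)..s, f u) - f s)) := by ring
    rw [this, neg_nonpos]
    exact mul_nonneg (mul_nonneg (Real.exp_pos _).le hL) (sub_nonneg.2 hs')
  have h0 : G t ≤ G 0 := hanti ⟨le_rfl, ht.1.trans ht.2⟩ ht ht.1
  have hG0 : G 0 = a := by simp [hG]
  calc f t ≤ a + L * ∫ u in (0 : ℝ)..t, f u := h t ht
    _ = G t * Real.exp (L * t) := by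
        simp only [hG]
        rw [mul_comm (Real.exp _), mul_assoc, ← Real.exp_add]
        simp
    _ ≤ a * Real.exp (L * t) := by
        rw [← hG0]
        exact mul_le_mul_of_nonneg_right h0 (Real.exp_pos _).le

/-- The constant forcing contributes at most `K * b` up to time `b`; absorbed into the initial
bound, it leaves a scalar Gronwall inequality for the norm. -/
theorem norm_le_of_eq_add_integral {V : Type*} [NormedAddCommGroup V] [NormedSpace ℝ V]
    {d h : ℝ → V} {a L K b : ℝ} (hd : Continuous d) (hL : 0 ≤ L) (hK : 0 ≤ K) (ha : ‖d 0‖ ≤ a)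
    (hh : ∀ u ∈ Icc 0 b, ‖h u‖ ≤ L * ‖d u‖ + K)
    (heq : ∀ t ∈ Icc 0 b, d t = d 0 + ∫ u in (0 : ℝ)..t, h u) {t : ℝ} (ht : t ∈ Icc 0 b) :
    ‖d t‖ ≤ (a + K * b) * Real.exp (L * b) := by
  have hb : 0 ≤ b := ht.1.trans ht.2
  have ha0 : 0 ≤ a := (norm_nonneg _).trans ha
  have := le_mul_exp_of_le_add_integral (f := fun t => ‖d t‖) (a := a + K * b) (b := b) hd.norm hL
    (fun s hs => ?_) ht
  · refine this.trans (mul_le_mul_of_nonneg_left (Real.exp_le_exp.2 ?_) (by positivity))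
    exact mul_le_mul_of_nonneg_left ht.2 hL
  · have hi : IntervalIntegrable (fun u => L * ‖d u‖ + K) volume 0 s :=
      ((hd.norm.const_mul L).add continuous_const).intervalIntegrable _ _
    have h1 : ‖∫ u in (0 : ℝ)..s, h u‖ ≤ ∫ u in (0 : ℝ)..s, (L * ‖d u‖ + K) := by
      refine intervalIntegral.norm_integral_le_of_norm_le hs.1 (ae_of_all _ fun u hu => ?_) hi
      exact hh u ⟨hu.1.le, hu.2.trans hs.2⟩
    rw [intervalIntegral.integral_add ((hd.norm.const_mul L).intervalIntegrable _ _) (by simp),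
      intervalIntegral.integral_const_mul] at h1
    simp only [intervalIntegral.integral_const, sub_zero, smul_eq_mul] at h1
    have h2 : s * K ≤ K * b := by rw [mul_comm]; exact mul_le_mul_of_nonneg_left hs.2 hK
    rw [heq s hs]
    refine (norm_add_le _ _).trans ?_
    linarith

/-! ### Forward operators, the Dirichlet form and the Poincaré inequality -/

section Forward

variable {𝒳 : Type*} [Fintype 𝒳]

/-- The forward operator of the jump rates `q`, the transpose of `generator q`. -/
def forwardOperator (q : 𝒳 → 𝒳 → ℝ) : (𝒳 → ℝ) →L[ℝ] (𝒳 → ℝ) :=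
  LinearMap.toContinuousLinearMap
    { toFun := fun p y => ∑ x, p x * q x y - p y * ∑ z, q y z
      map_add' := fun p p' => by
        ext y; simp only [Pi.add_apply, add_mul, Finset.sum_add_distrib]; ring
      map_smul' := fun c p => by
        ext y
        simp only [Pi.smul_apply, smul_eq_mul, RingHom.id_apply, mul_sub, Finset.mul_sum, mul_assoc] }

theorem forwardOperator_apply (q : 𝒳 → 𝒳 → ℝ) (p : 𝒳 → ℝ) (y : 𝒳) :
    forwardOperator q p y = ∑ x, p x * q x y - p y * ∑ z, q y z := rfl

theorem forwardOperator_add (q q' : 𝒳 → 𝒳 → ℝ) (p : 𝒳 → ℝ) :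
    forwardOperator (q + q') p = forwardOperator q p + forwardOperator q' p := by
  ext y
  simp only [forwardOperator_apply, Pi.add_apply, mul_add, Finset.sum_add_distrib]; ring

theorem forwardOperator_smul (c : ℝ) (q : 𝒳 → 𝒳 → ℝ) (p : 𝒳 → ℝ) :
    forwardOperator (c • q) p = c • forwardOperator q p := by
  ext y
  simp only [forwardOperator_apply, Pi.smul_apply, smul_eq_mul, mul_sub, Finset.mul_sum]
  congr 1 <;> exact Finset.sum_congr rfl fun _ _ => by ring

/-- Duality between laws and observables. Conservation of mass, the dissipation identity and the
passage from the martingale problem to the forward equation are all obtained by choosing `f`. -/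
theorem sum_forwardOperator_mul (q : 𝒳 → 𝒳 → ℝ) (p f : 𝒳 → ℝ) :
    ∑ y, forwardOperator q p y * f y = ∑ x, p x * generator q f x := by
  simp only [forwardOperator_apply, generator, sub_mul, Finset.sum_sub_distrib, Finset.sum_mul,
    Finset.mul_sum, mul_sub]
  congr 1
  · rw [Finset.sum_comm]; exact Finset.sum_congr rfl fun _ _ => Finset.sum_congr rfl fun _ _ => by ring
  · exact Finset.sum_congr rfl fun _ _ => Finset.sum_congr rfl fun _ _ => by ring

theorem sum_forwardOperator (q : 𝒳 → 𝒳 → ℝ) (p : 𝒳 → ℝ) : ∑ y, forwardOperator q p y = 0 := by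
  simpa [generator] using sum_forwardOperator_mul q p fun _ => 1

theorem norm_forwardOperator_apply_le {q : 𝒳 → 𝒳 → ℝ} {K : ℝ} (hK : 0 ≤ K)
    (hq : ∀ x y, |q x y| ≤ K) (p : 𝒳 → ℝ) :
    ‖forwardOperator q p‖ ≤ 2 * Fintype.card 𝒳 * K * ‖p‖ := by
  refine (pi_norm_le_iff_of_nonneg (by positivity)).2 fun y => ?_
  have hp (x : 𝒳) : |p x| ≤ ‖p‖ := norm_le_pi_norm p x
  rw [forwardOperator_apply, Real.norm_eq_abs]
  have h1 : |∑ x, p x * q x y| ≤ Fintype.card 𝒳 * (‖p‖ * K) := by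
    refine (Finset.abs_sum_le_sum_abs _ _).trans ((Finset.sum_le_card_nsmul _ _ (‖p‖ * K)
      fun x _ => ?_).trans_eq (by simp))
    rw [abs_mul]
    exact mul_le_mul (hp x) (hq x y) (abs_nonneg _) (norm_nonneg _)
  have h2 : |∑ z, q y z| ≤ Fintype.card 𝒳 * K :=
    (Finset.abs_sum_le_sum_abs _ _).trans ((Finset.sum_le_card_nsmul _ _ K
      fun x _ => hq y x).trans_eq (by simp))
  have h3 : |p y * ∑ z, q y z| ≤ ‖p‖ * (Fintype.card 𝒳 * K) := by
    rw [abs_mul]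
    exact mul_le_mul (hp y) h2 (abs_nonneg _) (norm_nonneg _)
  refine (abs_sub _ _).trans ?_
  linarith

theorem IsInvariantDistribution.forwardOperator_eq_zero {r : 𝒳 → 𝒳 → ℝ} {π : 𝒳 → ℝ}
    (hπ : IsInvariantDistribution r π) : forwardOperator r π = 0 := by
  ext y; simp [forwardOperator_apply, hπ.balance y]

/-- Some state has positive mass. If `π c = 0`, the balance equation makes the inflow into `c`
vanish, which is impossible along an edge of positive rate leaving a charged state; so positivity
spreads along paths. -/
theorem IsInvariantDistribution.pos {r : 𝒳 → 𝒳 → ℝ} (hr : ∀ x y, 0 ≤ r x y)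
    (hirr : IsIrreducible r) {π : 𝒳 → ℝ} (hπ : IsInvariantDistribution r π) (x : 𝒳) :
    0 < π x := by
  obtain ⟨a, ha⟩ : ∃ a, 0 < π a := by
    by_contra! h
    have := Finset.sum_nonpos fun x (_ : x ∈ Finset.univ) => h x
    linarith [hπ.sum_eq_one]
  induction hirr a x with
  | refl => exact ha
  | @tail b c _ hbc ih =>
    refine (hπ.nonneg c).lt_of_ne fun h0 => ?_
    have hb := hπ.balance c
    rw [← h0, zero_mul] at hb
    have := Finset.single_le_sum (f := fun y => π y * r y c)
      (fun y _ => mul_nonneg (hπ.nonneg y) (hr y c)) (Finset.mem_univ b)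
    have h2 := mul_pos ih hbc
    linarith

/-- The Dirichlet form (up to a factor `2`). -/
def dirichletForm (r : 𝒳 → 𝒳 → ℝ) (π u : 𝒳 → ℝ) : ℝ :=
  ∑ x, ∑ y, π x * r x y * (u y - u x) ^ 2

theorem dirichletForm_nonneg {r : 𝒳 → 𝒳 → ℝ} (hr : ∀ x y, 0 ≤ r x y) {π : 𝒳 → ℝ}
    (hπ : ∀ x, 0 ≤ π x) (u : 𝒳 → ℝ) : 0 ≤ dirichletForm r π u :=
  Finset.sum_nonneg fun x _ => Finset.sum_nonneg fun y _ =>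
    mul_nonneg (mul_nonneg (hπ x) (hr x y)) (sq_nonneg _)

/-- Invariance is tested on `u ^ 2`: the generator of a square is `2 u L u` plus the sum of the
squared increments. Reversibility plays no role. -/
theorem IsInvariantDistribution.two_mul_sum_generator {r : 𝒳 → 𝒳 → ℝ} {π : 𝒳 → ℝ}
    (hπ : IsInvariantDistribution r π) (u : 𝒳 → ℝ) :
    2 * ∑ x, π x * u x * generator r u x = -dirichletForm r π u := by
  have h := sum_forwardOperator_mul r π fun x => u x ^ 2
  rw [hπ.forwardOperator_eq_zero] at h
  simp only [Pi.zero_apply, zero_mul, Finset.sum_const_zero, generator] at h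
  rw [eq_neg_iff_add_eq_zero, h]
  simp only [generator, dirichletForm, Finset.mul_sum, ← Finset.sum_add_distrib]
  exact Finset.sum_congr rfl fun _ _ => Finset.sum_congr rfl fun _ _ => by ring

/-- Along a path of positive rates each squared increment is one summand of the Dirichlet form, up
to its weight, and `(a + b) ^ 2 ≤ 2 a ^ 2 + 2 b ^ 2` adds one edge at a time. -/
theorem exists_sq_sub_le_dirichletForm {r : 𝒳 → 𝒳 → ℝ} (hr : ∀ x y, 0 ≤ r x y)
    (hirr : IsIrreducible r) {π : 𝒳 → ℝ} (hπ : ∀ x, 0 < π x) (x y : 𝒳) :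
    ∃ C, 0 ≤ C ∧ ∀ u : 𝒳 → ℝ, (u y - u x) ^ 2 ≤ C * dirichletForm r π u := by
  induction hirr x y with
  | refl => exact ⟨0, le_rfl, fun u => by simp⟩
  | @tail b c _ hbc ih =>
    obtain ⟨C, hC, h⟩ := ih
    have hw : 0 < π b * r b c := mul_pos (hπ b) hbc
    refine ⟨2 * C + 2 * (π b * r b c)⁻¹, by positivity, fun u => ?_⟩
    have h1 : π b * r b c * (u c - u b) ^ 2 ≤ dirichletForm r π u := by
      refine le_trans ?_ (Finset.single_le_sum (f := fun x => ∑ y, π x * r x y * (u y - u x) ^ 2)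
        (fun x _ => Finset.sum_nonneg fun y _ =>
          mul_nonneg (mul_nonneg (hπ x).le (hr x y)) (sq_nonneg _)) (Finset.mem_univ b))
      exact Finset.single_le_sum (f := fun y => π b * r b y * (u y - u b) ^ 2)
        (fun y _ => mul_nonneg (mul_nonneg (hπ b).le (hr b y)) (sq_nonneg _)) (Finset.mem_univ c)
    have h2 : (u c - u b) ^ 2 ≤ (π b * r b c)⁻¹ * dirichletForm r π u := by
      rw [inv_mul_eq_div, le_div_iff₀ hw]; linarith
    have h3 := h u
    nlinarith [sq_nonneg ((u c - u b) - (u b - u x))]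

/-- A Poincaré inequality for irreducible jump rates. -/
theorem exists_sum_sq_le_dirichletForm {r : 𝒳 → 𝒳 → ℝ} (hr : ∀ x y, 0 ≤ r x y)
    (hirr : IsIrreducible r) {π : 𝒳 → ℝ} (hπ : ∀ x, 0 < π x) (hsum : ∑ x, π x = 1) :
    ∃ κ, 0 < κ ∧ ∀ u : 𝒳 → ℝ, ∑ x, π x * u x = 0 →
      ∑ x, π x * u x ^ 2 ≤ κ * dirichletForm r π u := by
  choose C hC h using exists_sq_sub_le_dirichletForm hr hirr hπ
  -- The added `1` makes the constant strictly positive, for instance on a single state.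
  refine ⟨∑ x, ∑ y, π x * π y * C x y + 1, ?_, fun u hu => ?_⟩
  · have : 0 ≤ ∑ x, ∑ y, π x * π y * C x y := Finset.sum_nonneg fun x _ =>
      Finset.sum_nonneg fun y _ => mul_nonneg (mul_nonneg (hπ x).le (hπ y).le) (hC x y)
    linarith
  -- For a centred function the doubly averaged squared difference is twice the variance.
  have h1 : ∑ x, ∑ y, π x * π y * (u y - u x) ^ 2 = 2 * ∑ x, π x * u x ^ 2 := by
    have e (x y : 𝒳) : π x * π y * (u y - u x) ^ 2
        = π x * (π y * u y ^ 2) - 2 * ((π x * u x) * (π y * u y)) + (π x * u x ^ 2) * π y := by ring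
    simp only [e, Finset.sum_add_distrib, Finset.sum_sub_distrib, ← Finset.mul_sum,
      ← Finset.sum_mul, hu, hsum]
    ring
  have h2 : ∑ x, ∑ y, π x * π y * (u y - u x) ^ 2
      ≤ (∑ x, ∑ y, π x * π y * C x y) * dirichletForm r π u := by
    simp only [Finset.sum_mul]
    refine Finset.sum_le_sum fun x _ => Finset.sum_le_sum fun y _ => ?_
    rw [mul_assoc (π x * π y)]
    exact mul_le_mul_of_nonneg_left (h x y u) (mul_nonneg (hπ x).le (hπ y).le)
  have h3 := dirichletForm_nonneg hr (fun x => (hπ x).le) u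
  have h4 : 0 ≤ ∑ x, π x * u x ^ 2 :=
    Finset.sum_nonneg fun x _ => mul_nonneg (hπ x).le (sq_nonneg _)
  linarith

/-! ### The semigroup of a bounded operator -/

/-- The semigroup generated by `A`. -/
def semigroup {V : Type*} [NormedAddCommGroup V] [NormedSpace ℝ V] (A : V →L[ℝ] V) (t : ℝ) :
    V →L[ℝ] V :=
  NormedSpace.exp (t • A)

section Semigroup

variable {V : Type*} [NormedAddCommGroup V] [NormedSpace ℝ V]

theorem semigroup_zero (A : V →L[ℝ] V) : semigroup A 0 = 1 := by simp [semigroup]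

variable [CompleteSpace V]

theorem semigroup_add (A : V →L[ℝ] V) (s t : ℝ) :
    semigroup A (s + t) = semigroup A s * semigroup A t := by
  rw [semigroup, add_smul]
  exact NormedSpace.exp_add_of_commute_of_mem_ball (𝕂 := ℝ)
    (((Commute.refl A).smul_left s).smul_right t)
    (by simp [NormedSpace.expSeries_radius_eq_top]) (by simp [NormedSpace.expSeries_radius_eq_top])

theorem semigroup_add_apply (A : V →L[ℝ] V) (s t : ℝ) (w : V) :
    semigroup A (s + t) w = semigroup A s (semigroup A t w) := by
  rw [semigroup_add]; rfl

theorem hasDerivAt_semigroup_apply (A : V →L[ℝ] V) (w : V) (t : ℝ) :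
    HasDerivAt (fun t => semigroup A t w) (A (semigroup A t w)) t := by
  simpa [semigroup] using (hasDerivAt_exp_smul_const' (𝕂 := ℝ) A t).clm_apply (hasDerivAt_const t w)

theorem continuous_semigroup_apply (A : V →L[ℝ] V) (w : V) :
    Continuous fun t => semigroup A t w :=
  continuous_iff_continuousAt.2 fun t => (hasDerivAt_semigroup_apply A w t).continuousAt

theorem semigroup_apply_eq_add_integral (A : V →L[ℝ] V) (w : V) (t : ℝ) :
    semigroup A t w = w + ∫ u in (0 : ℝ)..t, A (semigroup A u w) := by
  rw [intervalIntegral.integral_eq_sub_of_hasDerivAt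
    (fun u _ => hasDerivAt_semigroup_apply A w u)
    ((A.continuous.comp (continuous_semigroup_apply A w)).intervalIntegrable _ _)]
  simp [semigroup_zero]

end Semigroup

end Forward

/-! ### Exponential relaxation and stability of periodic solutions -/

section Relaxation

variable {𝒳 : Type*} [Fintype 𝒳]

theorem sum_semigroup_forwardOperator (r : 𝒳 → 𝒳 → ℝ) (w : 𝒳 → ℝ) (t : ℝ) :
    ∑ x, semigroup (forwardOperator r) t w x = ∑ x, w x := by
  have h (t : ℝ) : HasDerivAt (fun t => ∑ x, semigroup (forwardOperator r) t w x) 0 t := by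
    have := HasDerivAt.fun_sum (u := Finset.univ) fun x _ =>
      hasDerivAt_pi.1 (hasDerivAt_semigroup_apply (forwardOperator r) w t) x
    rwa [sum_forwardOperator] at this
  have := is_const_of_deriv_eq_zero (fun t => (h t).differentiableAt) (fun t => (h t).deriv) t 0
  simpa [semigroup_zero] using this

/-- Exponential relaxation of the semigroup of irreducible jump rates. -/
theorem exists_norm_semigroup_le {r : 𝒳 → 𝒳 → ℝ} (hr : ∀ x y, 0 ≤ r x y)
    (hirr : IsIrreducible r) {π : 𝒳 → ℝ} (hπ : IsInvariantDistribution r π) :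
    ∃ C γ, 0 < C ∧ 0 < γ ∧ ∀ w : 𝒳 → ℝ, ∑ x, w x = 0 → ∀ t, 0 ≤ t →
      ‖semigroup (forwardOperator r) t w‖ ≤ C * ‖w‖ * Real.exp (-γ * t) := by
  have hpos := hπ.pos hr hirr
  obtain ⟨κ, hκ, hP⟩ := exists_sum_sq_le_dirichletForm hr hirr hpos hπ.sum_eq_one
  set M : ℝ := ∑ x, (π x)⁻¹ + 1 with hM
  have hM0 : 0 < M := by
    have : 0 ≤ ∑ x, (π x)⁻¹ := Finset.sum_nonneg fun x _ => (inv_pos.2 (hpos x)).le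
    linarith
  -- The squared weighted norm decays at rate `κ⁻¹` from at most `M * ‖w‖ ^ 2`; taking square roots
  -- gives both constants.
  refine ⟨√M, (2 * κ)⁻¹, Real.sqrt_pos.2 hM0, by positivity, fun w hw t ht => ?_⟩
  set c : ℝ → 𝒳 → ℝ := fun t => semigroup (forwardOperator r) t w with hc
  -- This is the squared `L²(π)` norm of the density `c t / π`. Its derivative is minus the
  -- Dirichlet form of that density, which Poincaré bounds below by `φ / κ`, the density being
  -- centred.
  set φ : ℝ → ℝ := fun t => ∑ x, c t x ^ 2 / π x with hφ
  have hφ' (t : ℝ) : HasDerivAt φ (-dirichletForm r π fun x => c t x / π x) t := by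
    have h := HasDerivAt.fun_sum (u := Finset.univ) fun x _ =>
      ((hasDerivAt_pi.1 (hasDerivAt_semigroup_apply (forwardOperator r) w t) x).pow 2).div_const
        (π x)
    refine h.congr_deriv ?_
    have h2 := sum_forwardOperator_mul r (c t) fun x => c t x / π x
    rw [← hπ.two_mul_sum_generator]
    have e1 : ∑ x, π x * (c t x / π x) * generator r (fun x => c t x / π x) x
        = ∑ x, c t x * generator r (fun x => c t x / π x) x :=
      Finset.sum_congr rfl fun x _ => by rw [mul_div_cancel₀ _ (hpos x).ne']
    rw [e1, ← h2, Finset.mul_sum]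
    exact Finset.sum_congr rfl fun x _ => by simp only [hc]; push_cast; ring
  have hφP (t : ℝ) : φ t ≤ κ * dirichletForm r π fun x => c t x / π x := by
    refine le_of_eq_of_le ?_ (hP (fun x => c t x / π x) ?_)
    · exact Finset.sum_congr rfl fun x _ => by field_simp [(hpos x).ne']
    · rw [← hw, ← sum_semigroup_forwardOperator r w t]
      exact Finset.sum_congr rfl fun x _ => by rw [mul_div_cancel₀ _ (hpos x).ne']
  have hG (t : ℝ) : HasDerivAt (fun t => Real.exp (κ⁻¹ * t) * φ t)
      (Real.exp (κ⁻¹ * t) * κ⁻¹ * φ t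
        + Real.exp (κ⁻¹ * t) * -dirichletForm r π fun x => c t x / π x) t := by
    have h1 : HasDerivAt (fun s : ℝ => Real.exp (κ⁻¹ * s)) (Real.exp (κ⁻¹ * t) * κ⁻¹) t := by
      simpa using ((hasDerivAt_id t).const_mul κ⁻¹).exp
    exact h1.mul (hφ' t)
  have hanti : Antitone fun t => Real.exp (κ⁻¹ * t) * φ t := by
    refine antitone_of_deriv_nonpos (fun t => (hG t).differentiableAt) fun t => ?_
    rw [(hG t).deriv, mul_assoc, ← mul_add]
    refine mul_nonpos_of_nonneg_of_nonpos (Real.exp_pos _).le ?_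
    have h1 : κ⁻¹ * φ t ≤ dirichletForm r π fun x => c t x / π x := by
      rw [inv_mul_le_iff₀ hκ]; exact hφP t
    linarith
  have h0 : Real.exp (κ⁻¹ * t) * φ t ≤ φ 0 := by simpa using hanti ht
  have hφ0 : φ 0 ≤ M * ‖w‖ ^ 2 := by
    have : φ 0 ≤ ∑ x, (π x)⁻¹ * ‖w‖ ^ 2 := by
      refine Finset.sum_le_sum fun x _ => ?_
      simp only [hc, semigroup_zero, one_apply_eq_self]
      rw [div_eq_inv_mul]
      refine mul_le_mul_of_nonneg_left ?_ (inv_pos.2 (hpos x)).le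
      exact sq_le_sq' (by have := norm_le_pi_norm w x; rw [Real.norm_eq_abs] at this; linarith [neg_abs_le (w x)])
        ((le_abs_self _).trans (norm_le_pi_norm w x))
    rw [← Finset.sum_mul] at this
    nlinarith [sq_nonneg ‖w‖]
  refine (pi_norm_le_iff_of_nonneg (by positivity)).2 fun x => ?_
  have hx1 : c t x ^ 2 ≤ φ t := by
    have h1 : c t x ^ 2 / π x ≤ φ t := Finset.single_le_sum (f := fun x => c t x ^ 2 / π x)
      (fun y _ => div_nonneg (sq_nonneg _) (hpos y).le) (Finset.mem_univ x)
    have h2 : π x ≤ 1 := hπ.sum_eq_one ▸ Finset.single_le_sum (fun y _ => hπ.nonneg y)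
      (Finset.mem_univ x)
    refine le_trans ?_ h1
    rw [le_div_iff₀ (hpos x)]
    nlinarith [sq_nonneg (c t x)]
  have hx2 : φ t ≤ M * ‖w‖ ^ 2 * Real.exp (-(κ⁻¹ * t)) := by
    rw [Real.exp_neg, ← div_eq_mul_inv, le_div_iff₀ (Real.exp_pos _)]
    linarith
  rw [Real.norm_eq_abs]
  refine abs_le_of_sq_le_sq ?_ (by positivity)
  refine (hx1.trans hx2).trans_eq ?_
  rw [mul_pow, mul_pow, Real.sq_sqrt hM0.le, ← Real.exp_nat_mul]
  congr 2
  push_cast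
  field_simp

/-- A zero-sum vector fixed by `e^{TA}` is fixed by all its powers and therefore vanishes by
relaxation. In finite dimension injectivity gives a lower bound. Adjoining the total mass as an
extra coordinate of `Φ` avoids working on the subspace of zero-sum vectors. -/
theorem exists_norm_le_norm_sub_semigroup {r : 𝒳 → 𝒳 → ℝ} (hr : ∀ x y, 0 ≤ r x y)
    (hirr : IsIrreducible r) {π : 𝒳 → ℝ} (hπ : IsInvariantDistribution r π) {T : ℝ} (hT : 0 < T) :
    ∃ C, 0 ≤ C ∧ ∀ w : 𝒳 → ℝ, ∑ x, w x = 0 →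
      ‖w‖ ≤ C * ‖w - semigroup (forwardOperator r) T w‖ := by
  obtain ⟨C, γ, hC, hγ, hdecay⟩ := exists_norm_semigroup_le hr hirr hπ
  set S := semigroup (forwardOperator r) T with hS
  let Φ : (𝒳 → ℝ) →ₗ[ℝ] (𝒳 → ℝ) × ℝ :=
    (LinearMap.id - (S : (𝒳 → ℝ) →ₗ[ℝ] 𝒳 → ℝ)).prod (∑ x, LinearMap.proj x)
  have hΦ (w : 𝒳 → ℝ) : Φ w = (w - S w, ∑ x, w x) := by simp [Φ]
  have hker : LinearMap.ker Φ = ⊥ := by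
    refine (LinearMap.ker_eq_bot').2 fun w hw => ?_
    rw [hΦ, Prod.mk_eq_zero, sub_eq_zero] at hw
    obtain ⟨h1, h2⟩ := hw
    have hn (n : ℕ) : semigroup (forwardOperator r) (n * T) w = w := by
      induction n with
      | zero => simp [semigroup_zero]
      | succ n ih => rw [Nat.cast_succ, add_mul, one_mul, semigroup_add_apply, ← hS, ← h1, ih]
    have hlim : Tendsto (fun n : ℕ => C * ‖w‖ * Real.exp (-γ * (n * T))) atTop (𝓝 0) := by
      rw [← mul_zero (C * ‖w‖)]
      refine (Real.tendsto_exp_atBot.comp ?_).const_mul _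
      refine Tendsto.const_mul_atTop_of_neg (by linarith) ?_
      exact tendsto_natCast_atTop_atTop.atTop_mul_const hT
    have : ‖w‖ ≤ 0 := ge_of_tendsto' hlim fun n => by
      simpa only [hn n] using hdecay w h2 (n * T) (by positivity)
    exact norm_le_zero_iff.1 this
  obtain ⟨K, -, hK⟩ := Φ.exists_antilipschitzWith hker
  refine ⟨K, K.2, fun w hw => ?_⟩
  have := hK.le_mul_norm_sub w 0
  simpa [hΦ, hw, norm_sub_rev] using this

/-- Stability of the periodic solutions of zero mass of the inhomogeneous forward equation. -/
theorem exists_norm_le_of_periodic {r : 𝒳 → 𝒳 → ℝ} (hr : ∀ x y, 0 ≤ r x y)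
    (hirr : IsIrreducible r) {π : 𝒳 → ℝ} (hπ : IsInvariantDistribution r π) {T : ℝ} (hT : 0 < T) :
    ∃ C, 0 ≤ C ∧ ∀ (d h : ℝ → 𝒳 → ℝ) (K : ℝ), 0 ≤ K → Continuous d →
      (∀ u ∈ Icc 0 T, ‖h u - forwardOperator r (d u)‖ ≤ K) →
      (∀ t ∈ Icc 0 T, IntervalIntegrable h volume 0 t) →
      (∀ t ∈ Icc 0 T, d t = d 0 + ∫ u in (0 : ℝ)..t, h u) →
      d T = d 0 → ∑ x, d 0 x = 0 → ∀ t ∈ Icc 0 T, ‖d t‖ ≤ C * K := by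
  obtain ⟨C, hC, hstab⟩ := exists_norm_le_norm_sub_semigroup hr hirr hπ hT
  set A := forwardOperator r with hA
  set L := ‖A‖ with hL
  refine ⟨(C * (T * Real.exp (L * T)) + T) * Real.exp (L * T), by positivity, ?_⟩
  intro d h K hK hd hh hint heq hper hsum t ht
  -- Comparison with the free evolution from the same starting point: Gronwall makes the discrepancy
  -- after one period `O(K)`. As `d T = d 0`, this bounds `d 0 - e^{TA} (d 0)`, hence `d 0`, and a
  -- second Gronwall estimate reaches all times of the period.
  have h1 : ‖d T - semigroup A T (d 0)‖ ≤ (0 + K * T) * Real.exp (L * T) := by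
    refine norm_le_of_eq_add_integral (d := fun t => d t - semigroup A t (d 0))
      (h := fun u => h u - A (semigroup A u (d 0))) (b := T)
      (hd.sub (continuous_semigroup_apply A _)) (norm_nonneg A) hK (by simp [semigroup_zero])
      (fun u hu => ?_) (fun t ht => ?_) ⟨hT.le, le_rfl⟩
    · have e : h u - A (semigroup A u (d 0))
          = A (d u - semigroup A u (d 0)) + (h u - A (d u)) := by rw [map_sub]; abel
      rw [e]
      exact (norm_add_le _ _).trans (add_le_add (A.le_opNorm _) (hh u hu))
    · have hi : IntervalIntegrable (fun u => A (semigroup A u (d 0))) volume 0 t :=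
        (A.continuous.comp (continuous_semigroup_apply A _)).intervalIntegrable _ _
      rw [intervalIntegral.integral_sub (hint t ht) hi, heq t ht,
        semigroup_apply_eq_add_integral A (d 0) t]
      simp only [semigroup_zero, one_apply_eq_self]
      abel
  have h2 : ‖d 0‖ ≤ C * ((0 + K * T) * Real.exp (L * T)) := by
    refine (hstab (d 0) hsum).trans (mul_le_mul_of_nonneg_left ?_ hC)
    rwa [hper] at h1
  refine (norm_le_of_eq_add_integral hd (norm_nonneg A) hK h2 (fun u hu => ?_) heq ht).trans_eq ?_
  · have e : h u = A (d u) + (h u - A (d u)) := by abel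
    rw [e]
    exact (norm_add_le _ _).trans (add_le_add (A.le_opNorm _) (hh u hu))
  · simp only [← hL]; ring

end Relaxation

/-! ### Variation of constants with measurable forcing, and the linear response -/

theorem mul_integral_eq_integral {f f' k : ℝ → ℝ} (hf : ∀ u, HasDerivAt f (f' u) u)
    (hf' : Continuous f') (t : ℝ) (hk : IntervalIntegrable k volume 0 t) :
    f t * ∫ u in (0 : ℝ)..t, k u
      = ∫ u in (0 : ℝ)..t, (f' u * (∫ v in (0 : ℝ)..u, k v) + f u * k u) := by
  have hd : deriv f = f' := funext fun u => (hf u).deriv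
  have hf1 : ContDiff ℝ 1 f :=
    contDiff_one_iff_deriv.2 ⟨fun u => (hf u).differentiableAt, hd ▸ hf'⟩
  -- As `k` is only integrable, its primitive is differentiable only almost everywhere, so
  -- integration by parts is used in its absolutely continuous form.
  have h := (hf1.contDiffOn.absolutelyContinuousOnInterval (a := 0)
    (b := t)).integral_deriv_mul_eq_sub
    (hk.absolutelyContinuousOnInterval_intervalIntegral left_mem_uIcc)
  simp only [intervalIntegral.integral_same, mul_zero, sub_zero] at h
  rw [← h]
  refine intervalIntegral.integral_congr_ae ?_
  filter_upwards [hk.ae_hasDerivAt_integral] with u hu hu'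
  rw [hd, (hu (uIoc_subset_uIcc hu') 0 left_mem_uIcc).deriv]

theorem intervalIntegral_apply {𝒳 : Type*} [Fintype 𝒳] {h : ℝ → 𝒳 → ℝ} {a b : ℝ}
    (hh : IntervalIntegrable h volume a b) (x : 𝒳) :
    (∫ u in a..b, h u) x = ∫ u in a..b, h u x :=
  ((ContinuousLinearMap.proj (R := ℝ) (φ := fun _ : 𝒳 => ℝ) x).intervalIntegral_comp_comm hh).symm

theorem continuous_semigroup {V : Type*} [NormedAddCommGroup V] [NormedSpace ℝ V]
    [CompleteSpace V] (A : V →L[ℝ] V) : Continuous (semigroup A) :=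
  continuous_iff_continuousAt.2 fun t =>
    (hasDerivAt_exp_smul_const' (𝕂 := ℝ) A t).continuousAt

theorem IntervalIntegrable.continuous_clm_apply {V : Type*} [NormedAddCommGroup V]
    [NormedSpace ℝ V] {L : ℝ → V →L[ℝ] V} (hL : Continuous L) {k : ℝ → V} {a b : ℝ}
    (hk : IntervalIntegrable k volume a b) :
    IntervalIntegrable (fun u => L u (k u)) volume a b := by
  obtain ⟨C, hC⟩ := (isCompact_uIcc (a := a) (b := b)).exists_bound_of_continuousOn hL.continuousOn
  rw [intervalIntegrable_iff] at hk ⊢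
  refine Integrable.mono' (hk.norm.const_mul C) ?_ ?_
  · exact (ContinuousLinearMap.apply ℝ V).flip.aestronglyMeasurable_comp₂
      hL.aestronglyMeasurable hk.aestronglyMeasurable
  · refine (ae_restrict_iff' measurableSet_uIoc).2 (ae_of_all _ fun u hu => ?_)
    exact ((L u).le_opNorm _).trans
      (mul_le_mul_of_nonneg_right (hC u (uIoc_subset_uIcc hu)) (norm_nonneg _))

section Semigroup

variable {𝒳 : Type*} [Fintype 𝒳]

/-- The product rule for `e^{tA}` acting on a primitive. Expanding in the standard basis reduces
each coordinate to the scalar integration by parts. -/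
theorem semigroup_integral_eq_integral (A : (𝒳 → ℝ) →L[ℝ] (𝒳 → ℝ)) {k : ℝ → 𝒳 → ℝ}
    (hk : ∀ a b, IntervalIntegrable k volume a b) (t : ℝ) :
    semigroup A t (∫ u in (0 : ℝ)..t, k u)
      = ∫ u in (0 : ℝ)..t, (A (semigroup A u (∫ v in (0 : ℝ)..u, k v)) + semigroup A u (k u)) := by
  classical
  have hkx (x : 𝒳) (a b : ℝ) : IntervalIntegrable (fun u => k u x) volume a b :=
    ⟨(hk a b).1.eval x, (hk a b).2.eval x⟩
  have hS := continuous_semigroup A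
  have hg : Continuous fun u => ∫ v in (0 : ℝ)..u, k v :=
    intervalIntegral.continuous_primitive hk 0
  have h1 : Continuous fun u => A (semigroup A u (∫ v in (0 : ℝ)..u, k v)) :=
    A.continuous.comp (hS.clm_apply hg)
  have h2 : IntervalIntegrable (fun u => semigroup A u (k u)) volume 0 t :=
    IntervalIntegrable.continuous_clm_apply hS (hk 0 t)
  ext i
  rw [intervalIntegral_apply ((h1.intervalIntegrable _ _).add h2)]
  have expand (u : ℝ) (w : 𝒳 → ℝ) : semigroup A u w i
      = ∑ j, semigroup A u (fun m => if j = m then 1 else 0) i * w j := by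
    have := LinearMap.pi_apply_eq_sum_univ (semigroup A u : (𝒳 → ℝ) →ₗ[ℝ] 𝒳 → ℝ) w
    rw [ContinuousLinearMap.coe_coe] at this
    rw [this, Finset.sum_apply]
    exact Finset.sum_congr rfl fun j _ => by simp [mul_comm]
  have expand' (u : ℝ) (w : 𝒳 → ℝ) : A (semigroup A u w) i
      = ∑ j, A (semigroup A u (fun m => if j = m then 1 else 0)) i * w j := by
    have := LinearMap.pi_apply_eq_sum_univ
      ((A.comp (semigroup A u) : (𝒳 → ℝ) →L[ℝ] (𝒳 → ℝ)) : (𝒳 → ℝ) →ₗ[ℝ] 𝒳 → ℝ) w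
    rw [ContinuousLinearMap.coe_coe, ContinuousLinearMap.comp_apply] at this
    rw [this, Finset.sum_apply]
    exact Finset.sum_congr rfl fun j _ => by simp [mul_comm]
  have e (u : ℝ) : (A (semigroup A u (∫ v in (0 : ℝ)..u, k v)) + semigroup A u (k u)) i
      = ∑ j, (A (semigroup A u (fun m => if j = m then 1 else 0)) i * (∫ v in (0 : ℝ)..u, k v j)
        + semigroup A u (fun m => if j = m then 1 else 0) i * k u j) := by
    rw [Pi.add_apply, expand', expand, ← Finset.sum_add_distrib]
    exact Finset.sum_congr rfl fun j _ => by rw [intervalIntegral_apply (hk 0 u)]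
  simp only [e]
  have hc (j : 𝒳) : Continuous fun u => semigroup A u (fun m => if j = m then 1 else 0) :=
    continuous_semigroup_apply A _
  rw [expand, intervalIntegral.integral_finsetSum]
  · refine Finset.sum_congr rfl fun j _ => ?_
    rw [intervalIntegral_apply (hk 0 t)]
    exact mul_integral_eq_integral
      (fun u => hasDerivAt_pi.1 (hasDerivAt_semigroup_apply A _ u) i)
      ((continuous_apply i).comp (A.continuous.comp (hc j))) t (hkx j 0 t)
  · intro j _
    refine IntervalIntegrable.add (Continuous.intervalIntegrable ?_ _ _)
      ((hkx j 0 t).continuousOn_mul ((continuous_apply i).comp (hc j)).continuousOn)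
    exact ((continuous_apply i).comp (A.continuous.comp (hc j))).mul
      (intervalIntegral.continuous_primitive (hkx j) 0)

/-- The linear response `∫_0^∞ τ (t - s) e^{sA} w ds` of the flow of `A` to the periodic forcing
`τ` in the direction `w`. -/
def linearResponse (A : (𝒳 → ℝ) →L[ℝ] (𝒳 → ℝ)) (τ : ℝ → ℝ) (w : 𝒳 → ℝ) (t : ℝ) : 𝒳 → ℝ :=
  ∫ s in Ioi (0 : ℝ), τ (t - s) • semigroup A s w

variable {A : (𝒳 → ℝ) →L[ℝ] (𝒳 → ℝ)} {τ : ℝ → ℝ} {w : 𝒳 → ℝ} {C M γ : ℝ}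

theorem integrableOn_of_norm_le_exp {V : Type*} [NormedAddCommGroup V] {f : ℝ → V}
    (hf : AEStronglyMeasurable f (volume.restrict (Ioi 0))) (hγ : 0 < γ)
    (h : ∀ s, 0 ≤ s → ‖f s‖ ≤ M * Real.exp (-γ * s)) : IntegrableOn f (Ioi 0) := by
  refine Integrable.mono' ((integrableOn_exp_mul_Ioi (neg_lt_zero.2 hγ) 0).const_mul M) hf ?_
  exact (ae_restrict_iff' measurableSet_Ioi).2 (ae_of_all _ fun s hs => h s (le_of_lt hs))

theorem norm_integral_le_of_norm_le_exp {V : Type*} [NormedAddCommGroup V] [NormedSpace ℝ V]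
    {f : ℝ → V} (hγ : 0 < γ) (h : ∀ s, 0 ≤ s → ‖f s‖ ≤ M * Real.exp (-γ * s)) :
    ‖∫ s in Ioi (0 : ℝ), f s‖ ≤ M / γ := by
  refine (norm_integral_le_of_norm_le ((integrableOn_exp_mul_Ioi (neg_lt_zero.2 hγ) 0).const_mul M)
    ((ae_restrict_iff' measurableSet_Ioi).2 (ae_of_all _ fun s hs => h s (le_of_lt hs)))).trans_eq ?_
  rw [integral_const_mul, integral_exp_mul_Ioi (neg_lt_zero.2 hγ)]
  simp [div_eq_mul_inv]

theorem norm_smul_semigroup_le (hτC : ∀ s, |τ s| ≤ C)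
    (hdec : ∀ s, 0 ≤ s → ‖semigroup A s w‖ ≤ M * Real.exp (-γ * s)) (t s : ℝ) (hs : 0 ≤ s) :
    ‖τ (t - s) • semigroup A s w‖ ≤ C * M * Real.exp (-γ * s) := by
  rw [norm_smul, mul_assoc]
  exact mul_le_mul (hτC _) (hdec s hs) (norm_nonneg _) ((abs_nonneg _).trans (hτC 0))

theorem integrableOn_smul_semigroup (hτ : Measurable τ) (hτC : ∀ s, |τ s| ≤ C) (hγ : 0 < γ)
    (hdec : ∀ s, 0 ≤ s → ‖semigroup A s w‖ ≤ M * Real.exp (-γ * s)) (t : ℝ) :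
    IntegrableOn (fun s => τ (t - s) • semigroup A s w) (Ioi 0) :=
  integrableOn_of_norm_le_exp ((hτ.comp (measurable_const.sub measurable_id)).aestronglyMeasurable.smul
    (continuous_semigroup_apply A w).aestronglyMeasurable) hγ (norm_smul_semigroup_le hτC hdec t)

theorem norm_linearResponse_le (hτC : ∀ s, |τ s| ≤ C) (hγ : 0 < γ)
    (hdec : ∀ s, 0 ≤ s → ‖semigroup A s w‖ ≤ M * Real.exp (-γ * s)) (t : ℝ) :
    ‖linearResponse A τ w t‖ ≤ C * M / γ :=
  norm_integral_le_of_norm_le_exp hγ (norm_smul_semigroup_le hτC hdec t)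

theorem linearResponse_periodic {T : ℝ} (hτ : Function.Periodic τ T) :
    Function.Periodic (linearResponse A τ w) T := fun t => by
  simp only [linearResponse]
  congr 1 with s
  rw [show t + T - s = t - s + T by ring, hτ]

theorem linearResponse_apply (hτ : Measurable τ) (hτC : ∀ s, |τ s| ≤ C) (hγ : 0 < γ)
    (hdec : ∀ s, 0 ≤ s → ‖semigroup A s w‖ ≤ M * Real.exp (-γ * s)) (t : ℝ) (x : 𝒳) :
    linearResponse A τ w t x = ∫ s in Ioi (0 : ℝ), τ (t - s) * semigroup A s w x :=
  ((ContinuousLinearMap.proj (R := ℝ) (φ := fun _ : 𝒳 => ℝ) x).integral_comp_comm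
    (integrableOn_smul_semigroup hτ hτC hγ hdec t)).symm

theorem sum_linearResponse {r : 𝒳 → 𝒳 → ℝ} (hτ : Measurable τ) (hτC : ∀ s, |τ s| ≤ C)
    (hγ : 0 < γ) (hdec : ∀ s, 0 ≤ s →
      ‖semigroup (forwardOperator r) s w‖ ≤ M * Real.exp (-γ * s)) (hw : ∑ x, w x = 0) (t : ℝ) :
    ∑ x, linearResponse (forwardOperator r) τ w t x = 0 := by
  have h := ((∑ x, ContinuousLinearMap.proj (R := ℝ) (φ := fun _ : 𝒳 => ℝ) x).integral_comp_comm
    (integrableOn_smul_semigroup hτ hτC hγ hdec t))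
  simp only [sum_apply, ContinuousLinearMap.proj_apply, Pi.smul_apply,
    smul_eq_mul, ← Finset.mul_sum, sum_semigroup_forwardOperator, hw, mul_zero,
    integral_zero] at h
  exact h.symm

theorem intervalIntegrable_smul_semigroup_neg (hτ : Measurable τ) (hτC : ∀ s, |τ s| ≤ C)
    (a b : ℝ) : IntervalIntegrable (fun u => τ u • semigroup A (-u) w) volume a b := by
  have h : IntervalIntegrable (fun _ : ℝ => C) volume a b := by simp
  have hτi : IntervalIntegrable τ volume a b :=
    h.mono_fun hτ.aestronglyMeasurable
      (ae_of_all _ fun u => (hτC u).trans (le_abs_self C))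
  exact hτi.smul_continuousOn
    ((continuous_semigroup_apply A w).comp continuous_neg).continuousOn

/-- Shifting `s` by `t` pulls out `e^{tA}` and moves the lower limit to `-t`; reflecting the piece
between `-t` and `0` gives the integral over the elapsed time. Since `A` is bounded, `e^{-uA}` makes
sense. In this form `t` is only a limit of integration, so continuity holds although `τ` is merely
measurable. -/
theorem linearResponse_eq_semigroup (hτ : Measurable τ) (hτC : ∀ s, |τ s| ≤ C) (hγ : 0 < γ)
    (hdec : ∀ s, 0 ≤ s → ‖semigroup A s w‖ ≤ M * Real.exp (-γ * s)) (t : ℝ) :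
    linearResponse A τ w t = semigroup A t
      (linearResponse A τ w 0 + ∫ u in (0 : ℝ)..t, τ u • semigroup A (-u) w) := by
  have hi := integrableOn_smul_semigroup hτ hτC hγ hdec t
  have hi0 := integrableOn_smul_semigroup hτ hτC hγ hdec 0
  have hneg : IntervalIntegrable (fun u => τ (-u) • semigroup A u w) volume (-t) 0 := by
    have := ((intervalIntegrable_smul_semigroup_neg (A := A) (w := w) hτ hτC t 0).comp_sub_left 0)
    simpa using this
  have e1 : linearResponse A τ w t
      = semigroup A t (∫ s in Ioi (0 : ℝ), τ (t - s) • semigroup A (s - t) w) := by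
    have hcomm (s : ℝ) : semigroup A t (τ (t - s) • semigroup A (s - t) w)
        = τ (t - s) • semigroup A s w := by
      rw [map_smul, ← semigroup_add_apply]; congr 3; ring
    have hcomm' (s : ℝ) : semigroup A (-t) (τ (t - s) • semigroup A s w)
        = τ (t - s) • semigroup A (s - t) w := by
      rw [map_smul, ← semigroup_add_apply]; congr 3; ring
    have hi' : IntegrableOn (fun s => τ (t - s) • semigroup A (s - t) w) (Ioi 0) := by
      have := (semigroup A (-t)).integrable_comp hi
      simp only [hcomm'] at this
      exact this
    rw [← ContinuousLinearMap.integral_comp_comm _ hi']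
    simp only [hcomm, linearResponse]
  have e2 : ∫ s in Ioi (0 : ℝ), τ (t - s) • semigroup A (s - t) w
      = ∫ s in Ioi (-t), τ (-s) • semigroup A s w := by
    have := (measurePreserving_add_right volume (-t)).setIntegral_preimage_emb
      (measurableEmbedding_addRight (-t)) (fun s => τ (-s) • semigroup A s w) (Ioi (-t))
    rw [← this]
    simp [← sub_eq_add_neg]
  have e3 : ∫ s in Ioi (-t), τ (-s) • semigroup A s w
      = (∫ s in (-t)..0, τ (-s) • semigroup A s w) + ∫ s in Ioi (0 : ℝ), τ (-s) • semigroup A s w :=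
    (intervalIntegral.integral_interval_add_Ioi' hneg (by simpa using hi0)).symm
  have e4 : ∫ s in (-t)..0, τ (-s) • semigroup A s w
      = ∫ u in (0 : ℝ)..t, τ u • semigroup A (-u) w := by
    have := intervalIntegral.integral_comp_neg (a := 0) (b := t)
      (fun s => τ (-s) • semigroup A s w)
    simpa using this.symm
  rw [e1, e2, e3, e4, add_comm]
  simp [linearResponse]

theorem continuous_linearResponse (hτ : Measurable τ) (hτC : ∀ s, |τ s| ≤ C) (hγ : 0 < γ)
    (hdec : ∀ s, 0 ≤ s → ‖semigroup A s w‖ ≤ M * Real.exp (-γ * s)) :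
    Continuous (linearResponse A τ w) := by
  rw [funext (linearResponse_eq_semigroup hτ hτC hγ hdec)]
  exact (continuous_semigroup A).clm_apply (continuous_const.add
    (intervalIntegral.continuous_primitive (intervalIntegrable_smul_semigroup_neg hτ hτC) 0))

/-- The product rule applied to the variation-of-constants formula gives the integrated form of `ρ'
= A ρ + τ w`, the linearised forward equation. -/
theorem linearResponse_eq_add_integral (hτ : Measurable τ) (hτC : ∀ s, |τ s| ≤ C) (hγ : 0 < γ)
    (hdec : ∀ s, 0 ≤ s → ‖semigroup A s w‖ ≤ M * Real.exp (-γ * s)) (t : ℝ) :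
    linearResponse A τ w t = linearResponse A τ w 0
      + ∫ u in (0 : ℝ)..t, (A (linearResponse A τ w u) + τ u • w) := by
  have hk := intervalIntegrable_smul_semigroup_neg (A := A) (w := w) hτ hτC
  have hS := continuous_semigroup A
  have e (u : ℝ) : A (linearResponse A τ w u) + τ u • w
      = A (semigroup A u (linearResponse A τ w 0))
        + (A (semigroup A u (∫ v in (0 : ℝ)..u, τ v • semigroup A (-v) w))
          + semigroup A u (τ u • semigroup A (-u) w)) := by
    rw [linearResponse_eq_semigroup hτ hτC hγ hdec u, map_add, map_add, map_smul (semigroup A u),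
      ← semigroup_add_apply, add_neg_cancel, semigroup_zero, one_apply_eq_self]
    abel
  simp only [e]
  rw [intervalIntegral.integral_add, ← semigroup_integral_eq_integral A hk t, ← add_assoc,
    ← semigroup_apply_eq_add_integral, ← map_add]
  · exact linearResponse_eq_semigroup hτ hτC hγ hdec t
  · exact (A.continuous.comp (continuous_semigroup_apply A _)).intervalIntegrable _ _
  · exact ((A.continuous.comp (hS.clm_apply
      (intervalIntegral.continuous_primitive hk 0))).intervalIntegrable _ _).add
      (IntervalIntegrable.continuous_clm_apply hS (hk 0 t))

end Semigroup

/-! ### First-order expansion of periodic solutions of the forward equation -/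

theorem measurable_perturbedRate {𝒳 : Type*} (r E : 𝒳 → 𝒳 → ℝ) {τ : ℝ → ℝ} (hτ : Measurable τ) (l : ℝ)
    (x y : 𝒳) : Measurable fun s => perturbedRate r (fun s x y => τ s * E x y) l s x y :=
  measurable_const.mul (Real.measurable_exp.comp (measurable_const.mul (hτ.mul measurable_const)))

section Perturbation

variable {𝒳 : Type*} [Fintype 𝒳]

theorem exists_forall_abs_le (f : 𝒳 → 𝒳 → ℝ) : ∃ K, 0 ≤ K ∧ ∀ x y, |f x y| ≤ K := by
  refine ⟨∑ x, ∑ y, |f x y|, by positivity, fun x y => ?_⟩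
  exact (Finset.single_le_sum (f := fun y => |f x y|) (fun y _ => abs_nonneg _)
    (Finset.mem_univ y)).trans (Finset.single_le_sum (f := fun x => ∑ y, |f x y|)
      (fun x _ => by positivity) (Finset.mem_univ x))

theorem abs_exp_sub_one_sub_id_le_sq_mul_exp (z : ℝ) :
    |Real.exp z - 1 - z| ≤ z ^ 2 * Real.exp |z| := by
  have h := Complex.norm_exp_sub_sum_le_norm_mul_exp (z : ℂ) 2
  simp only [Finset.sum_range_succ, Finset.sum_range_zero, Nat.factorial] at h
  rw [← Real.norm_eq_abs, ← Complex.norm_real]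
  simpa [sub_sub] using h

theorem abs_exp_mul_sub_le {l a Z : ℝ} (hl : |l| ≤ 1) (ha : |a| ≤ Z) :
    |Real.exp (l * a) - 1 - l * a| ≤ Z ^ 2 * Real.exp Z * l ^ 2 := by
  have hZ : 0 ≤ Z := (abs_nonneg a).trans ha
  refine (abs_exp_sub_one_sub_id_le_sq_mul_exp _).trans ?_
  have h1 : |l * a| ≤ Z := by
    rw [abs_mul]
    exact (mul_le_mul hl ha (abs_nonneg _) zero_le_one).trans_eq (one_mul _)
  have h2 : a ^ 2 ≤ Z ^ 2 := sq_le_sq' (by linarith [neg_abs_le a]) ((le_abs_self _).trans ha)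
  calc (l * a) ^ 2 * Real.exp |l * a| ≤ (l ^ 2 * Z ^ 2) * Real.exp Z := by
        rw [mul_pow]
        exact mul_le_mul (mul_le_mul_of_nonneg_left h2 (sq_nonneg _)) (Real.exp_le_exp.2 h1)
          (Real.exp_pos _).le (by positivity)
    _ = _ := by ring

theorem abs_exp_mul_sub_one_le {l a Z : ℝ} (hl : |l| ≤ 1) (ha : |a| ≤ Z) :
    |Real.exp (l * a) - 1| ≤ (Z + Z ^ 2 * Real.exp Z) * |l| := by
  have hZ : 0 ≤ Z := (abs_nonneg a).trans ha
  have h1 := abs_exp_mul_sub_le hl ha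
  have h2 : |l * a| ≤ Z * |l| := by
    rw [abs_mul, mul_comm]; exact mul_le_mul_of_nonneg_right ha (abs_nonneg _)
  have h3 : l ^ 2 ≤ |l| := by
    rw [← sq_abs]; nlinarith [abs_nonneg l]
  have h4 : Z ^ 2 * Real.exp Z * l ^ 2 ≤ Z ^ 2 * Real.exp Z * |l| :=
    mul_le_mul_of_nonneg_left h3 (by positivity)
  calc |Real.exp (l * a) - 1| = |(Real.exp (l * a) - 1 - l * a) + l * a| := by ring_nf
    _ ≤ _ := (abs_add_le _ _).trans (by linarith)

theorem intervalIntegrable_forwardOperator {q : ℝ → 𝒳 → 𝒳 → ℝ} {K : ℝ}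
    (hqm : ∀ x y, Measurable fun s => q s x y) (hK : 0 ≤ K) (hqK : ∀ s x y, |q s x y| ≤ K)
    {p : ℝ → 𝒳 → ℝ} (hp : Continuous p) (a b : ℝ) :
    IntervalIntegrable (fun u => forwardOperator (q u) (p u)) volume a b := by
  have hi : IntervalIntegrable (fun u => 2 * Fintype.card 𝒳 * K * ‖p u‖) volume a b :=
    (hp.norm.const_mul _).intervalIntegrable _ _
  refine hi.mono_fun (Measurable.aestronglyMeasurable ?_) (ae_of_all _ fun u => ?_)
  · refine measurable_pi_iff.2 fun y => ?_
    have hpm (x : 𝒳) : Measurable fun u => p u x := ((continuous_apply x).comp hp).measurable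
    simp only [forwardOperator_apply]
    exact (Finset.measurable_sum _ fun x _ => (hpm x).mul (hqm x y)).sub
      ((hpm y).mul (Finset.measurable_sum _ fun z _ => hqm y z))
  · exact (norm_forwardOperator_apply_le hK (hqK u) (p u)).trans (le_abs_self _)

/-- Uniqueness for the forward equation. -/
theorem eq_of_forward_equation {q : ℝ → 𝒳 → 𝒳 → ℝ} {K : ℝ}
    (hqm : ∀ x y, Measurable fun s => q s x y) (hK : 0 ≤ K) (hqK : ∀ s x y, |q s x y| ≤ K)
    {p p' : ℝ → 𝒳 → ℝ} (hp : Continuous p) (hp' : Continuous p') (h0 : p 0 = p' 0)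
    (heq : ∀ t, 0 ≤ t → p t = p 0 + ∫ u in (0 : ℝ)..t, forwardOperator (q u) (p u))
    (heq' : ∀ t, 0 ≤ t → p' t = p' 0 + ∫ u in (0 : ℝ)..t, forwardOperator (q u) (p' u))
    {t : ℝ} (ht : 0 ≤ t) : p t = p' t := by
  have := norm_le_of_eq_add_integral (d := fun t => p t - p' t) (a := 0) (K := 0) (b := t)
    (h := fun u => forwardOperator (q u) (p u - p' u))
    (L := 2 * Fintype.card 𝒳 * K) (hp.sub hp') (by positivity) le_rfl (by simp [h0])
    (fun u _ => by simpa using norm_forwardOperator_apply_le hK (hqK u) (p u - p' u))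
    (fun s hs => by
      simp only [map_sub]
      rw [intervalIntegral.integral_sub (intervalIntegrable_forwardOperator hqm hK hqK hp _ _)
        (intervalIntegrable_forwardOperator hqm hK hqK hp' _ _), heq s hs.1, heq' s hs.1]
      abel) (t := t) ⟨ht, le_rfl⟩
  simpa [sub_eq_zero] using this

/-- The solution shifted by one period solves the same equation, the rates being periodic, with the
same initial value; uniqueness concludes. -/
theorem forward_equation_periodic {q : ℝ → 𝒳 → 𝒳 → ℝ} {K T : ℝ} (hT : 0 < T)
    (hqm : ∀ x y, Measurable fun s => q s x y) (hK : 0 ≤ K) (hqK : ∀ s x y, |q s x y| ≤ K)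
    (hqT : Function.Periodic q T) {p : ℝ → 𝒳 → ℝ} (hp : Continuous p) (hpT : p T = p 0)
    (heq : ∀ t, 0 ≤ t → p t = p 0 + ∫ u in (0 : ℝ)..t, forwardOperator (q u) (p u))
    {t : ℝ} (ht : 0 ≤ t) : p (t + T) = p t := by
  refine eq_of_forward_equation (p := fun t => p (t + T)) hqm hK hqK
    (hp.comp (continuous_id.add continuous_const)) hp (by simpa using hpT) (fun t ht => ?_) heq ht
  have hi := intervalIntegrable_forwardOperator hqm hK hqK hp
  have h1 := intervalIntegral.integral_comp_add_right (a := 0) (b := t)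
    (fun u => forwardOperator (q u) (p u)) T
  simp only [zero_add] at h1 ⊢
  rw [heq (t + T) (by positivity), heq T hT.le, add_assoc,
    ← intervalIntegral.integral_add_adjacent_intervals (hi 0 T) (hi T (t + T)), ← h1]
  simp only [hqT _]

theorem exists_perturbedRate_bounds (r E : 𝒳 → 𝒳 → ℝ) {τ : ℝ → ℝ} {c : ℝ}
    (hτ : ∀ s, |τ s| ≤ c) :
    ∃ M, 0 ≤ M ∧ ∀ l, |l| ≤ 1 → ∀ s x y,
      |perturbedRate r (fun s x y => τ s * E x y) l s x y - r x y| ≤ M * |l| ∧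
      |perturbedRate r (fun s x y => τ s * E x y) l s x y - r x y - l * (τ s * (r x y * E x y))|
        ≤ M * l ^ 2 := by
  obtain ⟨R, hR0, hR⟩ := exists_forall_abs_le r
  obtain ⟨e, he0, he⟩ := exists_forall_abs_le E
  have hc : 0 ≤ c := (abs_nonneg _).trans (hτ 0)
  set Z := c * e with hZ
  have hZ0 : 0 ≤ Z := mul_nonneg hc he0
  refine ⟨R * (Z + Z ^ 2 * Real.exp Z), by positivity, fun l hl s x y => ?_⟩
  have ha : |τ s * E x y| ≤ Z := by
    rw [abs_mul]; exact mul_le_mul (hτ s) (he x y) (abs_nonneg _) hc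
  have h1 := abs_exp_mul_sub_one_le hl ha
  have h2 := abs_exp_mul_sub_le hl ha
  simp only [perturbedRate]
  constructor
  · rw [show r x y * Real.exp (l * (τ s * E x y)) - r x y
      = r x y * (Real.exp (l * (τ s * E x y)) - 1) by ring, abs_mul, mul_assoc]
    exact mul_le_mul (hR x y) h1 (abs_nonneg _) hR0
  · rw [show r x y * Real.exp (l * (τ s * E x y)) - r x y - l * (τ s * (r x y * E x y))
      = r x y * (Real.exp (l * (τ s * E x y)) - 1 - l * (τ s * E x y)) by ring, abs_mul, mul_assoc]
    refine mul_le_mul (hR x y) (h2.trans ?_) (abs_nonneg _) hR0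
    exact mul_le_mul_of_nonneg_right (by linarith) (sq_nonneg _)

theorem exists_perturbedRate_le (r E : 𝒳 → 𝒳 → ℝ) {τ : ℝ → ℝ} {c : ℝ}
    (hτ : ∀ s, |τ s| ≤ c) (l : ℝ) :
    ∃ K, 0 ≤ K ∧ ∀ s x y, |perturbedRate r (fun s x y => τ s * E x y) l s x y| ≤ K := by
  obtain ⟨R, hR0, hR⟩ := exists_forall_abs_le r
  obtain ⟨e, he0, he⟩ := exists_forall_abs_le E
  have hc : 0 ≤ c := (abs_nonneg _).trans (hτ 0)
  refine ⟨R * Real.exp (|l| * (c * e)), by positivity, fun s x y => ?_⟩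
  rw [perturbedRate, abs_mul, Real.abs_exp]
  refine mul_le_mul (hR x y) (Real.exp_le_exp.2 ((le_abs_self _).trans ?_)) (Real.exp_pos _).le hR0
  rw [abs_mul, abs_mul]
  exact mul_le_mul_of_nonneg_left (mul_le_mul (hτ s) (he x y) (abs_nonneg _) hc) (abs_nonneg _)

theorem norm_le_one_of_sum_eq_one {p : 𝒳 → ℝ} (h0 : ∀ x, 0 ≤ p x) (h1 : ∑ x, p x = 1) :
    ‖p‖ ≤ 1 :=
  (pi_norm_le_iff_of_nonneg zero_le_one).2 fun x => by
    rw [Real.norm_of_nonneg (h0 x), ← h1]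
    exact Finset.single_le_sum (fun y _ => h0 y) (Finset.mem_univ x)

theorem forwardOperator_sub (q q' : 𝒳 → 𝒳 → ℝ) (p : 𝒳 → ℝ) :
    forwardOperator (q - q') p = forwardOperator q p - forwardOperator q' p := by
  have := forwardOperator_add (q - q') q' p
  rw [sub_add_cancel] at this
  rw [this, add_sub_cancel_right]

/-- The oscillatory steady state is, to first order in the strength of the perturbation, given by
the linear response, uniformly in time. -/
theorem exists_norm_sub_linearResponse_le {r : 𝒳 → 𝒳 → ℝ} (hr : ∀ x y, 0 ≤ r x y)
    (hirr : IsIrreducible r) {π : 𝒳 → ℝ} (hπ : IsInvariantDistribution r π) {T : ℝ} (hT : 0 < T)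
    {τ : ℝ → ℝ} (hτ : Measurable τ) {c : ℝ} (hτc : ∀ s, |τ s| ≤ c) (hτT : Function.Periodic τ T)
    (E : 𝒳 → 𝒳 → ℝ) :
    ∃ C, 0 ≤ C ∧ ∀ l, |l| ≤ 1 → ∀ p : ℝ → 𝒳 → ℝ, Continuous p → (∀ t x, 0 ≤ p t x) →
      (∀ t, ∑ x, p t x = 1) →
      (∀ t, 0 ≤ t → p t = p 0 + ∫ u in (0 : ℝ)..t,
        forwardOperator (perturbedRate r (fun s x y => τ s * E x y) l u) (p u)) →
      p T = p 0 → ∀ t, 0 ≤ t →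
      ‖p t - π - l • linearResponse (forwardOperator r) τ
        (forwardOperator (fun x y => r x y * E x y) π) t‖ ≤ C * l ^ 2 := by
  classical
  obtain ⟨C₀, hC₀, hper⟩ := exists_norm_le_of_periodic hr hirr hπ hT
  obtain ⟨M, hM0, hM⟩ := exists_perturbedRate_bounds r E hτc
  obtain ⟨D, γ, hD, hγ, hdec⟩ := exists_norm_semigroup_le hr hirr hπ
  obtain ⟨R, hR0, hR⟩ := exists_forall_abs_le fun x y => r x y * E x y
  have hc : 0 ≤ c := (abs_nonneg _).trans (hτc 0)
  set w := forwardOperator (fun x y => r x y * E x y) π with hw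
  have hw0 : ∑ x, w x = 0 := sum_forwardOperator _ _
  set A := forwardOperator r with hA
  set n : ℝ := 2 * Fintype.card 𝒳 with hn
  have hn0 : 0 ≤ n := by positivity
  have hdw := hdec w hw0
  refine ⟨C₀ * (n * M + c * (n * R * (C₀ * (n * M)))), by positivity, ?_⟩
  intro l hl p hpc hp0 hp1 heq hpT
  set q := fun u => perturbedRate r (fun s x y => τ s * E x y) l u with hq
  set ρ := linearResponse A τ w with hρ
  have hρc : Continuous ρ := continuous_linearResponse hτ hτc hγ hdw
  obtain ⟨K, hK0, hK⟩ := exists_perturbedRate_le r E hτc l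
  have hqm := measurable_perturbedRate r E hτ l
  have hint := intervalIntegrable_forwardOperator hqm hK0 hK hpc
  have hp_norm (t : ℝ) : ‖p t‖ ≤ 1 := norm_le_one_of_sum_eq_one (hp0 t) (hp1 t)
  have hAπ : A π = 0 := hπ.forwardOperator_eq_zero
  -- First pass: since `A π = 0`, the forcing of `p - π` is the operator of the rate difference, of
  -- size `O(l)`, applied to a probability vector.
  have h1 : ∀ t ∈ Icc 0 T, ‖p t - π‖ ≤ C₀ * (n * (M * |l|)) := by
    refine hper (fun t => p t - π) (fun u => forwardOperator (q u) (p u)) _ (by positivity)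
      (hpc.sub continuous_const) (fun u _ => ?_) (fun t _ => hint 0 t) (fun t ht => ?_)
      (by simp only [hpT]) ?_
    · rw [map_sub, hAπ, sub_zero, hA, ← forwardOperator_sub]
      refine (norm_forwardOperator_apply_le (K := M * |l|) (by positivity)
        (fun x y => (hM l hl u x y).1) _).trans ?_
      exact mul_le_of_le_one_right (by positivity) (hp_norm u)
    · rw [heq t ht.1]; abel
    · simp [Finset.sum_sub_distrib, hp1, hπ.sum_eq_one]
  -- Second pass: the forcing is the quadratic remainder of the rates applied to `p`, plus `l * τ`
  -- times the first-order operator applied to `p - π`. The first pass makes the latter `O(l ^ 2)`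
  -- as well.
  have h2 : ∀ t ∈ Icc 0 T, ‖p t - π - l • ρ t‖
      ≤ C₀ * (n * (M * l ^ 2) + |l| * (c * (n * R * (C₀ * (n * (M * |l|)))))) := by
    have hi2 (t : ℝ) : IntervalIntegrable (fun u => A (ρ u) + τ u • w) volume 0 t := by
      refine ((A.continuous.comp hρc).intervalIntegrable _ _).add ?_
      have h : IntervalIntegrable (fun _ : ℝ => c) volume 0 t := by simp
      have hτi : IntervalIntegrable τ volume 0 t :=
        h.mono_fun hτ.aestronglyMeasurable (ae_of_all _ fun u => (hτc u).trans (le_abs_self c))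
      exact hτi.smul_continuousOn continuousOn_const
    refine hper (fun t => p t - π - l • ρ t)
      (fun u => forwardOperator (q u) (p u) - l • (A (ρ u) + τ u • w)) _ (by positivity)
      ((hpc.sub continuous_const).sub (hρc.const_smul l)) (fun u hu => ?_)
      (fun t _ => (hint 0 t).sub ((hi2 t).smul l)) (fun t ht => ?_) ?_ ?_
    · have e : forwardOperator (q u) (p u) - l • (A (ρ u) + τ u • w) - A (p u - π - l • ρ u)
          = forwardOperator (q u - r - (l * τ u) • fun x y => r x y * E x y) (p u)
            + (l * τ u) • forwardOperator (fun x y => r x y * E x y) (p u - π) := by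
        rw [forwardOperator_sub, forwardOperator_sub, forwardOperator_smul, map_sub, map_sub,
          map_sub, hAπ, map_smul, ← hw, smul_add, smul_sub, smul_smul]
        abel
      rw [e]
      refine (norm_add_le _ _).trans (add_le_add ?_ ?_)
      · refine (norm_forwardOperator_apply_le (K := M * l ^ 2) (by positivity)
          (fun x y => ?_) _).trans (mul_le_of_le_one_right (by positivity) (hp_norm u))
        have := (hM l hl u x y).2
        simpa [mul_assoc] using this
      · rw [norm_smul, norm_mul, mul_assoc]
        refine mul_le_mul_of_nonneg_left (mul_le_mul (hτc u) ?_ (norm_nonneg _) hc) (norm_nonneg _)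
        exact (norm_forwardOperator_apply_le hR0 hR _).trans
          (mul_le_mul_of_nonneg_left (h1 u hu) (by positivity))
    · have e1 := linearResponse_eq_add_integral hτ hτc hγ hdw t
      have e2 : ∫ u in (0 : ℝ)..t, (forwardOperator (q u) (p u) - l • (A (ρ u) + τ u • w))
          = (∫ u in (0 : ℝ)..t, forwardOperator (q u) (p u))
            - l • ∫ u in (0 : ℝ)..t, (A (ρ u) + τ u • w) := by
        rw [← intervalIntegral.integral_smul]
        exact intervalIntegral.integral_sub (hint 0 t) ((hi2 t).smul l)
      rw [e2, heq t ht.1, hρ, e1, smul_add]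
      abel
    · have := linearResponse_periodic (A := A) (w := w) hτT 0
      rw [zero_add] at this
      simp only [hpT, hρ, this]
    · have := sum_linearResponse hτ hτc hγ hdw hw0 0
      rw [← hA] at this
      simp [Finset.sum_sub_distrib, hp1, hπ.sum_eq_one, ← Finset.mul_sum, hρ, this]
  have h3 : ∀ t ∈ Icc 0 T, ‖p t - π - l • ρ t‖
      ≤ C₀ * (n * M + c * (n * R * (C₀ * (n * M)))) * l ^ 2 := fun t ht =>
    (h2 t ht).trans_eq (by rw [← sq_abs l]; ring)
  have hqT : Function.Periodic q T := fun u => by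
    ext x y; simp only [hq, perturbedRate, hτT u]
  have hpp {t : ℝ} (ht : 0 ≤ t) : p (t + T) = p t :=
    forward_equation_periodic hT hqm hK0 hK hqT hpc hpT heq ht
  -- Both `p` (at nonnegative times) and `ρ` are periodic, so the bound on one period holds on the
  -- whole half-line.
  have h4 (m : ℕ) : ∀ t ∈ Icc 0 T, ‖p (t + m * T) - π - l • ρ (t + m * T)‖
      ≤ C₀ * (n * M + c * (n * R * (C₀ * (n * M)))) * l ^ 2 := by
    intro t ht
    induction m with
    | zero => simpa using h3 t ht
    | succ m ih =>
      rw [Nat.cast_succ, add_mul, one_mul, ← add_assoc, hpp (by have := ht.1; positivity), hρ,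
        linearResponse_periodic hτT]
      exact ih
  intro t ht
  have h5 := h4 ⌊t / T⌋₊ (t - ⌊t / T⌋₊ * T) ⟨?_, ?_⟩
  · simpa using h5
  · have := Nat.floor_le (div_nonneg ht hT.le)
    rw [le_div_iff₀ hT] at this
    linarith
  · have := Nat.lt_floor_add_one (t / T)
    rw [div_lt_iff₀ hT] at this
    linarith

end Perturbation

/-! ### From the martingale problem to the forward equation -/

theorem measurable_uncurry_of_isCadlagPath {𝒳 Ω : Type*} [TopologicalSpace 𝒳] [DiscreteTopology 𝒳]
    [MeasurableSpace 𝒳] [BorelSpace 𝒳] [MeasurableSpace Ω] {X : ℝ≥0 → Ω → 𝒳}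
    (hX : ∀ t, Measurable (X t)) (hc : ∀ ω, IsCadlagPath fun t => X t ω) :
    Measurable fun p : ℝ≥0 × Ω => X p.1 p.2 := by
  have aux (g : ℕ → ℝ≥0) (φ : ℝ≥0 → ℕ) (hφ : Measurable φ) :
      Measurable fun p : ℝ≥0 × Ω => X (g (φ p.1)) p.2 := by
    have h1 : Measurable fun p : ℕ × Ω => X (g p.1) p.2 :=
      measurable_from_prod_countable_right fun k => hX (g k)
    exact h1.comp ((hφ.comp measurable_fst).prodMk measurable_snd)
  -- The first grid point strictly after `u`, with mesh `1 / (n + 1)`. Approximation from the right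
  -- lets right-continuity give pointwise convergence, while each approximation takes countably many
  -- time values and so is jointly measurable.
  set g : ℕ → ℝ≥0 → ℝ≥0 := fun n u => ((⌊((n : ℝ) + 1) * (u : ℝ)⌋₊ : ℕ) + 1) / ((n : ℝ≥0) + 1)
    with hg
  have key (n : ℕ) : Measurable fun p : ℝ≥0 × Ω => X (g n p.1) p.2 :=
    aux (fun k => ((k : ℝ≥0) + 1) / ((n : ℝ≥0) + 1)) (fun u => ⌊((n : ℝ) + 1) * (u : ℝ)⌋₊)
      (Nat.measurable_floor.comp (measurable_coe_nnreal_real.const_mul _))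
  refine measurable_of_tendsto_metrizable key (tendsto_pi_nhds.2 fun p => ?_)
  obtain ⟨t, ω⟩ := p
  refine ((hc ω).1 t).tendsto.comp (tendsto_nhdsWithin_iff.2 ⟨?_, Eventually.of_forall fun n => ?_⟩)
  · refine NNReal.tendsto_coe.1 ?_
    simp only [hg]
    push_cast
    have h1 : Tendsto (fun n : ℕ => ((n : ℝ) + 1)) atTop atTop :=
      tendsto_atTop_add_const_right _ _ tendsto_natCast_atTop_atTop
    have h2 := ((tendsto_nat_floor_mul_div_atTop (R := ℝ) (a := t) t.2).comp h1).add
      (tendsto_inv_atTop_zero.comp h1)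
    rw [add_zero] at h2
    refine h2.congr fun n => ?_
    simp only [Function.comp_apply]
    rw [add_div, one_div, mul_comm (t : ℝ)]
  · rw [mem_Ici, ← NNReal.coe_le_coe]
    simp only [hg]
    push_cast
    rw [le_div_iff₀ (by positivity), mul_comm]
    exact (Nat.lt_floor_add_one _).le

section JumpProcess

variable {𝒳 Ω : Type*} [MeasurableSpace Ω]

/-- The vector of the masses of the level sets of `X t` under the measure `μ`. -/
def law (μ : Measure Ω) (X : ℝ≥0 → Ω → 𝒳) (t : ℝ) (x : 𝒳) : ℝ :=
  μ.real {ω | X t.toNNReal ω = x}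

theorem law_nonneg (μ : Measure Ω) (X : ℝ≥0 → Ω → 𝒳) (t : ℝ) (x : 𝒳) : 0 ≤ law μ X t x :=
  measureReal_nonneg

variable [Fintype 𝒳] [MeasurableSpace 𝒳] [MeasurableSingletonClass 𝒳] {X : ℝ≥0 → Ω → 𝒳}

theorem integral_eq_sum_law (hX : ∀ t, Measurable (X t)) (μ : Measure Ω) [IsFiniteMeasure μ]
    (f : 𝒳 → ℝ) (t : ℝ) : ∫ ω, f (X t.toNNReal ω) ∂μ = ∑ x, law μ X t x * f x := by
  have h1 : ∫ ω, f (X t.toNNReal ω) ∂μ = ∫ x, f x ∂(μ.map (X t.toNNReal)) :=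
    (integral_map (hX _).aemeasurable (measurable_of_countable f).aestronglyMeasurable).symm
  rw [h1, integral_fintype .of_finite]
  refine Finset.sum_congr rfl fun x _ => ?_
  rw [smul_eq_mul, law, measureReal_def, measureReal_def,
    Measure.map_apply (hX _) (measurableSet_singleton x)]
  rfl

theorem sum_law (hX : ∀ t, Measurable (X t)) (μ : Measure Ω) [IsFiniteMeasure μ] (t : ℝ) :
    ∑ x, law μ X t x = μ.real univ := by
  simpa using (integral_eq_sum_law hX μ (fun _ => 1) t).symm

theorem integrable_comp (hX : ∀ t, Measurable (X t)) (μ : Measure Ω) [IsFiniteMeasure μ]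
    (f : 𝒳 → ℝ) (t : ℝ≥0) : Integrable (fun ω => f (X t ω)) μ := by
  refine Integrable.of_bound (C := ∑ x, |f x|)
    ((measurable_of_countable f).comp (hX t)).aestronglyMeasurable (ae_of_all _ fun ω => ?_)
  exact Finset.single_le_sum (f := fun x => |f x|) (fun x _ => abs_nonneg _) (Finset.mem_univ _)

theorem norm_law_le (hX : ∀ t, Measurable (X t)) (μ : Measure Ω) [IsFiniteMeasure μ] (t : ℝ) :
    ‖law μ X t‖ ≤ μ.real univ :=
  (pi_norm_le_iff_of_nonneg measureReal_nonneg).2 fun x => by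
    rw [Real.norm_of_nonneg (law_nonneg _ _ _ _), ← sum_law hX μ t]
    exact Finset.single_le_sum (fun y _ => law_nonneg μ X t y) (Finset.mem_univ x)

end JumpProcess

section Jump

variable {𝒳 : Type*} [Fintype 𝒳] [TopologicalSpace 𝒳] [DiscreteTopology 𝒳] [MeasurableSpace 𝒳]
  [BorelSpace 𝒳] {Ω : Type*} [MeasurableSpace Ω] {P : Measure Ω} {X : ℝ≥0 → Ω → 𝒳}
  {q : ℝ → 𝒳 → 𝒳 → ℝ} {K : ℝ}

instance isFiniteMeasure_restrict_uIoc (a b : ℝ) :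
    IsFiniteMeasure (volume.restrict (uIoc a b) : Measure ℝ) := by
  rw [uIoc]; infer_instance

theorem IsMarkovJumpProcess.measurable (hX : IsMarkovJumpProcess q P X) (t : ℝ≥0) :
    Measurable (X t) := (hX.stronglyMeasurable t).measurable

theorem IsMarkovJumpProcess.measurable_uncurry (hX : IsMarkovJumpProcess q P X) :
    Measurable fun p : ℝ × Ω => X p.1.toNNReal p.2 :=
  (measurable_uncurry_of_isCadlagPath hX.measurable hX.cadlag).comp
    ((measurable_real_toNNReal.comp measurable_fst).prodMk measurable_snd)

theorem IsMarkovJumpProcess.measurable_law (hX : IsMarkovJumpProcess q P X) (μ : Measure Ω)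
    [IsFiniteMeasure μ] : Measurable (law μ X) :=
  measurable_pi_iff.2 fun x => Measurable.ennreal_toReal
    (measurable_measure_prodMk_left (hX.measurable_uncurry (measurableSet_singleton x)))

theorem measurable_generator (hqm : ∀ x y, Measurable fun s => q s x y) (f : 𝒳 → ℝ) :
    Measurable fun p : ℝ × 𝒳 => generator (q p.1) f p.2 :=
  measurable_from_prod_countable_left fun x =>
    Finset.measurable_sum _ fun y _ => (hqm x y).mul_const (f y - f x)

theorem abs_generator_le {𝒳 : Type*} [Fintype 𝒳] {q : ℝ → 𝒳 → 𝒳 → ℝ} {K : ℝ} (hqK : ∀ s x y, |q s x y| ≤ K) (f : 𝒳 → ℝ) (s : ℝ) (x : 𝒳) :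
    |generator (q s) f x| ≤ ∑ y, K * ∑ z, |f y - f z| := by
  refine (Finset.abs_sum_le_sum_abs _ _).trans (Finset.sum_le_sum fun y _ => ?_)
  rw [abs_mul]
  exact mul_le_mul (hqK s x y) (Finset.single_le_sum (f := fun z => |f y - f z|)
    (fun z _ => abs_nonneg _) (Finset.mem_univ x)) (abs_nonneg _)
    ((abs_nonneg _).trans (hqK s x y))

theorem IsMarkovJumpProcess.integrable_generator (hX : IsMarkovJumpProcess q P X)
    (hqm : ∀ x y, Measurable fun s => q s x y) (hqK : ∀ s x y, |q s x y| ≤ K) (f : 𝒳 → ℝ)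
    (μ : Measure Ω) [IsFiniteMeasure μ] (ν : Measure ℝ) [IsFiniteMeasure ν] :
    Integrable (fun p : ℝ × Ω => generator (q p.1) f (X p.1.toNNReal p.2)) (ν.prod μ) :=
  Integrable.of_bound ((measurable_generator hqm f).comp
    (measurable_fst.prodMk hX.measurable_uncurry)).aestronglyMeasurable _
    (ae_of_all _ fun _ => abs_generator_le hqK f _ _)

theorem IsMarkovJumpProcess.intervalIntegrable_generator (hX : IsMarkovJumpProcess q P X)
    (hqm : ∀ x y, Measurable fun s => q s x y) (hqK : ∀ s x y, |q s x y| ≤ K) (f : 𝒳 → ℝ)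
    (ω : Ω) (a b : ℝ) :
    IntervalIntegrable (fun u => generator (q u) f (X u.toNNReal ω)) volume a b := by
  have h : IntervalIntegrable (fun _ : ℝ => ∑ y, K * ∑ z, |f y - f z|) volume a b := by simp
  refine h.mono_fun (Measurable.aestronglyMeasurable ?_) (ae_of_all _ fun u =>
    (abs_generator_le hqK f u _).trans (le_abs_self _))
  exact (measurable_generator hqm f).comp (measurable_id.prodMk
    (hX.measurable_uncurry.comp (measurable_id.prodMk measurable_const)))

/-- The forward equation of a Markov jump process, on an event of the past of `s`. -/
theorem IsMarkovJumpProcess.law_eq_add_integral [IsFiniteMeasure P]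
    (hX : IsMarkovJumpProcess q P X)
    (hqm : ∀ x y, Measurable fun s => q s x y) (hqK : ∀ s x y, |q s x y| ≤ K) {s t : ℝ≥0}
    (hst : s ≤ t) {A : Set Ω}
    (hA : MeasurableSet[Filtration.natural X hX.stronglyMeasurable s] A) (y : 𝒳) :
    law (P.restrict A) X t y = law (P.restrict A) X s y
      + ∫ u in (s : ℝ)..t, forwardOperator (q u) (law (P.restrict A) X u) y := by
  classical
  set μ := P.restrict A
  set f : 𝒳 → ℝ := fun x => if x = y then 1 else 0 with hf
  -- Martingale increments integrate to zero over events of the past, so the law restricted to such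
  -- an event obeys the same forward equation. Below, this takes the place of the Markov property.
  have hm := (hX.martingale f).setIntegral_eq hst hA
  have hfm (t : ℝ≥0) : ∫ ω, f (X t ω) ∂μ = law μ X t y := by
    have := integral_eq_sum_law hX.measurable μ f t
    simpa [hf] using this
  have hgen : ∫ ω, (∫ u in (s : ℝ)..t, generator (q u) f (X u.toNNReal ω)) ∂μ
      = ∫ u in (s : ℝ)..t, forwardOperator (q u) (law μ X u) y := by
    rw [← intervalIntegral_integral_swap]
    · refine intervalIntegral.integral_congr fun u _ => ?_
      have h1 := integral_eq_sum_law hX.measurable μ (generator (q u) f) u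
      rw [← sum_forwardOperator_mul] at h1
      simpa [hf] using h1
    · exact hX.integrable_generator hqm hqK f μ _
  have hi (t : ℝ≥0) : Integrable (fun ω => f (X t ω)) μ := integrable_comp hX.measurable μ f t
  have hi2 (a b : ℝ) :
      Integrable (fun ω => ∫ u in a..b, generator (q u) f (X u.toNNReal ω)) μ := by
    simp only [intervalIntegral.intervalIntegral_eq_integral_uIoc]
    exact (hX.integrable_generator hqm hqK f μ
      (volume.restrict (uIoc a b))).integral_prod_right.const_mul (if a ≤ b then (1 : ℝ) else -1)
  have e : ∫ ω, f (X t ω) ∂μ = ∫ ω, f (X s ω) ∂μ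
      + ∫ ω, (∫ u in (s : ℝ)..t, generator (q u) f (X u.toNNReal ω)) ∂μ := by
    have hi3 : Integrable (fun ω => f (X s ω)
        + ∫ u in (s : ℝ)..t, generator (q u) f (X u.toNNReal ω)) μ := (hi s).add (hi2 _ _)
    rw [← sub_eq_zero, ← integral_add (hi s) (hi2 _ _), ← integral_sub (hi t) hi3]
    have h0 : ∫ ω, ((f (X t ω) - f (X 0 ω)
          - ∫ u in (0 : ℝ)..t, generator (q u) f (X u.toNNReal ω))
        - (f (X s ω) - f (X 0 ω)
          - ∫ u in (0 : ℝ)..s, generator (q u) f (X u.toNNReal ω))) ∂μ = 0 := by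
      have hM (t : ℝ≥0) : Integrable (fun ω => f (X t ω) - f (X 0 ω)
          - ∫ u in (0 : ℝ)..t, generator (q u) f (X u.toNNReal ω)) μ :=
        ((hi t).sub (hi 0)).sub (hi2 _ _)
      rw [integral_sub (hM t) (hM s), sub_eq_zero]
      exact hm.symm
    rw [← h0]
    refine integral_congr_ae (ae_of_all _ fun ω => ?_)
    have hgi := hX.intervalIntegrable_generator hqm hqK f ω
    simp only
    rw [← intervalIntegral.integral_add_adjacent_intervals (hgi 0 s) (hgi s t)]
    ring
  rw [← hfm t, ← hfm s, e, hgen]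

theorem abs_forwardOperator_apply_le {𝒳 : Type*} [Fintype 𝒳] {q : 𝒳 → 𝒳 → ℝ} {K : ℝ} (hK : 0 ≤ K)
    (hq : ∀ x y, |q x y| ≤ K) (p : 𝒳 → ℝ) (y : 𝒳) :
    |forwardOperator q p y| ≤ 2 * Fintype.card 𝒳 * K * ‖p‖ :=
  (norm_le_pi_norm _ y).trans (norm_forwardOperator_apply_le hK hq p)

theorem IsMarkovJumpProcess.intervalIntegrable_forwardOperator_law
    (hX : IsMarkovJumpProcess q P X) (hqm : ∀ x y, Measurable fun s => q s x y) (hK : 0 ≤ K)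
    (hqK : ∀ s x y, |q s x y| ≤ K) (μ : Measure Ω) [IsFiniteMeasure μ] (a b : ℝ) :
    IntervalIntegrable (fun u => forwardOperator (q u) (law μ X u)) volume a b := by
  have h : IntervalIntegrable (fun _ : ℝ => 2 * Fintype.card 𝒳 * K * μ.real univ) volume a b := by
    simp
  refine h.mono_fun (Measurable.aestronglyMeasurable ?_) (ae_of_all _ fun u => ?_)
  · refine measurable_pi_iff.2 fun y => ?_
    have hpm (x : 𝒳) : Measurable fun u => law μ X u x :=
      (measurable_pi_apply x).comp (hX.measurable_law μ)
    simp only [forwardOperator_apply]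
    exact (Finset.measurable_sum _ fun x _ => (hpm x).mul (hqm x y)).sub
      ((hpm y).mul (Finset.measurable_sum _ fun z _ => hqm y z))
  · refine (norm_forwardOperator_apply_le hK (hqK u) _).trans (le_trans ?_ (le_abs_self _))
    exact mul_le_mul_of_nonneg_left (norm_law_le hX.measurable μ u) (by positivity)

theorem IsMarkovJumpProcess.law_eq_add_integral_zero [IsFiniteMeasure P]
    (hX : IsMarkovJumpProcess q P X)
    (hqm : ∀ x y, Measurable fun s => q s x y) (hK : 0 ≤ K) (hqK : ∀ s x y, |q s x y| ≤ K)
    {A : Set Ω} (hA : MeasurableSet[Filtration.natural X hX.stronglyMeasurable 0] A) {t : ℝ}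
    (ht : 0 ≤ t) :
    law (P.restrict A) X t = law (P.restrict A) X 0
      + ∫ u in (0 : ℝ)..t, forwardOperator (q u) (law (P.restrict A) X u) := by
  ext y
  have := hX.law_eq_add_integral hqm hqK (zero_le (a := t.toNNReal)) hA y
  rw [Real.coe_toNNReal t ht, NNReal.coe_zero] at this
  rw [this, Pi.add_apply,
    intervalIntegral_apply (hX.intervalIntegrable_forwardOperator_law hqm hK hqK _ _ _)]

theorem IsMarkovJumpProcess.continuous_law [IsFiniteMeasure P]
    (hX : IsMarkovJumpProcess q P X)
    (hqm : ∀ x y, Measurable fun s => q s x y) (hK : 0 ≤ K) (hqK : ∀ s x y, |q s x y| ≤ K)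
    {A : Set Ω} (hA : MeasurableSet[Filtration.natural X hX.stronglyMeasurable 0] A) :
    Continuous (law (P.restrict A) X) := by
  have h := intervalIntegral.continuous_primitive
    (fun a b => hX.intervalIntegrable_forwardOperator_law hqm hK hqK (P.restrict A) a b) 0
  -- Negative times are truncated to `0`, so the law at `t` is the law at `max t 0`, where the
  -- forward equation applies.
  have e : law (P.restrict A) X = fun t => law (P.restrict A) X 0
      + ∫ u in (0 : ℝ)..(max t 0), forwardOperator (q u) (law (P.restrict A) X u) := by
    ext1 t
    rw [← hX.law_eq_add_integral_zero hqm hK hqK hA (le_max_right t 0)]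
    ext x
    simp only [law]
    congr 4
    rcases le_total t 0 with h | h
    · simp [Real.toNNReal_of_nonpos h, h]
    · simp [h]
  rw [e]
  exact continuous_const.add (h.comp (continuous_id.max continuous_const))

/-- A state carrying no mass at time `s` can only fill at a bounded rate, because the right-hand
side of the forward equation is bounded. -/
theorem IsMarkovJumpProcess.law_le_mul_sub [IsProbabilityMeasure P]
    (hX : IsMarkovJumpProcess q P X)
    (hqm : ∀ x y, Measurable fun s => q s x y) (hK : 0 ≤ K) (hqK : ∀ s x y, |q s x y| ≤ K)
    {s t : ℝ≥0} (hst : s ≤ t) {A : Set Ω}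
    (hA : MeasurableSet[Filtration.natural X hX.stronglyMeasurable s] A) {y : 𝒳}
    (h0 : law (P.restrict A) X s y = 0) :
    law (P.restrict A) X t y ≤ 2 * Fintype.card 𝒳 * K * (t - s) := by
  rw [hX.law_eq_add_integral hqm hqK hst hA y, h0, zero_add]
  refine (le_abs_self _).trans ?_
  have hst' : (s : ℝ) ≤ t := hst
  have := intervalIntegral.norm_integral_le_of_norm_le_const (a := (s : ℝ)) (b := t)
    (f := fun u => forwardOperator (q u) (law (P.restrict A) X u) y)
    (C := 2 * Fintype.card 𝒳 * K) fun u _ => ?_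
  · rwa [abs_of_nonneg (sub_nonneg.2 hst')] at this
  · refine (abs_forwardOperator_apply_le hK (hqK u) _ y).trans
      (mul_le_of_le_one_right (by positivity) ((norm_law_le hX.measurable _ u).trans ?_))
    rw [measureReal_restrict_apply_univ]
    exact measureReal_le_one

end Jump

/-! ### Counting the jumps of a single path along grids -/

section Path

variable {𝒳 : Type*} [TopologicalSpace 𝒳]

/-- The times of the jumps of the path `ξ` from `x` to `y`. -/
def jumpTimes (ξ : ℝ≥0 → 𝒳) (x y : 𝒳) : Set ℝ≥0 :=
  {s | 0 < s ∧ Function.leftLim ξ s = x ∧ ξ s = y}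

/-- The counting measure of the jumps of the path `ξ` from `x` to `y`. -/
def jumpMeasure (ξ : ℝ≥0 → 𝒳) (x y : 𝒳) : Measure ℝ≥0 :=
  Measure.count.restrict (jumpTimes ξ x y)

variable [DiscreteTopology 𝒳] {ξ : ℝ≥0 → 𝒳}

theorem leftLim_eq_of_forall_mem_Ico {c u : ℝ≥0} {z : 𝒳} (hcu : c < u)
    (h : ∀ v ∈ Ico c u, ξ v = z) : Function.leftLim ξ u = z := by
  have : (𝓝[<] u).NeBot := nhdsLT_neBot_of_exists_lt ⟨c, hcu⟩
  refine leftLim_eq_of_tendsto (tendsto_const_nhds.congr' ?_)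
  filter_upwards [Ico_mem_nhdsLT hcu] with v hv using (h v hv).symm

theorem jumpTimes_inter_Ioc_of_const {c d : ℝ≥0} {z x y : 𝒳} (hxy : x ≠ y)
    (h : ∀ v ∈ Icc c d, ξ v = z) : jumpTimes ξ x y ∩ Ioc c d = ∅ := by
  refine eq_empty_of_forall_notMem fun u hu => hxy ?_
  obtain ⟨⟨-, h1, h2⟩, h3, h4⟩ := hu
  rw [← h1, ← h2, h u ⟨h3.le, h4⟩]
  exact leftLim_eq_of_forall_mem_Ico h3 fun v hv => h v ⟨hv.1, hv.2.le.trans h4⟩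

/-- In a discrete space a convergent path is eventually constant, so the path is constant on each
side of `s`. At `s = 0` the left side is empty. -/
theorem IsCadlagPath.exists_isOpen (hξ : IsCadlagPath ξ) (s : ℝ≥0) :
    ∃ U : Set ℝ≥0, IsOpen U ∧ s ∈ U ∧ (∀ u ∈ U, s ≤ u → ξ u = ξ s) ∧
      ∃ z, ∀ u ∈ U, u < s → ξ u = z := by
  have h1 : ∀ᶠ u in 𝓝 s, s ≤ u → ξ u = ξ s :=
    eventually_nhdsWithin_iff.1
      ((hξ.1 s).tendsto.eventually_mem (mem_nhds_discrete.2 (mem_singleton _)))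
  have h2 : ∃ z, ∀ᶠ u in 𝓝 s, u < s → ξ u = z := by
    rcases eq_zero_or_pos s with rfl | hs
    · exact ⟨ξ 0, Eventually.of_forall fun u hu => absurd hu not_lt_zero⟩
    · obtain ⟨z, hz⟩ := hξ.2 s hs
      exact ⟨z, eventually_nhdsWithin_iff.1
        (hz.eventually_mem (mem_nhds_discrete.2 (mem_singleton _)))⟩
  obtain ⟨z, h2⟩ := h2
  obtain ⟨U, hU, hUo, hsU⟩ := eventually_nhds_iff.1 (h1.and h2)
  exact ⟨U, hUo, hsU, fun u hu => (hU u hu).1, z, fun u hu => (hU u hu).2⟩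

/-- By a Lebesgue number argument an interval shorter than `δ` lies in a neighbourhood of some `s`
on which the path is constant before `s` and from `s` on. So it contains at most one jump, at `s`,
and the two end values determine it. -/
theorem IsCadlagPath.exists_jumpMeasure_Ioc (hξ : IsCadlagPath ξ) (b : ℝ≥0) :
    ∃ δ > 0, ∀ c d : ℝ≥0, c ≤ d → d ≤ b → dist c d < δ → ∀ x y, x ≠ y →
      jumpMeasure ξ x y (Ioc c d)
        = {p : 𝒳 × 𝒳 | p.1 = x ∧ p.2 = y}.indicator (fun _ => (1 : ℝ≥0∞)) (ξ c, ξ d) := by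
  classical
  choose U hUo hsU hU z hz using hξ.exists_isOpen
  obtain ⟨δ, hδ, h⟩ := lebesgue_number_lemma_of_metric (isCompact_Icc (a := (0 : ℝ≥0)) (b := b))
    hUo fun s _ => mem_iUnion.2 ⟨s, hsU s⟩
  refine ⟨δ, hδ, fun c d hcd hdb hdist x y hxy => ?_⟩
  obtain ⟨s, hs⟩ := h c ⟨zero_le, hcd.trans hdb⟩
  have hsub : ∀ v ∈ Icc c d, v ∈ U s := fun v hv => hs <| by
    rw [Metric.mem_ball]
    refine lt_of_le_of_lt ?_ hdist
    rw [dist_comm c d]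
    rw [NNReal.dist_eq, NNReal.dist_eq, abs_of_nonneg (sub_nonneg.2 (NNReal.coe_le_coe.2 hv.1)),
      abs_of_nonneg (sub_nonneg.2 (NNReal.coe_le_coe.2 hcd))]
    exact sub_le_sub_right (NNReal.coe_le_coe.2 hv.2) _
  have hcount : jumpMeasure ξ x y (Ioc c d) = Measure.count (jumpTimes ξ x y ∩ Ioc c d) := by
    rw [jumpMeasure, Measure.restrict_apply measurableSet_Ioc, inter_comm]
  have hconst (w : 𝒳) (hw : ∀ v ∈ Icc c d, ξ v = w) : jumpMeasure ξ x y (Ioc c d)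
      = {p : 𝒳 × 𝒳 | p.1 = x ∧ p.2 = y}.indicator (fun _ => (1 : ℝ≥0∞)) (ξ c, ξ d) := by
    rw [hcount, jumpTimes_inter_Ioc_of_const hxy hw, measure_empty, indicator_of_notMem]
    rintro ⟨h1, h2⟩
    exact hxy (by rw [← h1, ← h2, hw c ⟨le_rfl, hcd⟩, hw d ⟨hcd, le_rfl⟩])
  rcases le_or_gt s c with hsc | hsc
  · exact hconst (ξ s) fun v hv => hU s v (hsub v hv) (hsc.trans hv.1)
  rcases lt_or_ge d s with hds | hds
  · exact hconst (z s) fun v hv => hz s v (hsub v hv) (hv.2.trans_lt hds)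
  have hleft : ∀ v ∈ Ico c s, ξ v = ξ c := fun v hv => by
    rw [hz s v (hsub v ⟨hv.1, hv.2.le.trans hds⟩) hv.2, hz s c (hsub c ⟨le_rfl, hcd⟩) hsc]
  have hright : ∀ v ∈ Icc s d, ξ v = ξ d := fun v hv => by
    rw [hU s v (hsub v ⟨hsc.le.trans hv.1, hv.2⟩) hv.1, hU s d (hsub d ⟨hcd, le_rfl⟩) hds]
  have hlim : Function.leftLim ξ s = ξ c := leftLim_eq_of_forall_mem_Ico hsc hleft
  have honly : ∀ u ∈ jumpTimes ξ x y ∩ Ioc c d, u = s := by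
    rintro u ⟨⟨hu0, hu1, hu2⟩, hu3, hu4⟩
    by_contra hne
    rcases lt_or_gt_of_ne hne with hlt | hgt
    · refine hxy ?_
      rw [← hu1, ← hu2, hleft u ⟨hu3.le, hlt⟩]
      exact leftLim_eq_of_forall_mem_Ico hu3 fun v hv => hleft v ⟨hv.1, hv.2.trans hlt⟩
    · refine hxy ?_
      rw [← hu1, ← hu2, hright u ⟨hgt.le, hu4⟩]
      exact leftLim_eq_of_forall_mem_Ico hgt fun v hv => hright v ⟨hv.1, hv.2.le.trans hu4⟩
  rw [hcount]
  by_cases hp : ξ c = x ∧ ξ d = y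
  · have : jumpTimes ξ x y ∩ Ioc c d = {s} := by
      refine Subset.antisymm honly (singleton_subset_iff.2 ⟨⟨hsc.pos, ?_, ?_⟩, hsc, hds⟩)
      · rw [hlim, hp.1]
      · rw [hright s ⟨le_rfl, hds⟩, hp.2]
    rw [this, Measure.count_singleton, indicator_of_mem (by exact hp)]
  · have : jumpTimes ξ x y ∩ Ioc c d = ∅ := by
      refine eq_empty_of_forall_notMem fun u hu => hp ?_
      have hus := honly u hu
      obtain ⟨⟨-, h1, h2⟩, -⟩ := hu
      rw [hus] at h1 h2
      exact ⟨by rw [← hlim, h1], by rw [← hright s ⟨le_rfl, hds⟩, h2]⟩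
    rw [this, measure_empty, indicator_of_notMem (by exact hp)]

/-- The points of the regular grid of mesh `h / n` starting in `a`. -/
def gridPoint (a h : ℝ≥0) (n k : ℕ) : ℝ≥0 := a + k * (h / n)

theorem gridPoint_zero (a h : ℝ≥0) (n : ℕ) : gridPoint a h n 0 = a := by simp [gridPoint]

theorem gridPoint_self (a h : ℝ≥0) {n : ℕ} (hn : n ≠ 0) : gridPoint a h n n = a + h := by
  rw [gridPoint, mul_div_cancel₀ h (Nat.cast_ne_zero.2 hn)]

theorem gridPoint_succ (a h : ℝ≥0) (n k : ℕ) :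
    gridPoint a h n (k + 1) = gridPoint a h n k + h / n := by
  simp [gridPoint, add_mul, add_assoc]

theorem monotone_gridPoint (a h : ℝ≥0) (n : ℕ) : Monotone (gridPoint a h n) :=
  monotone_nat_of_le_succ fun k => by rw [gridPoint_succ]; exact le_self_add

theorem measure_Ioc_eq_sum (μ : Measure ℝ≥0) {t : ℕ → ℝ≥0} (ht : Monotone t) (m : ℕ) :
    μ (Ioc (t 0) (t m)) = ∑ k ∈ Finset.range m, μ (Ioc (t k) (t (k + 1))) := by
  induction m with
  | zero => simp
  | succ m ih =>
    rw [Finset.sum_range_succ, ← ih, ← measure_union (Ioc_disjoint_Ioc_of_le le_rfl)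
      measurableSet_Ioc, Ioc_union_Ioc_eq_Ioc (ht (Nat.zero_le m)) (ht (Nat.le_succ m))]

/-- The number of jumps of the path `ξ` from `x` to `y` along the regular grid. -/
def gridCount (ξ : ℝ≥0 → 𝒳) (a h : ℝ≥0) (x y : 𝒳) (n : ℕ) : ℝ≥0∞ :=
  ∑ k ∈ Finset.range n, {p : 𝒳 × 𝒳 | p.1 = x ∧ p.2 = y}.indicator (fun _ => (1 : ℝ≥0∞))
    (ξ (gridPoint a h n k), ξ (gridPoint a h n (k + 1)))

theorem IsCadlagPath.eventually_gridCount_eq (hξ : IsCadlagPath ξ) (a h : ℝ≥0) :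
    ∀ᶠ n in atTop, ∀ x y, x ≠ y →
      gridCount ξ a h x y n = jumpMeasure ξ x y (Ioc a (a + h)) := by
  obtain ⟨δ, hδ, H⟩ := hξ.exists_jumpMeasure_Ioc (a + h)
  have hlim : Tendsto (fun n : ℕ => (h : ℝ) / n) atTop (𝓝 0) :=
    tendsto_const_div_atTop_nhds_zero_nat _
  filter_upwards [hlim.eventually_lt_const hδ, eventually_ne_atTop 0] with n hn hn0 x y hxy
  have hm := monotone_gridPoint a h n
  have := measure_Ioc_eq_sum (jumpMeasure ξ x y) hm n
  rw [gridPoint_zero, gridPoint_self a h hn0] at this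
  rw [this, gridCount]
  refine Finset.sum_congr rfl fun k hk => ?_
  refine (H _ _ (hm (Nat.le_succ k)) ?_ ?_ x y hxy).symm
  · exact (hm (Finset.mem_range.1 hk)).trans_eq (gridPoint_self a h hn0)
  · rw [gridPoint_succ, NNReal.dist_eq]
    push_cast
    rw [sub_add_cancel_left, abs_neg, abs_of_nonneg (by positivity)]
    exact hn

theorem IsCadlagPath.jumpMeasure_Ioc_ne_top (hξ : IsCadlagPath ξ) (a h : ℝ≥0) {x y : 𝒳}
    (hxy : x ≠ y) : jumpMeasure ξ x y (Ioc a (a + h)) ≠ ∞ := by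
  obtain ⟨n, hn⟩ := (hξ.eventually_gridCount_eq a h).exists
  rw [← hn x y hxy, gridCount]
  refine ENNReal.sum_ne_top.2 fun k _ => ?_
  by_cases hp : (ξ (gridPoint a h n k), ξ (gridPoint a h n (k + 1)))
    ∈ {p : 𝒳 × 𝒳 | p.1 = x ∧ p.2 = y} <;> simp [indicator, hp]

variable [Fintype 𝒳]

open Classical in
/-- The counting measure of all the jumps of the path `ξ`. -/
def totalJumpMeasure (ξ : ℝ≥0 → 𝒳) : Measure ℝ≥0 :=
  ∑ p ∈ (Finset.univ : Finset (𝒳 × 𝒳)) with p.1 ≠ p.2, jumpMeasure ξ p.1 p.2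

theorem IsCadlagPath.one_le_totalJumpMeasure (hξ : IsCadlagPath ξ) {c d : ℝ≥0} (hcd : c ≤ d)
    (hne : ξ c ≠ ξ d) : 1 ≤ totalJumpMeasure ξ (Ioc c d) := by
  classical
  obtain ⟨h, rfl⟩ := exists_add_of_le hcd
  obtain ⟨n, hn, hn0⟩ := ((hξ.eventually_gridCount_eq c h).and (eventually_ne_atTop 0)).exists
  have hstep : ∃ k < n, ξ (gridPoint c h n k) ≠ ξ (gridPoint c h n (k + 1)) := by
    by_contra! hall
    have hconst : ∀ m ≤ n, ξ (gridPoint c h n m) = ξ c := by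
      intro m hm
      induction m with
      | zero => rw [gridPoint_zero]
      | succ m ih => rw [← hall m (by omega), ih (by omega)]
    exact hne (by rw [← hconst n le_rfl, gridPoint_self c h hn0])
  obtain ⟨k, hk, hkne⟩ := hstep
  rw [totalJumpMeasure, Measure.finsetSum_apply]
  refine le_trans ?_ (Finset.single_le_sum (f := fun p : 𝒳 × 𝒳 =>
    jumpMeasure ξ p.1 p.2 (Ioc c (c + h))) (fun _ _ => zero_le)
    (Finset.mem_filter.2 ⟨Finset.mem_univ
      (ξ (gridPoint c h n k), ξ (gridPoint c h n (k + 1))), hkne⟩))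
  simp only
  rw [← hn _ _ hkne, gridCount]
  refine le_trans ?_ (Finset.single_le_sum (f := fun j =>
    {p : 𝒳 × 𝒳 | p.1 = ξ (gridPoint c h n k) ∧ p.2 = ξ (gridPoint c h n (k + 1))}.indicator
      (fun _ => (1 : ℝ≥0∞)) (ξ (gridPoint c h n j), ξ (gridPoint c h n (j + 1))))
    (fun _ _ => zero_le) (Finset.mem_range.2 hk))
  simp

/-- A grid cell whose end values differ contains at least one jump of some kind. A coarse grid may
see `x → y` where the path passed through other states, so all jumps are needed on the right; the
bound does not depend on `n` and serves as dominating function. -/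
theorem IsCadlagPath.gridCount_le_totalJumpMeasure (hξ : IsCadlagPath ξ) (a h : ℝ≥0) {x y : 𝒳}
    (hxy : x ≠ y) (n : ℕ) : gridCount ξ a h x y n ≤ totalJumpMeasure ξ (Ioc a (a + h)) := by
  rcases eq_or_ne n 0 with rfl | hn0
  · simp [gridCount]
  have := measure_Ioc_eq_sum (totalJumpMeasure ξ) (monotone_gridPoint a h n) n
  rw [gridPoint_zero, gridPoint_self a h hn0] at this
  rw [this, gridCount]
  refine Finset.sum_le_sum fun k _ => ?_
  refine indicator_apply_le' (fun hp => ?_) fun _ => zero_le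
  exact hξ.one_le_totalJumpMeasure (monotone_gridPoint a h n (Nat.le_succ k)) fun he =>
    hxy (hp.1.symm.trans (he.trans hp.2))

end Path

/-! ### The expected number of jumps -/

section Compensator

variable {𝒳 : Type*} [Fintype 𝒳] [TopologicalSpace 𝒳] [DiscreteTopology 𝒳] [MeasurableSpace 𝒳]
  [BorelSpace 𝒳] {Ω : Type*} [MeasurableSpace Ω] {P : Measure Ω} {X : ℝ≥0 → Ω → 𝒳}
  {q : ℝ → 𝒳 → 𝒳 → ℝ} {K : ℝ}

theorem IsMarkovJumpProcess.measurableSet_natural (hX : IsMarkovJumpProcess q P X) (s : ℝ≥0)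
    (B : Set 𝒳) : MeasurableSet[Filtration.natural X hX.stronglyMeasurable s] {ω | X s ω ∈ B} :=
  (Filtration.stronglyAdapted_natural hX.stronglyMeasurable s).measurable
    (Set.toFinite B).measurableSet

theorem IsMarkovJumpProcess.law_restrict (hX : IsMarkovJumpProcess q P X) (A : Set Ω) (t : ℝ)
    (y : 𝒳) : law (P.restrict A) X t y = P.real ({ω | X t.toNNReal ω = y} ∩ A) :=
  measureReal_restrict_apply (hX.measurable _ (measurableSet_singleton y))

theorem IsMarkovJumpProcess.law_restrict_self_eq_zero (hX : IsMarkovJumpProcess q P X) (s : ℝ≥0)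
    {B : Set 𝒳} {y : 𝒳} (hy : y ∉ B) : law (P.restrict {ω | X s ω ∈ B}) X s y = 0 := by
  rw [hX.law_restrict, Real.toNNReal_coe]
  convert measureReal_empty
  refine eq_empty_of_forall_notMem fun ω hω => hy ?_
  obtain ⟨h1, h2⟩ := hω
  have h1 : X s ω = y := h1
  rw [← h1]
  exact h2

theorem IsMarkovJumpProcess.intervalIntegrable_rate_mul_law [IsProbabilityMeasure P]
    (hX : IsMarkovJumpProcess q P X)
    (hqm : ∀ x y, Measurable fun s => q s x y) (hqK : ∀ s x y, |q s x y| ≤ K)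
    (x y : 𝒳) (a b : ℝ) : IntervalIntegrable (fun u => q u x y * law P X u x) volume a b := by
  have h : IntervalIntegrable (fun _ : ℝ => K * 1) volume a b := by simp
  refine h.mono_fun (((hqm x y).mul ((measurable_pi_apply x).comp
    (hX.measurable_law P))).aestronglyMeasurable) (ae_of_all _ fun u => ?_)
  refine le_trans (norm_mul_le _ _) (le_trans ?_ (le_abs_self _))
  have h1 : ‖law P X u x‖ ≤ 1 := by
    rw [Real.norm_of_nonneg (law_nonneg P X u x)]; exact measureReal_le_one
  exact mul_le_mul (hqK u x y) h1 (norm_nonneg _) ((abs_nonneg _).trans (hqK u x y))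

/-- On the event that `X s = x`, the law at a time `u` shortly after `s` is close to the mass `law P
X u x` placed at `x`, and the forward operator sends a unit mass at `x` to `q u x y` at `y ≠ x`. The
discrepancy is `O(t - s)`, and a second factor `t - s` comes from integrating over the interval. -/
theorem IsMarkovJumpProcess.abs_measureReal_sub_integral_le [IsProbabilityMeasure P]
    (hX : IsMarkovJumpProcess q P X)
    (hqm : ∀ x y, Measurable fun s => q s x y) (hK : 0 ≤ K) (hqK : ∀ s x y, |q s x y| ≤ K)
    {s t : ℝ≥0} (hst : s ≤ t) {x y : 𝒳} (hxy : x ≠ y) :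
    |P.real {ω | X s ω = x ∧ X t ω = y} - ∫ u in (s : ℝ)..t, q u x y * law P X u x|
      ≤ (2 * Fintype.card 𝒳 * K) ^ 2 * (t - s) ^ 2 := by
  classical
  set n : ℝ := 2 * Fintype.card 𝒳 * K with hn
  have hn0 : 0 ≤ n := by positivity
  have hst' : (s : ℝ) ≤ t := hst
  set A : Set Ω := {ω | X s ω ∈ ({x} : Set 𝒳)} with hA
  have hAm := hX.measurableSet_natural s {x}
  have hAcm := hX.measurableSet_natural s {x}ᶜ
  set v := law (P.restrict A) X with hv
  have hvint := (hX.intervalIntegrable_forwardOperator_law hqm hK hqK (P.restrict A) s t)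
  have h1 : P.real {ω | X s ω = x ∧ X t ω = y} = ∫ u in (s : ℝ)..t, forwardOperator (q u) (v u) y := by
    have e1 := hX.law_eq_add_integral hqm hqK hst hAm y
    rw [hX.law_restrict_self_eq_zero s (by simpa using hxy.symm), zero_add] at e1
    rw [hv, ← e1, hX.law_restrict, Real.toNNReal_coe]
    congr 1
    ext ω
    simp [and_comm]
  have hsplit (u : ℝ) (z : 𝒳) : law P X u z
      = v u z + law (P.restrict {ω | X s ω ∈ ({x} : Set 𝒳)ᶜ}) X u z := by
    have hA' := hX.measurable s (measurableSet_singleton x)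
    rw [hv, hX.law_restrict, hX.law_restrict, law]
    have := measureReal_inter_add_sdiff (μ := P) (s := {ω | X u.toNNReal ω = z}) hA'
    rw [← this]
    rfl
  set e : ℝ → 𝒳 → ℝ := fun u => v u - law P X u x • (Pi.single x 1 : 𝒳 → ℝ) with he
  have he_norm : ∀ u ∈ Icc (s : ℝ) t, ‖e u‖ ≤ n * (t - s) := by
    intro u hu
    have hu0 : 0 ≤ u := s.2.trans hu.1
    have hsu : s ≤ u.toNNReal := by rw [← NNReal.coe_le_coe, Real.coe_toNNReal u hu0]; exact hu.1
    have hle : n * (u - s) ≤ n * (t - s) :=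
      mul_le_mul_of_nonneg_left (sub_le_sub_right hu.2 _) hn0
    refine (pi_norm_le_iff_of_nonneg (mul_nonneg hn0 (sub_nonneg.2 hst'))).2 fun z => ?_
    refine le_trans ?_ hle
    rw [Real.norm_eq_abs]
    rcases eq_or_ne z x with rfl | hz
    -- At `x` itself the discrepancy is the mass now at `x` that was elsewhere at time `s`; at other
    -- states, in the next case, it is the mass that has left `x`. Both had only the time `u - s` to
    -- move.
    · have h3 := hX.law_le_mul_sub hqm hK hqK hsu hAcm (y := z)
        (hX.law_restrict_self_eq_zero s (by simp))
      rw [Real.coe_toNNReal u hu0] at h3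
      simp only [he, Pi.sub_apply, Pi.smul_apply, Pi.single_eq_same, smul_eq_mul, mul_one]
      rw [hsplit u z, sub_add_cancel_left, abs_neg, abs_of_nonneg (law_nonneg _ _ _ _)]
      exact h3
    · have h3 := hX.law_le_mul_sub hqm hK hqK hsu hAm (y := z)
        (hX.law_restrict_self_eq_zero s (by simpa using hz))
      rw [Real.coe_toNNReal u hu0] at h3
      simp only [he, Pi.sub_apply, Pi.smul_apply, Pi.single_eq_of_ne hz, smul_eq_mul, mul_zero,
        sub_zero]
      rw [abs_of_nonneg (law_nonneg _ _ _ _)]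
      exact h3
  have h2 (u : ℝ) : forwardOperator (q u) (v u) y - q u x y * law P X u x
      = forwardOperator (q u) (e u) y := by
    simp only [he, map_sub, map_smul, Pi.sub_apply, Pi.smul_apply, smul_eq_mul]
    rw [forwardOperator_apply (q u) (Pi.single x 1)]
    simp [Pi.single_apply, hxy.symm, mul_comm]
  have hi1 : IntervalIntegrable (fun u => forwardOperator (q u) (v u) y) volume s t :=
    ⟨hvint.1.eval y, hvint.2.eval y⟩
  rw [h1, ← intervalIntegral.integral_sub hi1
    (hX.intervalIntegrable_rate_mul_law hqm hqK x y s t)]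
  simp only [h2]
  have := intervalIntegral.norm_integral_le_of_norm_le_const (a := (s : ℝ)) (b := t)
    (f := fun u => forwardOperator (q u) (e u) y) (C := n * (n * (t - s))) fun u hu => ?_
  · rw [abs_of_nonneg (sub_nonneg.2 hst')] at this
    exact this.trans_eq (by ring)
  · rw [uIoc_of_le hst'] at hu
    exact (abs_forwardOperator_apply_le hK (hqK u) _ y).trans
      (mul_le_mul_of_nonneg_left (he_norm u ⟨hu.1.le, hu.2⟩) hn0)

theorem IsMarkovJumpProcess.measurable_comp_prodMk (hX : IsMarkovJumpProcess q P X)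
    (f : 𝒳 × 𝒳 → ℝ≥0∞) (s t : ℝ≥0) : Measurable fun ω => f (X s ω, X t ω) :=
  (measurable_of_countable f).comp ((hX.measurable s).prodMk (hX.measurable t))

theorem IsMarkovJumpProcess.measurable_gridCount (hX : IsMarkovJumpProcess q P X) (a h : ℝ≥0)
    (x y : 𝒳) (n : ℕ) : Measurable fun ω => gridCount (fun t => X t ω) a h x y n :=
  Finset.measurable_sum _ fun _ _ => hX.measurable_comp_prodMk _ _ _

theorem IsMarkovJumpProcess.lintegral_gridCount [IsProbabilityMeasure P]
    (hX : IsMarkovJumpProcess q P X) (a h : ℝ≥0) (x y : 𝒳) (n : ℕ) :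
    ∫⁻ ω, gridCount (fun t => X t ω) a h x y n ∂P
      = ENNReal.ofReal (∑ k ∈ Finset.range n,
        P.real {ω | X (gridPoint a h n k) ω = x ∧ X (gridPoint a h n (k + 1)) ω = y}) := by
  simp only [gridCount]
  rw [lintegral_finsetSum, ENNReal.ofReal_sum_of_nonneg fun _ _ => measureReal_nonneg]
  · refine Finset.sum_congr rfl fun k _ => ?_
    rw [ofReal_measureReal]
    have hm : MeasurableSet
        {ω | X (gridPoint a h n k) ω = x ∧ X (gridPoint a h n (k + 1)) ω = y} :=
      (hX.measurable _ (measurableSet_singleton x)).inter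
        (hX.measurable _ (measurableSet_singleton y))
    rw [← lintegral_indicator_one hm]
    rfl
  · exact fun _ _ => hX.measurable_comp_prodMk _ _ _

/-- There are `n` cells, each with an error of order `(h / n) ^ 2`, so the total error is of order
`h ^ 2 / n`. -/
theorem IsMarkovJumpProcess.tendsto_lintegral_gridCount [IsProbabilityMeasure P]
    (hX : IsMarkovJumpProcess q P X)
    (hqm : ∀ x y, Measurable fun s => q s x y) (hK : 0 ≤ K) (hqK : ∀ s x y, |q s x y| ≤ K)
    (a h : ℝ≥0) {x y : 𝒳} (hxy : x ≠ y) :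
    Tendsto (fun n => ∫⁻ ω, gridCount (fun t => X t ω) a h x y n ∂P) atTop
      (𝓝 (ENNReal.ofReal (∫ u in (a : ℝ)..(a + h : ℝ≥0), q u x y * law P X u x))) := by
  simp only [hX.lintegral_gridCount]
  refine ENNReal.tendsto_ofReal (tendsto_iff_norm_sub_tendsto_zero.2 ?_)
  set C := (2 * Fintype.card 𝒳 * K) ^ 2 with hC
  have hlim : Tendsto (fun n : ℕ => C * (h : ℝ) ^ 2 / n) atTop (𝓝 0) :=
    tendsto_const_div_atTop_nhds_zero_nat _
  refine squeeze_zero' (Eventually.of_forall fun n => norm_nonneg _) ?_ hlim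
  filter_upwards [eventually_ne_atTop 0] with n hn0
  have hsum := intervalIntegral.sum_integral_adjacent_intervals
    (a := fun k => (gridPoint a h n k : ℝ)) (n := n)
    (fun k _ => hX.intervalIntegrable_rate_mul_law hqm hqK x y _ _)
  rw [gridPoint_zero, gridPoint_self a h hn0] at hsum
  rw [← hsum, ← Finset.sum_sub_distrib]
  refine (norm_sum_le _ _).trans ?_
  refine (Finset.sum_le_card_nsmul _ _ (C * ((h : ℝ) / n) ^ 2) fun k _ => ?_).trans_eq ?_
  · refine (hX.abs_measureReal_sub_integral_le hqm hK hqK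
      (monotone_gridPoint a h n (Nat.le_succ k)) hxy).trans_eq ?_
    rw [Nat.succ_eq_add_one, gridPoint_succ]
    push_cast
    rw [add_sub_cancel_left]
  · have : (n : ℝ) ≠ 0 := Nat.cast_ne_zero.2 hn0
    rw [Finset.card_range, nsmul_eq_mul]
    field_simp

theorem IsMarkovJumpProcess.tendsto_gridCount (hX : IsMarkovJumpProcess q P X) (a h : ℝ≥0)
    {x y : 𝒳} (hxy : x ≠ y) (ω : Ω) :
    Tendsto (fun n => gridCount (fun t => X t ω) a h x y n) atTop
      (𝓝 (jumpMeasure (fun t => X t ω) x y (Ioc a (a + h)))) :=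
  tendsto_const_nhds.congr' <| ((hX.cadlag ω).eventually_gridCount_eq a h).mono
    fun _ hn => (hn x y hxy).symm

theorem IsMarkovJumpProcess.measurable_jumpMeasure_Ioc (hX : IsMarkovJumpProcess q P X)
    (a h : ℝ≥0) {x y : 𝒳} (hxy : x ≠ y) :
    Measurable fun ω => jumpMeasure (fun t => X t ω) x y (Ioc a (a + h)) :=
  measurable_of_tendsto_metrizable (hX.measurable_gridCount a h x y)
    (tendsto_pi_nhds.2 fun ω => hX.tendsto_gridCount a h hxy ω)

/-- The expected number of jumps from `x` to `y` during a time interval. -/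
theorem IsMarkovJumpProcess.lintegral_jumpMeasure_Ioc [IsProbabilityMeasure P]
    (hX : IsMarkovJumpProcess q P X)
    (hqm : ∀ x y, Measurable fun s => q s x y) (hK : 0 ≤ K) (hqK : ∀ s x y, |q s x y| ≤ K)
    (a h : ℝ≥0) {x y : 𝒳} (hxy : x ≠ y) :
    ∫⁻ ω, jumpMeasure (fun t => X t ω) x y (Ioc a (a + h)) ∂P
      = ENNReal.ofReal (∫ u in (a : ℝ)..(a + h : ℝ≥0), q u x y * law P X u x) := by
  classical
  -- Fatou first gives a finite mean for each kind of jump. Hence the total number of jumps is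
  -- integrable and dominates the grid counts, and dominated convergence then yields equality.
  have hfin {x y : 𝒳} (hxy : x ≠ y) :
      ∫⁻ ω, jumpMeasure (fun t => X t ω) x y (Ioc a (a + h)) ∂P ≠ ∞ := by
    have h1 : ∫⁻ ω, jumpMeasure (fun t => X t ω) x y (Ioc a (a + h)) ∂P
        ≤ ENNReal.ofReal (∫ u in (a : ℝ)..(a + h : ℝ≥0), q u x y * law P X u x) := by
      calc ∫⁻ ω, jumpMeasure (fun t => X t ω) x y (Ioc a (a + h)) ∂P
          = ∫⁻ ω, liminf (fun n => gridCount (fun t => X t ω) a h x y n) atTop ∂P :=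
            lintegral_congr fun ω => (hX.tendsto_gridCount a h hxy ω).liminf_eq.symm
        _ ≤ liminf (fun n => ∫⁻ ω, gridCount (fun t => X t ω) a h x y n ∂P) atTop :=
            lintegral_liminf_le fun n => hX.measurable_gridCount a h x y n
        _ = _ := (hX.tendsto_lintegral_gridCount hqm hK hqK a h hxy).liminf_eq
    exact (h1.trans_lt ENNReal.ofReal_lt_top).ne
  refine tendsto_nhds_unique (tendsto_lintegral_of_dominated_convergence
    (fun ω => totalJumpMeasure (fun t => X t ω) (Ioc a (a + h)))
    (hX.measurable_gridCount a h x y)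
    (fun n => ae_of_all _ fun ω => (hX.cadlag ω).gridCount_le_totalJumpMeasure a h hxy n) ?_
    (ae_of_all _ fun ω => hX.tendsto_gridCount a h hxy ω))
    (hX.tendsto_lintegral_gridCount hqm hK hqK a h hxy)
  simp only [totalJumpMeasure, Measure.finsetSum_apply]
  rw [lintegral_finsetSum _ fun p hp =>
    hX.measurable_jumpMeasure_Ioc a h (Finset.mem_filter.1 hp).2]
  exact ENNReal.sum_ne_top.2 fun p hp => hfin (Finset.mem_filter.1 hp).2

end Compensator

/-! ### Jump sums as integrals against random measures, and their intensity -/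

/-- The mean of the integrals of `f` with respect to a random measure. -/
theorem integrable_integral_of_integrable_bind {Ω S : Type*} [MeasurableSpace Ω]
    [MeasurableSpace S] {P : Measure Ω} {J : Ω → Measure S} (hJ : Measurable J) {f : S → ℝ}
    (hf : Measurable f) (hfJ : ∀ ω, Integrable f (J ω)) (hfi : Integrable f (P.bind J)) :
    Integrable (fun ω => ∫ s, f s ∂J ω) P ∧
      ∫ ω, (∫ s, f s ∂J ω) ∂P = ∫ s, f s ∂P.bind J := by
  -- Disintegration of `P.bind J` is applied to nonnegative integrals, hence separately to the
  -- positive and negative parts of `f`.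
  have key (g : S → ℝ) (hg : Measurable g) (hgi : Integrable g (P.bind J)) :
      Measurable (fun ω => ∫⁻ s, ENNReal.ofReal (g s) ∂J ω) ∧
      ∫⁻ ω, ∫⁻ s, ENNReal.ofReal (g s) ∂J ω ∂P = ∫⁻ s, ENNReal.ofReal (g s) ∂P.bind J ∧
      ∫⁻ s, ENNReal.ofReal (g s) ∂P.bind J ≠ ∞ := by
    refine ⟨(Measure.measurable_lintegral hg.ennreal_ofReal).comp hJ, ?_, ?_⟩
    · exact (Measure.lintegral_bind hJ.aemeasurable hg.ennreal_ofReal.aemeasurable).symm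
    · exact hgi.lintegral_lt_top.ne
  obtain ⟨m1, e1, n1⟩ := key f hf hfi
  obtain ⟨m2, e2, n2⟩ := key (fun s => -f s) hf.neg hfi.neg
  have hint (ω : Ω) : ∫ s, f s ∂J ω = (∫⁻ s, ENNReal.ofReal (f s) ∂J ω).toReal
      - (∫⁻ s, ENNReal.ofReal (-f s) ∂J ω).toReal :=
    integral_eq_lintegral_pos_part_sub_lintegral_neg_part (hfJ ω)
  have i1 := integrable_toReal_of_lintegral_ne_top m1.aemeasurable (e1 ▸ n1)
  have i2 := integrable_toReal_of_lintegral_ne_top m2.aemeasurable (e2 ▸ n2)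
  simp only [hint]
  refine ⟨i1.sub i2, ?_⟩
  rw [integral_sub i1 i2, integral_toReal m1.aemeasurable (ae_lt_top m1 (e1 ▸ n1)),
    integral_toReal m2.aemeasurable (ae_lt_top m2 (e2 ▸ n2)), e1, e2]
  exact (integral_eq_lintegral_pos_part_sub_lintegral_neg_part hfi).symm

section JumpSum

variable {𝒳 : Type*} [TopologicalSpace 𝒳]

/-- The counting measure, on the real line, of the jumps from `x` to `y` up to time `t`. -/
def stoppedJumpMeasure (ξ : ℝ≥0 → 𝒳) (t : ℝ≥0) (x y : 𝒳) : Measure ℝ :=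
  ((jumpMeasure ξ x y).restrict (Ioc 0 t)).map (fun s : ℝ≥0 => (s : ℝ))

theorem stoppedJumpMeasure_Ioc (ξ : ℝ≥0 → 𝒳) (t : ℝ≥0) (x y : 𝒳) (a b : ℝ) :
    stoppedJumpMeasure ξ t x y (Ioc a b)
      = jumpMeasure ξ x y (Ioc a.toNNReal (min b.toNNReal t)) := by
  rw [stoppedJumpMeasure, Measure.map_apply measurable_coe_nnreal_real measurableSet_Ioc,
    Measure.restrict_apply (measurable_coe_nnreal_real measurableSet_Ioc)]
  congr 1
  ext s
  simp only [mem_inter_iff, mem_preimage, mem_Ioc, le_min_iff]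
  constructor
  · rintro ⟨⟨h1, h2⟩, h3, h4⟩
    exact ⟨by rw [← NNReal.coe_lt_coe, Real.coe_toNNReal']; exact max_lt h1 h3,
      (NNReal.le_toNNReal_of_coe_le h2), h4⟩
  · rintro ⟨h1, h2, h4⟩
    have h0 : 0 < s := zero_le.trans_lt h1
    have hb : (s : ℝ) ≤ b := (Real.le_toNNReal_iff_coe_le' h0).1 h2
    exact ⟨⟨(Real.le_coe_toNNReal a).trans_lt (NNReal.coe_lt_coe.2 h1), hb⟩, h0, h4⟩

theorem stoppedJumpMeasure_univ (ξ : ℝ≥0 → 𝒳) (t : ℝ≥0) (x y : 𝒳) :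
    stoppedJumpMeasure ξ t x y univ = jumpMeasure ξ x y (Ioc 0 t) := by
  rw [stoppedJumpMeasure, Measure.map_apply measurable_coe_nnreal_real .univ]
  simp

variable [DiscreteTopology 𝒳] {ξ : ℝ≥0 → 𝒳}

theorem IsCadlagPath.isFiniteMeasure_stoppedJumpMeasure (hξ : IsCadlagPath ξ) (t : ℝ≥0) {x y : 𝒳}
    (hxy : x ≠ y) : IsFiniteMeasure (stoppedJumpMeasure ξ t x y) := by
  refine ⟨?_⟩
  have := hξ.jumpMeasure_Ioc_ne_top 0 t hxy
  rw [zero_add] at this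
  rw [stoppedJumpMeasure_univ]
  exact this.lt_top

theorem IsCadlagPath.finite_jumpTimes (hξ : IsCadlagPath ξ) (t : ℝ≥0) {x y : 𝒳} (hxy : x ≠ y) :
    (jumpTimes ξ x y ∩ Ioc 0 t).Finite := by
  have := hξ.jumpMeasure_Ioc_ne_top 0 t hxy
  rw [zero_add, jumpMeasure, Measure.restrict_apply measurableSet_Ioc, inter_comm] at this
  exact Measure.count_apply_lt_top.1 this.lt_top

theorem IsCadlagPath.integral_stoppedJumpMeasure (hξ : IsCadlagPath ξ) (t : ℝ≥0) {x y : 𝒳}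
    (hxy : x ≠ y) {f : ℝ → ℝ} (hf : Measurable f) :
    Integrable f (stoppedJumpMeasure ξ t x y) ∧
    ∫ s, f s ∂stoppedJumpMeasure ξ t x y
      = ∑ s ∈ (hξ.finite_jumpTimes t hxy).toFinset, f s := by
  have hfin := hξ.finite_jumpTimes t hxy
  have e : (jumpMeasure ξ x y).restrict (Ioc 0 t)
      = Measure.count.restrict (hfin.toFinset : Set ℝ≥0) := by
    rw [jumpMeasure, Measure.restrict_restrict measurableSet_Ioc, inter_comm, hfin.coe_toFinset]
  have hi : IntegrableOn (fun s : ℝ≥0 => f s) (hfin.toFinset : Set ℝ≥0) Measure.count := by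
    have hr : IsFiniteMeasure (Measure.count.restrict (hfin.toFinset : Set ℝ≥0)) :=
      ⟨by rw [Measure.restrict_apply_univ]; exact Measure.count_apply_lt_top.2 (Finset.finite_toSet _)⟩
    have : IntegrableOn (fun s : ℝ≥0 => f s) (hfin.toFinset : Set ℝ≥0)
        (Measure.count.restrict (hfin.toFinset : Set ℝ≥0)) := IntegrableOn.finset
    rwa [IntegrableOn, Measure.restrict_restrict (Finset.measurableSet _), inter_self] at this
  constructor
  · rw [stoppedJumpMeasure, integrable_map_measure hf.aestronglyMeasurable
      measurable_coe_nnreal_real.aemeasurable, e]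
    exact hi
  · rw [stoppedJumpMeasure, integral_map measurable_coe_nnreal_real.aemeasurable
      hf.aestronglyMeasurable, e, setIntegral_finset _ hi]
    refine Finset.sum_congr rfl fun s _ => ?_
    simp [measureReal_def]

-- The finitely many jump times are grouped by the pair formed by the left limit and the value; each
-- group is the support of one of the counting measures.
open Classical in
theorem IsCadlagPath.jumpSum_eq [Fintype 𝒳] (hξ : IsCadlagPath ξ) (t : ℝ≥0)
    {α : ℝ → 𝒳 → 𝒳 → ℝ} (hα : ∀ x y, Measurable fun s => α s x y) :
    jumpSum α t ξ = ∑ p ∈ (Finset.univ : Finset (𝒳 × 𝒳)) with p.1 ≠ p.2,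
      ∫ s, α s p.1 p.2 ∂stoppedJumpMeasure ξ t p.1 p.2 := by
  set D : Set ℝ≥0 := {s | 0 < s ∧ s ≤ t ∧ Function.leftLim ξ s ≠ ξ s} with hD
  have hDfin : D.Finite := by
    refine (Finite.biUnion (Finset.finite_toSet
      ((Finset.univ : Finset (𝒳 × 𝒳)).filter fun p => p.1 ≠ p.2)) fun p hp =>
      hξ.finite_jumpTimes t (Finset.mem_filter.1 hp).2).subset fun s hs => ?_
    exact mem_biUnion (x := (Function.leftLim ξ s, ξ s)) (by simpa using hs.2.2)
      ⟨⟨hs.1, rfl, rfl⟩, hs.1, hs.2.1⟩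
  rw [jumpSum, ← hD, finsum_mem_eq_finite_toFinset_sum _ hDfin,
    ← Finset.sum_fiberwise_of_maps_to (t := (Finset.univ : Finset (𝒳 × 𝒳)).filter
      fun p => p.1 ≠ p.2) (g := fun s => (Function.leftLim ξ s, ξ s))]
  · refine Finset.sum_congr rfl fun p hp => ?_
    have hne := (Finset.mem_filter.1 hp).2
    rw [(hξ.integral_stoppedJumpMeasure t hne (hα p.1 p.2)).2]
    refine Finset.sum_congr ?_ fun s hs => ?_
    · ext s
      simp only [Finset.mem_filter, Finite.mem_toFinset, hD, jumpTimes, mem_ofPred_eq,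
        mem_inter_iff, mem_Ioc, Prod.ext_iff]
      constructor
      · rintro ⟨⟨h1, h2, h3⟩, h4, h5⟩
        exact ⟨⟨h1, h4, h5⟩, h1, h2⟩
      · rintro ⟨⟨h1, h4, h5⟩, -, h2⟩
        exact ⟨⟨h1, h2, by rw [h4, h5]; exact hne⟩, h4, h5⟩
    · obtain ⟨⟨-, h1, h2⟩, -⟩ := (hξ.finite_jumpTimes t hne).mem_toFinset.1 hs
      rw [h1, h2]
  · intro s hs
    rw [hDfin.mem_toFinset] at hs
    simpa using hs.2.2

end JumpSum

section Compensator

variable {𝒳 : Type*} [Fintype 𝒳] [TopologicalSpace 𝒳] [DiscreteTopology 𝒳] [MeasurableSpace 𝒳]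
  [BorelSpace 𝒳] {Ω : Type*} [MeasurableSpace Ω] {P : Measure Ω} {X : ℝ≥0 → Ω → 𝒳}
  {q : ℝ → 𝒳 → 𝒳 → ℝ} {K : ℝ}

theorem IsMarkovJumpProcess.measurable_jumpMeasure_Ioc' (hX : IsMarkovJumpProcess q P X)
    (a b : ℝ≥0) {x y : 𝒳} (hxy : x ≠ y) :
    Measurable fun ω => jumpMeasure (fun t => X t ω) x y (Ioc a b) := by
  rcases le_total a b with hab | hab
  · obtain ⟨h, rfl⟩ := exists_add_of_le hab
    exact hX.measurable_jumpMeasure_Ioc a h hxy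
  · simp [Ioc_eq_empty_of_le hab]

theorem IsMarkovJumpProcess.lintegral_jumpMeasure_Ioc' [IsProbabilityMeasure P]
    (hX : IsMarkovJumpProcess q P X) (hqm : ∀ x y, Measurable fun s => q s x y)
    (hq0 : ∀ s x y, 0 ≤ q s x y) (hK : 0 ≤ K) (hqK : ∀ s x y, |q s x y| ≤ K)
    (a b : ℝ≥0) {x y : 𝒳} (hxy : x ≠ y) :
    ∫⁻ ω, jumpMeasure (fun t => X t ω) x y (Ioc a b) ∂P
      = ∫⁻ u in Ioc (a : ℝ) b, ENNReal.ofReal (q u x y * law P X u x) := by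
  rcases le_total a b with hab | hab
  · obtain ⟨h, rfl⟩ := exists_add_of_le hab
    rw [hX.lintegral_jumpMeasure_Ioc hqm hK hqK a h hxy,
      intervalIntegral.integral_of_le (NNReal.coe_le_coe.2 hab),
      ofReal_integral_eq_lintegral_ofReal
        (hX.intervalIntegrable_rate_mul_law hqm hqK x y a (a + h : ℝ≥0)).1
        (ae_of_all _ fun u => mul_nonneg (hq0 u x y) (law_nonneg P X u x))]
  · rw [Ioc_eq_empty_of_le hab, Ioc_eq_empty_of_le (NNReal.coe_le_coe.2 hab)]
    simp

theorem IsMarkovJumpProcess.measurable_stoppedJumpMeasure (hX : IsMarkovJumpProcess q P X)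
    (t : ℝ≥0) {x y : 𝒳} (hxy : x ≠ y) :
    Measurable fun ω => stoppedJumpMeasure (fun t => X t ω) t x y := by
  have (ω : Ω) : IsFiniteMeasure (stoppedJumpMeasure (fun t => X t ω) t x y) :=
    (hX.cadlag ω).isFiniteMeasure_stoppedJumpMeasure t hxy
  refine Measurable.measure_of_isPiSystem ((BorelSpace.measurable_eq (α := ℝ)).trans
    (borel_eq_generateFrom_Ioc ℝ)) (isPiSystem_Ioc id id) ?_ ?_
  · rintro _ ⟨a, b, -, rfl⟩
    simp only [stoppedJumpMeasure_Ioc]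
    exact hX.measurable_jumpMeasure_Ioc' _ _ hxy
  · simp only [stoppedJumpMeasure_univ]
    exact hX.measurable_jumpMeasure_Ioc' _ _ hxy

/-- The intensity measure of the jumps from `x` to `y`. -/
theorem IsMarkovJumpProcess.bind_stoppedJumpMeasure [IsProbabilityMeasure P]
    (hX : IsMarkovJumpProcess q P X) (hqm : ∀ x y, Measurable fun s => q s x y)
    (hq0 : ∀ s x y, 0 ≤ q s x y) (hK : 0 ≤ K) (hqK : ∀ s x y, |q s x y| ≤ K)
    (t : ℝ≥0) {x y : 𝒳} (hxy : x ≠ y) :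
    P.bind (fun ω => stoppedJumpMeasure (fun t => X t ω) t x y)
      = (volume.restrict (Ioc (0 : ℝ) t)).withDensity
        fun u => ENNReal.ofReal (q u x y * law P X u x) := by
  have hJ := hX.measurable_stoppedJumpMeasure t hxy
  have huniv : P.bind (fun ω => stoppedJumpMeasure (fun t => X t ω) t x y) univ
      = ∫⁻ u in Ioc (0 : ℝ) t, ENNReal.ofReal (q u x y * law P X u x) := by
    rw [Measure.bind_apply .univ hJ.aemeasurable]
    simp only [stoppedJumpMeasure_univ]
    exact hX.lintegral_jumpMeasure_Ioc' hqm hq0 hK hqK 0 t hxy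
  have hfin : IsFiniteMeasure (P.bind (fun ω => stoppedJumpMeasure (fun t => X t ω) t x y)) := by
    refine ⟨?_⟩
    rw [huniv]
    exact (hX.intervalIntegrable_rate_mul_law hqm hqK x y 0 t).1.lintegral_lt_top
  -- Finite measures on the line are determined by their total mass and their values on half-open
  -- intervals, which the expected jump counts provide.
  refine Measure.ext_of_Ioc_finite _ _ ?_ fun a b _ => ?_
  · rw [huniv, withDensity_apply _ .univ, Measure.restrict_univ]
  · rw [Measure.bind_apply measurableSet_Ioc hJ.aemeasurable,
      withDensity_apply _ measurableSet_Ioc, Measure.restrict_restrict measurableSet_Ioc]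
    simp only [stoppedJumpMeasure_Ioc]
    rw [hX.lintegral_jumpMeasure_Ioc' hqm hq0 hK hqK _ _ hxy]
    congr 2
    rw [Ioc_inter_Ioc, NNReal.coe_min, Real.coe_toNNReal', Real.coe_toNNReal']
    ext u
    simp only [mem_Ioc, sup_lt_iff, le_inf_iff, le_max_iff]
    constructor
    · rintro ⟨⟨h1, h2⟩, h3, h4⟩
      exact ⟨⟨h1, h2⟩, h3.resolve_right (not_le.2 h2), h4⟩
    · rintro ⟨h1, h3, h4⟩
      exact ⟨h1, Or.inl h3, h4⟩

open Classical in
/-- The mean of an additive functional of the jumps. -/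
theorem IsMarkovJumpProcess.integral_jumpSum [IsProbabilityMeasure P]
    (hX : IsMarkovJumpProcess q P X) (hqm : ∀ x y, Measurable fun s => q s x y)
    (hq0 : ∀ s x y, 0 ≤ q s x y) (hK : 0 ≤ K) (hqK : ∀ s x y, |q s x y| ≤ K)
    (t : ℝ≥0) {α : ℝ → 𝒳 → 𝒳 → ℝ} (hα : ∀ x y, Measurable fun s => α s x y)
    (hαi : ∀ x y, x ≠ y → IntegrableOn (fun s => α s x y * (q s x y * law P X s x)) (Ioc 0 (t : ℝ))) :
    Integrable (fun ω => jumpSum α t fun s => X s ω) P ∧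
    ∫ ω, jumpSum α t (fun s => X s ω) ∂P
      = ∑ p ∈ (Finset.univ : Finset (𝒳 × 𝒳)) with p.1 ≠ p.2,
        ∫ s in (0 : ℝ)..t, α s p.1 p.2 * (q s p.1 p.2 * law P X s p.1) := by
  have hdens (x y : 𝒳) : Measurable fun u => (q u x y * law P X u x).toNNReal :=
    ((hqm x y).mul ((measurable_pi_apply x).comp (hX.measurable_law P))).real_toNNReal
  have key (p : 𝒳 × 𝒳) (hp : p ∈ (Finset.univ : Finset (𝒳 × 𝒳)).filter fun p => p.1 ≠ p.2) :
      Integrable (fun ω => ∫ s, α s p.1 p.2 ∂stoppedJumpMeasure (fun t => X t ω) t p.1 p.2) P ∧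
      ∫ ω, (∫ s, α s p.1 p.2 ∂stoppedJumpMeasure (fun t => X t ω) t p.1 p.2) ∂P
        = ∫ s in (0 : ℝ)..t, α s p.1 p.2 * (q s p.1 p.2 * law P X s p.1) := by
    have hne := (Finset.mem_filter.1 hp).2
    have e : P.bind (fun ω => stoppedJumpMeasure (fun t => X t ω) t p.1 p.2)
        = (volume.restrict (Ioc (0 : ℝ) t)).withDensity
          fun u => ((q u p.1 p.2 * law P X u p.1).toNNReal : ℝ≥0∞) :=
      hX.bind_stoppedJumpMeasure hqm hq0 hK hqK t hne
    have hsm (s : ℝ) : (q s p.1 p.2 * law P X s p.1).toNNReal • α s p.1 p.2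
        = α s p.1 p.2 * (q s p.1 p.2 * law P X s p.1) := by
      rw [NNReal.smul_def, Real.coe_toNNReal _ (mul_nonneg (hq0 _ _ _) (law_nonneg _ _ _ _)),
        smul_eq_mul, mul_comm]
    have := integrable_integral_of_integrable_bind (P := P) (hX.measurable_stoppedJumpMeasure t hne)
      (hα p.1 p.2)
      (fun ω => ((hX.cadlag ω).integral_stoppedJumpMeasure t hne (hα p.1 p.2)).1) ?_
    · refine ⟨this.1, this.2.trans ?_⟩
      rw [e, integral_withDensity_eq_integral_smul (hdens p.1 p.2),
        intervalIntegral.integral_of_le t.coe_nonneg]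
      simp only [hsm]
    · rw [e, integrable_withDensity_iff_integrable_smul (hdens p.1 p.2)]
      simp only [hsm]
      exact hαi p.1 p.2 hne
  have hsum (ω : Ω) := (hX.cadlag ω).jumpSum_eq t hα
  simp only [hsum]
  refine ⟨integrable_finsetSum _ fun p hp => (key p hp).1, ?_⟩
  rw [integral_finsetSum _ fun p hp => (key p hp).1]
  exact Finset.sum_congr rfl fun p hp => (key p hp).2

end Compensator

/-! ### Differentiation at zero from quadratic remainder bounds -/

theorem hasDerivAt_zero_of_norm_sub_le {V : Type*} [NormedAddCommGroup V] [NormedSpace ℝ V]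
    {F : ℝ → V} {D : V} {C : ℝ} (h : ∀ l, |l| ≤ 1 → ‖F l - F 0 - l • D‖ ≤ C * l ^ 2) :
    HasDerivAt F D 0 := by
  rw [hasDerivAt_iff_isLittleO_nhds_zero]
  have h1 : (fun l : ℝ => F (0 + l) - F 0 - l • D) =O[𝓝 0] fun l => l ^ 2 := by
    refine Asymptotics.IsBigO.of_bound C ?_
    filter_upwards [Metric.ball_mem_nhds (0 : ℝ) one_pos] with l hl
    rw [zero_add, norm_pow, Real.norm_eq_abs, sq_abs]
    exact h l (by simpa using hl : |l| < 1).le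
  exact h1.trans_isLittleO (by simpa using Asymptotics.isLittleO_pow_id (𝕜 := ℝ) one_lt_two)

theorem intervalIntegrable_smul_of_bound {V : Type*} [NormedAddCommGroup V] [NormedSpace ℝ V]
    {a b B : ℝ} (hab : a ≤ b) {k : ℝ → V} (hk : IntervalIntegrable k volume a b) {G : ℝ → ℝ}
    (hG : Measurable G) (hB : ∀ s ∈ Icc a b, |G s| ≤ B) :
    IntervalIntegrable (fun s => G s • k s) volume a b := by
  refine (hk.smul B).mono_fun (hG.aestronglyMeasurable.smul ?_) ?_
  · rw [uIoc_of_le hab]; exact hk.1.aestronglyMeasurable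
  · refine (ae_restrict_iff' measurableSet_uIoc).2 (ae_of_all _ fun s hs => ?_)
    rw [uIoc_of_le hab] at hs
    change ‖G s • k s‖ ≤ ‖B • k s‖
    rw [norm_smul, norm_smul]
    exact mul_le_mul_of_nonneg_right ((hB s ⟨hs.1.le, hs.2⟩).trans (le_abs_self B)) (norm_nonneg _)

/-- The remainder is quadratic uniformly in `s`, so integrating it against the merely integrable
weight `k` keeps it quadratic. -/
theorem hasDerivAt_integral_smul {V : Type*} [NormedAddCommGroup V] [NormedSpace ℝ V]
    {a b C B' : ℝ} (hab : a ≤ b) {k : ℝ → V} (hk : IntervalIntegrable k volume a b)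
    {G : ℝ → ℝ → ℝ} {G' : ℝ → ℝ} {B : ℝ → ℝ} (hG : ∀ l, Measurable (G l))
    (hB : ∀ l, ∀ s ∈ Icc a b, |G l s| ≤ B l) (hG' : Measurable G')
    (hB' : ∀ s ∈ Icc a b, |G' s| ≤ B')
    (h : ∀ l, |l| ≤ 1 → ∀ s ∈ Icc a b, |G l s - G 0 s - l * G' s| ≤ C * l ^ 2) :
    HasDerivAt (fun l => ∫ s in a..b, G l s • k s) (∫ s in a..b, G' s • k s) 0 := by
  refine hasDerivAt_zero_of_norm_sub_le (C := C * ∫ s in a..b, ‖k s‖) fun l hl => ?_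
  have hi (l : ℝ) := intervalIntegrable_smul_of_bound hab hk (hG l) (hB l)
  have hi' := intervalIntegrable_smul_of_bound hab hk hG' hB'
  have hil : IntervalIntegrable (fun s => l • G' s • k s) volume a b := hi'.smul l
  have e : (∫ s in a..b, G l s • k s) - (∫ s in a..b, G 0 s • k s) - l • ∫ s in a..b, G' s • k s
      = ∫ s in a..b, (G l s - G 0 s - l * G' s) • k s := by
    rw [← intervalIntegral.integral_sub (hi l) (hi 0), ← intervalIntegral.integral_smul,
      ← intervalIntegral.integral_sub ((hi l).sub (hi 0)) hil]
    refine intervalIntegral.integral_congr fun s _ => ?_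
    simp only [sub_smul, mul_smul]
  rw [e]
  have := intervalIntegral.norm_integral_le_of_norm_le hab
    (f := fun s => (G l s - G 0 s - l * G' s) • k s) (g := fun s => C * l ^ 2 * ‖k s‖)
    (ae_of_all _ fun s hs => by
      rw [norm_smul]
      exact mul_le_mul_of_nonneg_right (h l hl s ⟨hs.1.le, hs.2⟩) (norm_nonneg _))
    (hk.norm.const_mul _)
  rw [intervalIntegral.integral_const_mul] at this
  exact this.trans_eq (by ring)

/-! ### Fourier coefficients of a convolution -/

section Fourier

theorem exp_neg_add_period {T : ℝ} (hT : 0 < T) (k : ℤ) (t : ℝ) :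
    Complex.exp (-(Complex.I * k * (2 * Real.pi / T : ℝ) * (t + T : ℝ)))
      = Complex.exp (-(Complex.I * k * (2 * Real.pi / T : ℝ) * t)) := by
  have hT' : (T : ℂ) ≠ 0 := Complex.ofReal_ne_zero.2 hT.ne'
  have : -(Complex.I * k * (2 * Real.pi / T : ℝ) * (t + T : ℝ))
      = -(Complex.I * k * (2 * Real.pi / T : ℝ) * t) - k * (2 * Real.pi * Complex.I) := by
    push_cast
    field_simp
    ring
  rw [this, Complex.exp_sub, Complex.exp_int_mul_two_pi_mul_I, div_one]

theorem norm_exp_neg_I_mul (k : ℤ) (ω t : ℝ) :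
    ‖Complex.exp (-(Complex.I * k * (ω : ℝ) * t))‖ = 1 := by
  have : -(Complex.I * k * (ω : ℝ) * t) = ((-(k * ω * t) : ℝ) : ℂ) * Complex.I := by
    push_cast; ring
  rw [this, Complex.norm_exp_ofReal_mul_I]

/-- The Fourier coefficients of the convolution of a periodic function and a function on the half
line. -/
theorem fourierCoefficient_convolution {T : ℝ} (hT : 0 < T) {τ : ℝ → ℝ} (hτ : Measurable τ) {c : ℝ}
    (hτc : ∀ s, |τ s| ≤ c) (hτT : Function.Periodic τ T) {g : ℝ → ℝ} (hg : IntegrableOn g (Ioi 0))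
    (k : ℤ) :
    IntegrableOn (fun s : ℝ => fourierCoefficient T k τ *
        Complex.exp (-(Complex.I * k * (2 * Real.pi / T : ℝ) * s)) * (g s : ℂ)) (Ioi 0) ∧
      fourierCoefficient T k (fun t => ∫ s in Ioi (0 : ℝ), τ (t - s) * g s)
        = ∫ s in Ioi (0 : ℝ), fourierCoefficient T k τ *
          Complex.exp (-(Complex.I * k * (2 * Real.pi / T : ℝ) * s)) * (g s : ℂ) := by
  set e : ℝ → ℂ := fun t => Complex.exp (-(Complex.I * k * (2 * Real.pi / T : ℝ) * t)) with he
  have he1 (t : ℝ) : ‖e t‖ = 1 := norm_exp_neg_I_mul k _ t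
  have hec : Continuous e := by simp only [he]; fun_prop
  have headd (s t : ℝ) : e (s + t) = e s * e t := by
    simp only [he, ← Complex.exp_add]; congr 1; push_cast; ring
  have hgC : Integrable (fun s => (g s : ℂ)) (volume.restrict (Ioi 0)) := hg.ofReal
  have hmain : Integrable (fun s => e s * (g s : ℂ)) (volume.restrict (Ioi 0)) := by
    refine hgC.norm.mono' (hec.aestronglyMeasurable.mul hgC.aestronglyMeasurable)
      (ae_of_all _ fun s => ?_)
    rw [norm_mul, he1, one_mul]
  constructor
  · have := hmain.const_mul (fourierCoefficient T k τ)
    simp only [← mul_assoc] at this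
    exact this
  · have hper : Function.Periodic (fun t => e t * (τ t : ℂ)) T := fun t => by
      simp only [he]; rw [exp_neg_add_period hT, hτT]
    -- The exponential is multiplicative, so translating `τ` by `s` produces the factor `e s`;
    -- periodicity moves the shifted window back to one period.
    have hinner (s : ℝ) : ∫ t in (0 : ℝ)..T, e t * ((τ (t - s) : ℝ) : ℂ)
        = e s * ∫ t in (0 : ℝ)..T, e t * (τ t : ℂ) := by
      have h1 (t : ℝ) : e t * ((τ (t - s) : ℝ) : ℂ) = e s * (e (t - s) * (τ (t - s) : ℂ)) := by
        rw [← mul_assoc, ← headd, add_sub_cancel]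
      simp only [h1, intervalIntegral.integral_const_mul]
      rw [intervalIntegral.integral_comp_sub_right (fun t => e t * (τ t : ℂ)) s]
      have := hper.intervalIntegral_add_eq (-s) 0
      rw [zero_add] at this
      rw [← this, zero_sub, sub_eq_add_neg, add_comm T]
    have hjoint : Integrable (Function.uncurry fun t s : ℝ => e t * ((τ (t - s) : ℝ) : ℂ) * (g s : ℂ))
        ((volume.restrict (uIoc 0 T)).prod (volume.restrict (Ioi (0 : ℝ)))) := by
      have h1 : Integrable (fun p : ℝ × ℝ => (g p.2 : ℂ))
          ((volume.restrict (uIoc 0 T)).prod (volume.restrict (Ioi (0 : ℝ)))) := hgC.comp_snd _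
      refine (h1.norm.const_mul c).mono' ?_ (ae_of_all _ fun p => ?_)
      · refine AEStronglyMeasurable.mul (Measurable.aestronglyMeasurable ?_) h1.aestronglyMeasurable
        exact (hec.measurable.comp measurable_fst).mul
          (Complex.measurable_ofReal.comp (hτ.comp (measurable_fst.sub measurable_snd)))
      · simp only [Function.uncurry]
        rw [norm_mul, norm_mul, he1, one_mul, Complex.norm_real]
        exact mul_le_mul_of_nonneg_right (hτc _) (norm_nonneg _)
    have hswap := intervalIntegral_integral_swap hjoint
    have e1 (t : ℝ) : e t * ((∫ s in Ioi (0 : ℝ), τ (t - s) * g s : ℝ) : ℂ)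
        = ∫ s in Ioi (0 : ℝ), e t * ((τ (t - s) : ℝ) : ℂ) * (g s : ℂ) := by
      rw [← integral_complex_ofReal, ← integral_const_mul]
      simp only [Complex.ofReal_mul, mul_assoc]
    have e2 (s : ℝ) : ∫ t in (0 : ℝ)..T, e t * ((τ (t - s) : ℝ) : ℂ) * (g s : ℂ)
        = (∫ t in (0 : ℝ)..T, e t * (τ t : ℂ)) * e s * (g s : ℂ) := by
      rw [intervalIntegral.integral_mul_const, hinner]; ring
    change (1 / T : ℂ) * ∫ t in (0 : ℝ)..T, e t * ((∫ s in Ioi (0 : ℝ), τ (t - s) * g s : ℝ) : ℂ)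
      = ∫ s in Ioi (0 : ℝ), (1 / T : ℂ) * (∫ t in (0 : ℝ)..T, e t * (τ t : ℂ)) * e s * (g s : ℂ)
    simp only [e1, hswap, e2]
    rw [← integral_const_mul]
    exact integral_congr_ae (ae_of_all _ fun s => by ring)

end Fourier

/-! ### Pairing the linear response with observables -/

section Response

variable {𝒳 : Type*} [Fintype 𝒳] {A : (𝒳 → ℝ) →L[ℝ] (𝒳 → ℝ)} {τ : ℝ → ℝ} {w : 𝒳 → ℝ} {c M γ : ℝ}

theorem integrableOn_sum_semigroup (hγ : 0 < γ)
    (hdec : ∀ s, 0 ≤ s → ‖semigroup A s w‖ ≤ M * Real.exp (-γ * s)) (f : 𝒳 → ℝ) :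
    IntegrableOn (fun s => ∑ x, f x * semigroup A s w x) (Ioi 0) := by
  have h : IntegrableOn (fun s => semigroup A s w) (Ioi 0) :=
    integrableOn_of_norm_le_exp (continuous_semigroup_apply A w).aestronglyMeasurable hγ hdec
  exact integrable_finsetSum _ fun x _ => (h.eval x).const_mul (f x)

theorem integral_mul_sum_semigroup (hτ : Measurable τ) (hτc : ∀ s, |τ s| ≤ c) (hγ : 0 < γ)
    (hdec : ∀ s, 0 ≤ s → ‖semigroup A s w‖ ≤ M * Real.exp (-γ * s)) (f : 𝒳 → ℝ) (t : ℝ) :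
    IntegrableOn (fun s => τ (t - s) * ∑ x, f x * semigroup A s w x) (Ioi 0) ∧
    ∫ s in Ioi (0 : ℝ), τ (t - s) * ∑ x, f x * semigroup A s w x
      = ∑ x, f x * linearResponse A τ w t x := by
  have h := integrableOn_smul_semigroup hτ hτc hγ hdec t
  have e (s : ℝ) : τ (t - s) * ∑ x, f x * semigroup A s w x
      = ∑ x, f x * (τ (t - s) * semigroup A s w x) := by
    rw [Finset.mul_sum]; exact Finset.sum_congr rfl fun x _ => by ring
  have hx (x : 𝒳) : IntegrableOn (fun s => f x * (τ (t - s) * semigroup A s w x)) (Ioi 0) :=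
    (h.eval x).const_mul (f x)
  simp only [e]
  refine ⟨integrable_finsetSum _ fun x _ => hx x, ?_⟩
  rw [integral_finsetSum _ fun x _ => hx x]
  exact Finset.sum_congr rfl fun x _ => by
    rw [integral_const_mul, linearResponse_apply hτ hτc hγ hdec]

theorem integrableOn_prod_mul_sum_semigroup (hτ : Measurable τ) (hτc : ∀ s, |τ s| ≤ c) (hγ : 0 < γ)
    (hdec : ∀ s, 0 ≤ s → ‖semigroup A s w‖ ≤ M * Real.exp (-γ * s)) {f : ℝ → 𝒳 → ℝ} {S : Set ℝ}
    (hf : ∀ x, IntegrableOn (fun u => f u x) S) :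
    IntegrableOn (fun p : ℝ × ℝ => τ (p.1 - p.2) * ∑ x, f p.1 x * semigroup A p.2 w x)
      (S ×ˢ Ioi (0 : ℝ)) := by
  have h : IntegrableOn (fun s => semigroup A s w) (Ioi 0) :=
    integrableOn_of_norm_le_exp (continuous_semigroup_apply A w).aestronglyMeasurable hγ hdec
  have h1 : Integrable (fun p : ℝ × ℝ => ∑ x, f p.1 x * semigroup A p.2 w x)
      (volume.restrict (S ×ˢ Ioi (0 : ℝ))) := by
    rw [Measure.volume_eq_prod, ← Measure.prod_restrict]
    exact integrable_finsetSum _ fun x _ => (hf x).mul_prod (h.eval x)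
  refine (h1.norm.const_mul c).mono' ?_ (ae_of_all _ fun p => ?_)
  · exact (hτ.comp (measurable_fst.sub measurable_snd)).aestronglyMeasurable.mul
      h1.aestronglyMeasurable
  · rw [norm_mul]
    exact mul_le_mul_of_nonneg_right (hτc _) (norm_nonneg _)

end Response

section Response

variable {𝒳 : Type*} [Fintype 𝒳]

theorem abs_sum_mul_le (a f : 𝒳 → ℝ) : |∑ x, a x * f x| ≤ ‖a‖ * ∑ x, |f x| := by
  rw [Finset.mul_sum]
  refine (Finset.abs_sum_le_sum_abs _ _).trans (Finset.sum_le_sum fun x _ => ?_)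
  rw [abs_mul]
  exact mul_le_mul_of_nonneg_right (norm_le_pi_norm a x) (abs_nonneg _)

theorem abs_sum_mul_sub_le {p π ρ : 𝒳 → ℝ} {l D : ℝ} (h : ‖p - π - l • ρ‖ ≤ D) (f : 𝒳 → ℝ) :
    |∑ x, p x * f x - ∑ x, π x * f x - l * ∑ x, ρ x * f x| ≤ D * ∑ x, |f x| := by
  have e : ∑ x, p x * f x - ∑ x, π x * f x - l * ∑ x, ρ x * f x
      = ∑ x, (p - π - l • ρ) x * f x := by
    rw [Finset.mul_sum, ← Finset.sum_sub_distrib, ← Finset.sum_sub_distrib]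
    refine Finset.sum_congr rfl fun x _ => ?_
    simp only [Pi.sub_apply, Pi.smul_apply, smul_eq_mul]
    ring
  rw [e]
  exact (abs_sum_mul_le _ f).trans
    (mul_le_mul_of_nonneg_right h (Finset.sum_nonneg fun x _ => abs_nonneg _))

/-- The origin of the response function: in the forward operator applied to `π`, dividing the inflow
at `y` by `π y` produces the time-reversed rates, and the outflow produces the contraction with `r`.
-/
theorem forwardOperator_mul_apply {π : 𝒳 → ℝ} {y : 𝒳} (hπ : π y ≠ 0) (r E : 𝒳 → 𝒳 → ℝ) :
    forwardOperator (fun x y => r x y * E x y) π y = π y * responseFunction π r E y := by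
  rw [forwardOperator_apply]
  simp only [responseFunction, contraction, reversedRate, mul_sub]
  congr 1
  · rw [Finset.mul_sum]
    exact Finset.sum_congr rfl fun x _ => by field_simp
  · congr 1
    exact Finset.sum_congr rfl fun x _ => mul_comm _ _

theorem measurable_contraction {α : ℝ → 𝒳 → 𝒳 → ℝ} (hα : ∀ x y, Measurable fun s => α s x y)
    (r : 𝒳 → 𝒳 → ℝ) (x : 𝒳) : Measurable fun s => contraction r (α s) x :=
  Finset.measurable_sum _ fun y _ => (hα x y).mul_const _

end Response

/-! ### Means of path functionals and stationary correlations -/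

section JumpProcess

variable {𝒳 : Type*} [Fintype 𝒳] [TopologicalSpace 𝒳] [DiscreteTopology 𝒳] [MeasurableSpace 𝒳]
  [BorelSpace 𝒳] {Ω : Type*} [MeasurableSpace Ω] {P : Measure Ω} {X : ℝ≥0 → Ω → 𝒳}

theorem measurable_uncurry_of_forall {v : ℝ → 𝒳 → ℝ} (hv : ∀ x, Measurable fun s => v s x) :
    Measurable fun p : ℝ × 𝒳 => v p.1 p.2 :=
  measurable_from_prod_countable_left hv

theorem IsMarkovJumpProcess.integral_intervalIntegral {q : ℝ → 𝒳 → 𝒳 → ℝ} [IsFiniteMeasure P]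
    (hX : IsMarkovJumpProcess q P X) (t : ℝ≥0) {v : ℝ → 𝒳 → ℝ}
    (hv : ∀ x, Measurable fun s => v s x)
    (hvi : ∀ x, IntervalIntegrable (fun s => v s x) volume 0 t) :
    Integrable (fun ω => ∫ s in (0 : ℝ)..t, v s (X s.toNNReal ω)) P ∧
    ∫ ω, (∫ s in (0 : ℝ)..t, v s (X s.toNNReal ω)) ∂P
      = ∫ s in (0 : ℝ)..t, ∑ x, law P X s x * v s x := by
  have hu : uIoc (0 : ℝ) t = Ioc 0 (t : ℝ) := uIoc_of_le t.coe_nonneg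
  have hm : Measurable fun p : ℝ × Ω => v p.1 (X p.1.toNNReal p.2) :=
    (measurable_uncurry_of_forall hv).comp (measurable_fst.prodMk hX.measurable_uncurry)
  have hb : Integrable (fun s => ∑ x, ‖v s x‖) (volume.restrict (uIoc (0 : ℝ) t)) := by
    rw [hu]
    exact integrable_finsetSum _ fun x _ => ((hvi x).1).norm
  have hj : Integrable (Function.uncurry fun (s : ℝ) ω => v s (X s.toNNReal ω))
      ((volume.restrict (uIoc (0 : ℝ) t)).prod P) :=
    (hb.comp_fst P).mono' hm.aestronglyMeasurable (ae_of_all _ fun p =>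
      Finset.single_le_sum (f := fun x => ‖v p.1 x‖) (fun x _ => norm_nonneg _)
        (Finset.mem_univ _))
  constructor
  · have e (ω : Ω) : ∫ s in (0 : ℝ)..t, v s (X s.toNNReal ω)
        = ∫ s in uIoc (0 : ℝ) t, v s (X s.toNNReal ω) := by
      rw [intervalIntegral.integral_of_le t.coe_nonneg, hu]
    simp only [e]
    exact hj.integral_prod_right
  · rw [← intervalIntegral_integral_swap hj]
    exact intervalIntegral.integral_congr fun s _ =>
      integral_eq_sum_law hX.measurable P (fun x => v s x) s

variable {r : 𝒳 → 𝒳 → ℝ} {π : 𝒳 → ℝ}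

theorem IsMarkovJumpProcess.law_restrict_eq_semigroup [IsFiniteMeasure P]
    (hX : IsMarkovJumpProcess (fun _ => r) P X) {A : Set Ω}
    (hA : MeasurableSet[Filtration.natural X hX.stronglyMeasurable 0] A) {t : ℝ} (ht : 0 ≤ t) :
    law (P.restrict A) X t = semigroup (forwardOperator r) t (law (P.restrict A) X 0) := by
  obtain ⟨K, hK, hrK⟩ := exists_forall_abs_le r
  have hqm (x y : 𝒳) : Measurable fun _ : ℝ => r x y := measurable_const
  refine eq_of_forward_equation (q := fun _ => r) hqm hK (fun _ => hrK)
    (hX.continuous_law hqm hK (fun _ => hrK) hA) (continuous_semigroup_apply _ _) ?_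
    (fun t ht => hX.law_eq_add_integral_zero hqm hK (fun _ => hrK) hA ht) (fun t _ => ?_) ht
  · simp [semigroup_zero]
  · simpa [semigroup_zero] using semigroup_apply_eq_add_integral (forwardOperator r) _ t

theorem IsHomogeneousProcess.law_zero (hX : IsHomogeneousProcess r π P X) : law P X 0 = π := by
  ext x
  simpa [law] using hX.initial x

theorem IsHomogeneousProcess.law_eq [IsFiniteMeasure P] (hX : IsHomogeneousProcess r π P X)
    (hπ : IsInvariantDistribution r π) {t : ℝ} (ht : 0 ≤ t) : law P X t = π := by
  obtain ⟨K, hK, hrK⟩ := exists_forall_abs_le r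
  have hqm (x y : 𝒳) : Measurable fun _ : ℝ => r x y := measurable_const
  have hc := hX.isMarkovJumpProcess.continuous_law hqm hK (fun _ => hrK) MeasurableSet.univ
  have he := fun t ht => hX.isMarkovJumpProcess.law_eq_add_integral_zero hqm hK (fun _ => hrK)
    MeasurableSet.univ (t := t) ht
  simp only [Measure.restrict_univ] at hc he
  exact eq_of_forward_equation (q := fun _ => r) hqm hK (fun _ => hrK) hc
    (continuous_const (y := π)) hX.law_zero he
    (fun t _ => by simp [hπ.forwardOperator_eq_zero]) ht

/-- Splitting according to the initial state `z`, the restricted law starts as `π z` times the unit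
mass at `z` and evolves by the semigroup; weighting by `h z` and summing gives the initial vector `π
* h` by linearity. -/
theorem IsHomogeneousProcess.correlation_eq [IsFiniteMeasure P]
    (hX : IsHomogeneousProcess r π P X) (f h : 𝒳 → ℝ) {s : ℝ} (hs : 0 ≤ s) :
    correlation P X f h s
      = ∑ x, f x * semigroup (forwardOperator r) s (fun z => π z * h z) x := by
  classical
  have hm := hX.isMarkovJumpProcess.measurable
  have hA (z : 𝒳) := hX.isMarkovJumpProcess.measurableSet_natural 0 {z}
  have hA' (z : 𝒳) : MeasurableSet {ω | X 0 ω ∈ ({z} : Set 𝒳)} := hm 0 (measurableSet_singleton z)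
  have h0 (z : 𝒳) : law (P.restrict {ω | X 0 ω ∈ ({z} : Set 𝒳)}) X 0 = π z • Pi.single z 1 := by
    ext x
    rw [hX.isMarkovJumpProcess.law_restrict, Real.toNNReal_zero, Pi.smul_apply, smul_eq_mul,
      Pi.single_apply]
    split_ifs with hx
    · rw [mul_one, ← hX.initial z, hx]
      congr 1; ext ω; simp
    · rw [mul_zero]
      have : {ω | X 0 ω = x} ∩ {ω | X 0 ω ∈ ({z} : Set 𝒳)} = ∅ := by
        ext ω
        simp only [mem_inter_iff, mem_ofPred_eq, mem_singleton_iff, mem_empty_iff_false, iff_false,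
          not_and]
        exact fun h1 h2 => hx (h1.symm.trans h2)
      rw [this, measureReal_empty]
  have hsplit (ω : Ω) : f (X s.toNNReal ω) * h (X 0 ω)
      = ∑ z, h z * ({ω | X 0 ω ∈ ({z} : Set 𝒳)}.indicator (fun ω => f (X s.toNNReal ω)) ω) := by
    simp only [indicator, mem_ofPred_eq, mem_singleton_iff, mul_ite, mul_zero, Finset.sum_ite_eq,
      Finset.mem_univ, if_true]
    ring
  have hw : (fun z => π z * h z) = ∑ z, h z • π z • (Pi.single z 1 : 𝒳 → ℝ) := by
    ext x
    simp [Finset.sum_apply, Pi.single_apply, mul_comm]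
  rw [correlation]
  simp only [hsplit]
  rw [integral_finsetSum _ fun z _ =>
    ((integrable_comp hm P f _).indicator (hA' z)).const_mul (h z)]
  simp only [integral_const_mul, integral_indicator (hA' _), integral_eq_sum_law hm]
  rw [hw, map_sum]
  simp only [Finset.sum_apply, Finset.mul_sum]
  rw [Finset.sum_comm]
  refine Finset.sum_congr rfl fun x _ => Finset.sum_congr rfl fun z _ => ?_
  rw [hX.isMarkovJumpProcess.law_restrict_eq_semigroup (hA z) hs, h0, map_smul, map_smul, map_smul]
  simp only [Pi.smul_apply, smul_eq_mul]
  ring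

/-- Tonelli and stationarity turn path integrability into integrability in time of the `π`-average
of the contraction of `|α|`. As every `π x` is positive and all summands are nonnegative, each
individual edge is controlled. -/
theorem IsHomogeneousProcess.integrableOn_mul_rate [IsFiniteMeasure P]
    (hX : IsHomogeneousProcess r π P X) (hr : ∀ x y, 0 ≤ r x y)
    (hπ : IsInvariantDistribution r π) (hpos : ∀ x, 0 < π x) {t : ℝ≥0} {α : ℝ → 𝒳 → 𝒳 → ℝ}
    (hα : ∀ x y, Measurable fun s => α s x y) (hαi : IsPathIntegrable r P X t α) (x y : 𝒳) :
    IntegrableOn (fun s => α s x y * r x y) (Ioc 0 (t : ℝ)) := by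
  have hm := hX.isMarkovJumpProcess.measurable
  set b : ℝ → 𝒳 → ℝ := fun s => contraction r fun x y => |α s x y| with hb
  have hb0 (s : ℝ) (x : 𝒳) : 0 ≤ b s x :=
    Finset.sum_nonneg fun y _ => mul_nonneg (abs_nonneg _) (hr x y)
  have hbm (x : 𝒳) : Measurable fun s => b s x :=
    measurable_contraction (fun x y => (hα x y).abs) r x
  have hF : Measurable fun p : ℝ × Ω => ENNReal.ofReal (b p.1 (X p.1.toNNReal p.2)) :=
    ((measurable_uncurry_of_forall hbm).comp
      (measurable_fst.prodMk hX.isMarkovJumpProcess.measurable_uncurry)).ennreal_ofReal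
  have h1 : ∫⁻ s in Ioc (0 : ℝ) t, ENNReal.ofReal (∑ x, π x * b s x) < ∞ := by
    have hsw := lintegral_lintegral_swap (μ := P) (ν := volume.restrict (Ioc (0 : ℝ) t))
      (f := fun ω s => ENNReal.ofReal (b s (X s.toNNReal ω)))
      (hF.comp measurable_swap).aemeasurable
    have hαi' : ∫⁻ ω, (∫⁻ s in Ioc (0 : ℝ) t, ENNReal.ofReal (b s (X s.toNNReal ω))) ∂P < ∞ := hαi
    rw [hsw] at hαi'
    refine lt_of_eq_of_lt (setLIntegral_congr_fun measurableSet_Ioc fun s hs => ?_) hαi'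
    rw [← hX.law_eq hπ hs.1.le, ← integral_eq_sum_law hm P (b s) s,
      ofReal_integral_eq_lintegral_ofReal (integrable_comp hm P (b s) _)
        (ae_of_all _ fun ω => hb0 s _)]
  refine ⟨((hα x y).mul_const _).aestronglyMeasurable, ?_⟩
  rw [HasFiniteIntegral]
  have h2 : ∫⁻ s in Ioc (0 : ℝ) t, ENNReal.ofReal (π x)⁻¹ * ENNReal.ofReal (∑ x, π x * b s x)
      < ∞ := by
    rw [lintegral_const_mul' _ _ ENNReal.ofReal_ne_top]
    exact ENNReal.mul_lt_top ENNReal.ofReal_lt_top h1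
  refine lt_of_le_of_lt (lintegral_mono fun s => ?_) h2
  rw [← ENNReal.ofReal_mul (inv_nonneg.2 (hpos x).le), Real.enorm_eq_ofReal_abs]
  refine ENNReal.ofReal_le_ofReal ?_
  rw [abs_mul, abs_of_nonneg (hr x y), ← div_eq_inv_mul, le_div_iff₀ (hpos x)]
  calc |α s x y| * r x y * π x ≤ b s x * π x := by
        refine mul_le_mul_of_nonneg_right ?_ (hpos x).le
        exact Finset.single_le_sum (f := fun y => |α s x y| * r x y)
          (fun y _ => mul_nonneg (abs_nonneg _) (hr x y)) (Finset.mem_univ y)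
    _ = π x * b s x := mul_comm _ _
    _ ≤ _ := Finset.single_le_sum (f := fun x => π x * b s x)
        (fun x _ => mul_nonneg (hpos x).le (hb0 s x)) (Finset.mem_univ x)

end JumpProcess

theorem IsOscillatorySteadyState.law_eq {𝒳 : Type*} [Fintype 𝒳] [TopologicalSpace 𝒳]
    [DiscreteTopology 𝒳] [MeasurableSpace 𝒳] [BorelSpace 𝒳] {Ω : Type*} [MeasurableSpace Ω]
    {P : Measure Ω} {X : ℝ≥0 → Ω → 𝒳} {q : ℝ → 𝒳 → 𝒳 → ℝ} {T : ℝ}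
    (hX : IsOscillatorySteadyState q T P X) : law P X T = law P X 0 := by
  ext x
  have h (t : ℝ≥0) : P.real {ω | X t ω = x} = (P.map (X t)).real {x} := by
    rw [map_measureReal_apply (hX.isMarkovJumpProcess.measurable t) (measurableSet_singleton x)]
    rfl
  rw [law, law, h, h, hX.map_eq, Real.toNNReal_zero]

/-! ### Differentiating integrals of laws and of perturbed jump intensities -/

section Expansion

variable {𝒳 : Type*} [Fintype 𝒳] {p : ℝ → ℝ → 𝒳 → ℝ} {π : 𝒳 → ℝ} {ρ : ℝ → 𝒳 → ℝ} {C R : ℝ}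

theorem hasDerivAt_sum_mul (h0 : ∀ t, 0 ≤ t → p 0 t = π)
    (hC : ∀ l, |l| ≤ 1 → ∀ t, 0 ≤ t → ‖p l t - π - l • ρ t‖ ≤ C * l ^ 2) (f : 𝒳 → ℝ) {t : ℝ}
    (ht : 0 ≤ t) : HasDerivAt (fun l => ∑ x, p l t x * f x) (∑ x, ρ t x * f x) 0 := by
  refine hasDerivAt_zero_of_norm_sub_le (C := C * ∑ x, |f x|) fun l hl => ?_
  rw [h0 t ht, smul_eq_mul, Real.norm_eq_abs]
  exact (abs_sum_mul_sub_le (hC l hl t ht) f).trans_eq (by ring)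

theorem hasDerivAt_integral_sum_mul_smul {V : Type*} [NormedAddCommGroup V] [NormedSpace ℝ V]
    (h0 : ∀ t, 0 ≤ t → p 0 t = π) (hp : ∀ l, Measurable (p l)) (hp1 : ∀ l t, ‖p l t‖ ≤ 1)
    (hρ : Measurable ρ) (hR : ∀ t, ‖ρ t‖ ≤ R)
    (hC : ∀ l, |l| ≤ 1 → ∀ t, 0 ≤ t → ‖p l t - π - l • ρ t‖ ≤ C * l ^ 2) (f : 𝒳 → ℝ) {t : ℝ}
    (ht : 0 ≤ t) {k : ℝ → V} (hk : IntervalIntegrable k volume 0 t) :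
    HasDerivAt (fun l => ∫ s in (0 : ℝ)..t, (∑ x, p l s x * f x) • k s)
      (∫ s in (0 : ℝ)..t, (∑ x, ρ s x * f x) • k s) 0 := by
  have hm {a : ℝ → 𝒳 → ℝ} (ha : Measurable a) : Measurable fun s => ∑ x, a s x * f x :=
    Finset.measurable_sum _ fun x _ => ((measurable_pi_apply x).comp ha).mul_const _
  have hb {a : ℝ → 𝒳 → ℝ} {D : ℝ} (ha : ∀ t, ‖a t‖ ≤ D) (s : ℝ) :
      |∑ x, a s x * f x| ≤ D * ∑ x, |f x| :=
    (abs_sum_mul_le _ f).trans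
      (mul_le_mul_of_nonneg_right (ha s) (Finset.sum_nonneg fun x _ => abs_nonneg _))
  refine hasDerivAt_integral_smul (C := C * ∑ x, |f x|) ht hk (fun l => hm (hp l))
    (fun l s _ => hb (hp1 l) s) (hm hρ) (fun s _ => hb hR s) fun l hl s hs => ?_
  rw [h0 s hs.1]
  exact (abs_sum_mul_sub_le (hC l hl s hs.1) f).trans_eq (by ring)

theorem abs_exp_mul_mul_le {a Z p : ℝ} (ha : |a| ≤ Z) (hp : |p| ≤ 1) (l : ℝ) :
    |Real.exp (l * a) * p| ≤ Real.exp (|l| * Z) := by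
  rw [abs_mul, Real.abs_exp]
  refine (mul_le_of_le_one_right (Real.exp_pos _).le hp).trans (Real.exp_le_exp.2 ?_)
  refine (le_abs_self _).trans ?_
  rw [abs_mul]
  exact mul_le_mul_of_nonneg_left ha (abs_nonneg l)

/-- The error splits into the Taylor remainder of the exponential times `p`, the cross term `l * a *
(p - π)`, which is quadratic because `p - π` is linear in `l`, and the remainder of `p`. These give
the three summands of the constant. -/
theorem abs_exp_mul_sub_expansion_le {π ρ p a l Z C R : ℝ} (hl : |l| ≤ 1) (ha : |a| ≤ Z)
    (hp : |p| ≤ 1) (hR : |ρ| ≤ R) (hC0 : 0 ≤ C) (hC : |p - π - l * ρ| ≤ C * l ^ 2) :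
    |Real.exp (l * a) * p - π - l * (a * π + ρ)|
      ≤ (Z ^ 2 * Real.exp Z + Z * (R + C) + C) * l ^ 2 := by
  have hl2 : l ^ 2 ≤ |l| := by
    rw [← sq_abs]; nlinarith [abs_nonneg l]
  have hd : |p - π| ≤ |l| * (R + C) := by
    have h1 : p - π = (p - π - l * ρ) + l * ρ := by ring
    rw [h1]
    refine (abs_add_le _ _).trans ?_
    have h2 : C * l ^ 2 ≤ C * |l| := mul_le_mul_of_nonneg_left hl2 hC0
    have h3 : |l * ρ| ≤ |l| * R := by
      rw [abs_mul]; exact mul_le_mul_of_nonneg_left hR (abs_nonneg l)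
    linarith
  have hZ : 0 ≤ Z := (abs_nonneg a).trans ha
  have h1 : |(Real.exp (l * a) - 1 - l * a) * p| ≤ Z ^ 2 * Real.exp Z * l ^ 2 := by
    rw [abs_mul]
    exact (mul_le_of_le_one_right (abs_nonneg _) hp).trans (abs_exp_mul_sub_le hl ha)
  have h2 : |l * a * (p - π)| ≤ Z * (R + C) * l ^ 2 := by
    rw [abs_mul, abs_mul]
    calc |l| * |a| * |p - π| ≤ |l| * Z * (|l| * (R + C)) :=
          mul_le_mul (mul_le_mul_of_nonneg_left ha (abs_nonneg l)) hd (abs_nonneg _)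
            (mul_nonneg (abs_nonneg l) hZ)
      _ = Z * (R + C) * |l| ^ 2 := by ring
      _ = _ := by rw [sq_abs]
  have e : Real.exp (l * a) * p - π - l * (a * π + ρ)
      = (Real.exp (l * a) - 1 - l * a) * p + l * a * (p - π) + (p - π - l * ρ) := by ring
  rw [e]
  refine (abs_add_three _ _ _).trans ?_
  linarith

variable {Z : ℝ} {a : ℝ → ℝ}

theorem intervalIntegrable_exp_mul_smul (hp : ∀ l, Measurable (p l)) (hp1 : ∀ l t, ‖p l t‖ ≤ 1)
    (ha : Measurable a) (haZ : ∀ s, |a s| ≤ Z) (x : 𝒳) {t : ℝ} (ht : 0 ≤ t) {k : ℝ → ℝ}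
    (hk : IntervalIntegrable k volume 0 t) (l : ℝ) :
    IntervalIntegrable (fun s => (Real.exp (l * a s) * p l s x) • k s) volume 0 t :=
  intervalIntegrable_smul_of_bound (B := Real.exp (|l| * Z)) ht hk
    ((Real.measurable_exp.comp (ha.const_mul l)).mul ((measurable_pi_apply x).comp (hp l)))
    fun s _ => abs_exp_mul_mul_le (haZ s) ((norm_le_pi_norm _ x).trans (hp1 l s)) l

theorem hasDerivAt_integral_exp_mul_smul
    (h0 : ∀ t, 0 ≤ t → p 0 t = π) (hp : ∀ l, Measurable (p l)) (hp1 : ∀ l t, ‖p l t‖ ≤ 1)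
    (hρ : Measurable ρ) (hR : ∀ t, ‖ρ t‖ ≤ R) (hC0 : 0 ≤ C)
    (hC : ∀ l, |l| ≤ 1 → ∀ t, 0 ≤ t → ‖p l t - π - l • ρ t‖ ≤ C * l ^ 2)
    (ha : Measurable a) (haZ : ∀ s, |a s| ≤ Z) (x : 𝒳) {t : ℝ} (ht : 0 ≤ t) {k : ℝ → ℝ}
    (hk : IntervalIntegrable k volume 0 t) :
    HasDerivAt (fun l => ∫ s in (0 : ℝ)..t, (Real.exp (l * a s) * p l s x) • k s)
      (∫ s in (0 : ℝ)..t, (a s * π x + ρ s x) • k s) 0 := by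
  have hx (l s : ℝ) : |p l s x| ≤ 1 := (norm_le_pi_norm _ x).trans (hp1 l s)
  have hRx (s : ℝ) : |ρ s x| ≤ R := (norm_le_pi_norm _ x).trans (hR s)
  refine hasDerivAt_integral_smul (C := Z ^ 2 * Real.exp Z + Z * (R + C) + C)
    (B := fun l => Real.exp (|l| * Z)) (B' := Z * |π x| + R) ht hk
    (fun l => (Real.measurable_exp.comp (ha.const_mul l)).mul ((measurable_pi_apply x).comp (hp l)))
    (fun l s _ => abs_exp_mul_mul_le (haZ s) (hx l s) l)
    ((ha.mul_const _).add ((measurable_pi_apply x).comp hρ)) (fun s _ => ?_) fun l hl s hs => ?_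
  · refine (abs_add_le _ _).trans (add_le_add ?_ (hRx s))
    rw [abs_mul]
    exact mul_le_mul_of_nonneg_right (haZ s) (abs_nonneg _)
  · rw [h0 s hs.1, zero_mul, Real.exp_zero, one_mul]
    exact abs_exp_mul_sub_expansion_le hl (haZ s) (hx l s) (hRx s) hC0
      ((norm_le_pi_norm (p l s - π - l • ρ s) x).trans (hC l hl s hs.1))

end Expansion

end OSSResponse

end

/-! ### The response formulas -/

open OSSResponse in
theorem mainTheorem11
    {𝒳 : Type*} [Fintype 𝒳] [TopologicalSpace 𝒳] [DiscreteTopology 𝒳] [MeasurableSpace 𝒳]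
    [BorelSpace 𝒳]
    -- the unperturbed rates and their invariant distribution
    (r : 𝒳 → 𝒳 → ℝ) (hr : ∀ x y, 0 ≤ r x y) (hr_diag : ∀ x, r x x = 0) (hirr : IsIrreducible r)
    (π : 𝒳 → ℝ) (hπ : IsInvariantDistribution r π)
    -- the decoupled periodic perturbation `g s x y = τ s * E x y`
    (T : ℝ) (hT : 0 < T) (τ : ℝ → ℝ) (hτ_meas : Measurable τ) (hτ_bdd : ∃ C, ∀ s, |τ s| ≤ C)
    (hτ_per : Function.Periodic τ T) (E : 𝒳 → 𝒳 → ℝ)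
    -- the stationary unperturbed process
    {Ω : Type*} [MeasurableSpace Ω] (P : Measure Ω) [IsProbabilityMeasure P]
    (X : ℝ≥0 → Ω → 𝒳) (hX : IsHomogeneousProcess r π P X)
    -- the oscillatory steady states of the perturbed dynamics
    {Ω' : ℝ → Type*} [∀ l, MeasurableSpace (Ω' l)] (P' : ∀ l, Measure (Ω' l))
    [∀ l, IsProbabilityMeasure (P' l)] (X' : ∀ l, ℝ≥0 → Ω' l → 𝒳)
    (hX' : ∀ l, IsOscillatorySteadyState
      (perturbedRate r (fun s x y => τ s * E x y) l) T (P' l) (X' l)) :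
    -- observables at a fixed time
    (∀ (v : 𝒳 → ℝ) (t : ℝ≥0),
      IntegrableOn (fun s : ℝ => τ (t - s) * correlation P X v (responseFunction π r E) s)
        (Ioi 0) ∧
      HasDerivAt (fun l => ∫ ω, v (X' l t ω) ∂P' l)
        (∫ s in Ioi (0 : ℝ), τ (t - s) * correlation P X v (responseFunction π r E) s) 0) ∧
    -- time-integrated observables
    (∀ (t : ℝ≥0) (v : ℝ → 𝒳 → ℝ), (∀ x, Measurable fun s => v s x) →
      (∀ x, IntervalIntegrable (fun s => v s x) volume 0 t) →
      (∀ l, Integrable (fun ω => ∫ s in (0 : ℝ)..t, v s (X' l s.toNNReal ω)) (P' l)) ∧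
      IntegrableOn
        (fun p : ℝ × ℝ => τ (p.1 - p.2) * correlation P X (v p.1) (responseFunction π r E) p.2)
        (Ioc (0 : ℝ) t ×ˢ Ioi (0 : ℝ)) ∧
      HasDerivAt (fun l => ∫ ω, (∫ s in (0 : ℝ)..t, v s (X' l s.toNNReal ω)) ∂P' l)
        (∫ u in (0 : ℝ)..t, ∫ s in Ioi (0 : ℝ),
          τ (u - s) * correlation P X (v u) (responseFunction π r E) s) 0) ∧
    -- additive functionals of the jumps
    (∀ (t : ℝ≥0) (α : ℝ → 𝒳 → 𝒳 → ℝ), (∀ x y, Measurable fun s => α s x y) →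
      IsPathIntegrable r P X t α →
      (∀ l, Integrable (fun ω => jumpSum α t (fun s => X' l s ω)) (P' l)) ∧
      IntervalIntegrable
        (fun s => τ s *
          ∫ ω, contraction r (fun x y => α s x y * E x y) (X s.toNNReal ω) ∂P) volume 0 t ∧
      IntegrableOn
        (fun p : ℝ × ℝ => τ (p.1 - p.2) *
          correlation P X (contraction r (α p.1)) (responseFunction π r E) p.2)
        (Ioc (0 : ℝ) t ×ˢ Ioi (0 : ℝ)) ∧
      HasDerivAt (fun l => ∫ ω, jumpSum α t (fun s => X' l s ω) ∂P' l)
        ((∫ s in (0 : ℝ)..t, τ s *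
            ∫ ω, contraction r (fun x y => α s x y * E x y) (X s.toNNReal ω) ∂P) +
          ∫ s in (0 : ℝ)..t, ∫ u in Ioi (0 : ℝ),
            τ (s - u) * correlation P X (contraction r (α s)) (responseFunction π r E) u) 0) ∧
    -- Fourier coefficients of the periodic map `t ↦ f_l t`, the mean of `v` at time `t`
    (∀ v : 𝒳 → ℝ,
      (∀ (l : ℝ) (t : ℝ≥0),
        ∫ ω, v (X' l (t + T.toNNReal) ω) ∂P' l = ∫ ω, v (X' l t ω) ∂P' l) ∧
      (∀ l, IntervalIntegrable (fun t : ℝ => ∫ ω, v (X' l t.toNNReal ω) ∂P' l) volume 0 T) ∧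
      ∀ k : ℤ,
        IntegrableOn (fun s : ℝ => fourierCoefficient T k τ *
          Complex.exp (-(Complex.I * k * (2 * Real.pi / T : ℝ) * s)) *
            (correlation P X v (responseFunction π r E) s : ℂ)) (Ioi 0) ∧
        HasDerivAt
          (fun l : ℝ => fourierCoefficient T k (fun t => ∫ ω, v (X' l t.toNNReal ω) ∂P' l))
          (∫ s in Ioi (0 : ℝ), fourierCoefficient T k τ *
            Complex.exp (-(Complex.I * k * (2 * Real.pi / T : ℝ) * s)) *
              (correlation P X v (responseFunction π r E) s : ℂ)) 0) := by
  classical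
  obtain ⟨c, hτc⟩ := hτ_bdd
  obtain ⟨C₀, γ, -, hγ, hrel⟩ := exists_norm_semigroup_le hr hirr hπ
  have hpos := hπ.pos hr hirr
  set w : 𝒳 → ℝ := forwardOperator (fun x y => r x y * E x y) π with hw
  have hw' : (fun x => π x * responseFunction π r E x) = w :=
    funext fun x => (forwardOperator_mul_apply (hpos x).ne' r E).symm
  have hdec := hrel w (sum_forwardOperator _ _)
  set ρ : ℝ → 𝒳 → ℝ := linearResponse (forwardOperator r) τ w with hρ
  have hρc : Continuous ρ := continuous_linearResponse hτ_meas hτc hγ hdec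
  have hR : ∀ t, ‖ρ t‖ ≤ c * (C₀ * ‖w‖) / γ := norm_linearResponse_le hτc hγ hdec
  obtain ⟨C, hC0, hexp⟩ := exists_norm_sub_linearResponse_le hr hirr hπ hT hτ_meas hτc hτ_per E
  -- the one-dimensional distributions of the oscillatory steady states
  set q : ℝ → ℝ → 𝒳 → 𝒳 → ℝ := perturbedRate r (fun s x y => τ s * E x y) with hq
  set p : ℝ → ℝ → 𝒳 → ℝ := fun l => law (P' l) (X' l) with hp
  have hM (l : ℝ) : IsMarkovJumpProcess (q l) (P' l) (X' l) := (hX' l).1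
  have hm (l : ℝ) := (hM l).measurable
  have hqm (l : ℝ) (x y : 𝒳) : Measurable fun s => q l s x y :=
    measurable_perturbedRate r E hτ_meas l x y
  have hq0 (l s : ℝ) (x y : 𝒳) : 0 ≤ q l s x y := mul_nonneg (hr x y) (Real.exp_pos _).le
  choose K hK hqK using exists_perturbedRate_le r E hτc
  have hpc (l : ℝ) : Continuous (p l) := by
    simpa only [Measure.restrict_univ] using
      (hM l).continuous_law (hqm l) (hK l) (hqK l) MeasurableSet.univ
  have hpm (l : ℝ) : Measurable (p l) := (hpc l).measurable
  have hp0 (l t : ℝ) (x : 𝒳) : 0 ≤ p l t x := law_nonneg _ _ t x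
  have hps (l t : ℝ) : ∑ x, p l t x = 1 := by
    rw [hp, sum_law (hm l), probReal_univ]
  have hp1 (l t : ℝ) : ‖p l t‖ ≤ 1 := norm_le_one_of_sum_eq_one (hp0 l t) (hps l t)
  have hpe (l t : ℝ) (ht : 0 ≤ t) :
      p l t = p l 0 + ∫ u in (0 : ℝ)..t, forwardOperator (q l u) (p l u) := by
    simpa only [Measure.restrict_univ] using
      (hM l).law_eq_add_integral_zero (hqm l) (hK l) (hqK l) MeasurableSet.univ ht
  have hpT (l : ℝ) : p l T = p l 0 := (hX' l).law_eq
  have hC (l : ℝ) (hl : |l| ≤ 1) (t : ℝ) (ht : 0 ≤ t) : ‖p l t - π - l • ρ t‖ ≤ C * l ^ 2 :=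
    hexp l hl (p l) (hpc l) (hp0 l) (hps l) (hpe l) (hpT l) t ht
  -- The expansion at `l = 0` has error zero, so it already identifies the unperturbed steady state
  -- with `π`.
  have hπ0 (t : ℝ) (ht : 0 ≤ t) : p 0 t = π := by
    have := hC 0 (by simp) t ht
    rw [zero_smul, sub_zero, zero_pow two_ne_zero, mul_zero] at this
    exact sub_eq_zero.1 (norm_le_zero_iff.1 this)
  have hmean (l : ℝ) (f : 𝒳 → ℝ) (t : ℝ) :
      ∫ ω, f (X' l t.toNNReal ω) ∂P' l = ∑ x, p l t x * f x :=
    integral_eq_sum_law (hm l) (P' l) f t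
  -- the correlations with the response function
  have hcorr (f : 𝒳 → ℝ) (s : ℝ) (hs : s ∈ Ioi (0 : ℝ)) :
      correlation P X f (responseFunction π r E) s
        = ∑ x, f x * semigroup (forwardOperator r) s w x := by
    rw [hX.correlation_eq f _ (le_of_lt hs), hw']
  have hconv (f : 𝒳 → ℝ) (t : ℝ) :
      IntegrableOn (fun s => τ (t - s) * correlation P X f (responseFunction π r E) s) (Ioi 0) ∧
      ∫ s in Ioi (0 : ℝ), τ (t - s) * correlation P X f (responseFunction π r E) s
        = ∑ x, ρ t x * f x := by
    have h := integral_mul_sum_semigroup hτ_meas hτc hγ hdec f t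
    have e : EqOn (fun s => τ (t - s) * correlation P X f (responseFunction π r E) s)
        (fun s => τ (t - s) * ∑ x, f x * semigroup (forwardOperator r) s w x) (Ioi 0) :=
      fun s hs => by simp only [hcorr f s hs]
    refine ⟨(integrableOn_congr_fun e measurableSet_Ioi).2 h.1, ?_⟩
    rw [setIntegral_congr_fun measurableSet_Ioi e, h.2]
    exact Finset.sum_congr rfl fun x _ => mul_comm _ _
  have hprod (t : ℝ) (f : ℝ → 𝒳 → ℝ) (hf : ∀ x, IntegrableOn (fun s => f s x) (Ioc 0 t)) :
      IntegrableOn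
        (fun p : ℝ × ℝ => τ (p.1 - p.2) * correlation P X (f p.1) (responseFunction π r E) p.2)
        (Ioc (0 : ℝ) t ×ˢ Ioi (0 : ℝ)) := by
    refine IntegrableOn.congr_fun
      (integrableOn_prod_mul_sum_semigroup hτ_meas hτc hγ hdec hf) (fun z hz => ?_)
      (measurableSet_Ioc.prod measurableSet_Ioi)
    simp only [hcorr (f z.1) z.2 hz.2]
  refine ⟨fun v t => ⟨(hconv v t).1, ?_⟩, fun t v hv hvi => ⟨fun l => ?_, ?_, ?_⟩,
    fun t α hα hαi => ?_, fun v => ⟨fun l t => ?_, fun l => ?_, fun k => ?_⟩⟩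
  · rw [(hconv v t).2]
    have h := hasDerivAt_sum_mul hπ0 hC v t.coe_nonneg
    simpa only [← hmean, Real.toNNReal_coe] using h
  · exact ((hM l).integral_intervalIntegral t hv hvi).1
  · exact hprod t v fun x => (hvi x).1
  · simp only [((hM _).integral_intervalIntegral t hv hvi).2, (hconv _ _).2]
    have hi {g : ℝ → 𝒳 → ℝ} (hg : Continuous g) (x : 𝒳) :
        IntervalIntegrable (fun s => g s x * v s x) volume 0 t :=
      (hvi x).continuousOn_mul ((continuous_apply x).comp hg).continuousOn
    -- Splitting over the states lets the merely integrable `v s x` act as the weight, while the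
    -- bounded law enters through its coordinate, written as a pairing with `Pi.single x 1`.
    have e {g : ℝ → 𝒳 → ℝ} (hg : Continuous g) :
        ∫ s in (0 : ℝ)..t, ∑ x, g s x * v s x
          = ∑ x, ∫ s in (0 : ℝ)..t, (∑ y, g s y * (Pi.single x 1 : 𝒳 → ℝ) y) • v s x := by
      rw [intervalIntegral.integral_finsetSum fun x _ => hi hg x]
      exact Finset.sum_congr rfl fun x _ => intervalIntegral.integral_congr fun s _ => by
        simp [Pi.single_apply]
    have e' (l : ℝ) := e (hpc l)
    simp only [hp] at e'
    simp only [e', e hρc]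
    exact HasDerivAt.fun_sum fun x _ => hasDerivAt_integral_sum_mul_smul hπ0
      hpm hp1 hρc.measurable hR hC _ t.coe_nonneg (hvi x)
  · have hki (x y : 𝒳) : IntervalIntegrable (fun s => α s x y * r x y) volume 0 t :=
      (intervalIntegrable_iff_integrableOn_Ioc_of_le t.coe_nonneg).2
        (hX.integrableOn_mul_rate hr hπ hpos hα hαi x y)
    have ham (x y : 𝒳) : Measurable fun s => τ s * E x y := hτ_meas.mul_const _
    have haZ (x y : 𝒳) (s : ℝ) : |τ s * E x y| ≤ c * |E x y| := by
      rw [abs_mul]; exact mul_le_mul_of_nonneg_right (hτc s) (abs_nonneg _)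
    -- Only the unperturbed `α * r` is known to be integrable. The remaining factor is bounded for
    -- each `l`, so integrability for the stationary process passes to every perturbed one.
    have hα_eq (l s : ℝ) (x y : 𝒳) : α s x y * (q l s x y * p l s x)
        = (Real.exp (l * (τ s * E x y)) * p l s x) • (α s x y * r x y) := by
      simp only [hq, perturbedRate, smul_eq_mul]; ring
    have hJ (l : ℝ) := (hM l).integral_jumpSum (hqm l) (hq0 l) (hK l) (hqK l) t hα
      fun x y _ => by
        have := (intervalIntegrable_exp_mul_smul hpm hp1 (ham x y) (haZ x y) x t.coe_nonneg
          (hki x y) l).1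
        simpa only [← hα_eq] using this
    have hsum (l : ℝ) : ∫ ω, jumpSum α t (fun s => X' l s ω) ∂P' l = ∑ z : 𝒳 × 𝒳,
        ∫ s in (0 : ℝ)..t,
          (Real.exp (l * (τ s * E z.1 z.2)) * p l s z.1) • (α s z.1 z.2 * r z.1 z.2) := by
      -- The diagonal pairs, absent from the jumps, may be added back because `r x x = 0`.
      rw [(hJ l).2, Finset.sum_filter_of_ne]
      · exact Finset.sum_congr rfl fun z _ => intervalIntegral.integral_congr fun s _ =>
          hα_eq l s z.1 z.2
      · intro z _ hne he
        refine hne ?_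
        simp [hq, perturbedRate, he, hr_diag]
    have hi1 (z : 𝒳 × 𝒳) : IntervalIntegrable
        (fun s => (τ s * E z.1 z.2 * π z.1) • (α s z.1 z.2 * r z.1 z.2)) volume 0 t :=
      intervalIntegrable_smul_of_bound (B := c * |E z.1 z.2| * |π z.1|) t.coe_nonneg
        (hki z.1 z.2) ((ham z.1 z.2).mul_const _) fun s _ => by
          rw [abs_mul]; exact mul_le_mul_of_nonneg_right (haZ _ _ s) (abs_nonneg _)
    have hi2 (z : 𝒳 × 𝒳) : IntervalIntegrable
        (fun s => ρ s z.1 • (α s z.1 z.2 * r z.1 z.2)) volume 0 t :=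
      (hki z.1 z.2).continuousOn_mul ((continuous_apply z.1).comp hρc).continuousOn
    have h1 (s : ℝ) (hs : 0 ≤ s) :
        τ s * ∫ ω, contraction r (fun x y => α s x y * E x y) (X s.toNNReal ω) ∂P
          = ∑ z : 𝒳 × 𝒳, (τ s * E z.1 z.2 * π z.1) • (α s z.1 z.2 * r z.1 z.2) := by
      rw [integral_eq_sum_law hX.isMarkovJumpProcess.measurable, hX.law_eq hπ hs,
        Fintype.sum_prod_type, Finset.mul_sum]
      refine Finset.sum_congr rfl fun x _ => ?_
      rw [contraction, Finset.mul_sum, Finset.mul_sum]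
      exact Finset.sum_congr rfl fun y _ => by rw [smul_eq_mul]; ring
    have h2 (s : ℝ) : ∑ x, ρ s x * contraction r (α s) x
        = ∑ z : 𝒳 × 𝒳, ρ s z.1 • (α s z.1 z.2 * r z.1 z.2) := by
      rw [Fintype.sum_prod_type]
      exact Finset.sum_congr rfl fun x _ => Finset.mul_sum _ _ _
    refine ⟨fun l => (hJ l).1, ?_, hprod t (fun s => contraction r (α s)) fun x => ?_, ?_⟩
    · rw [intervalIntegrable_iff_integrableOn_Ioc_of_le t.coe_nonneg,
        integrableOn_congr_fun (fun s hs => h1 s hs.1.le) measurableSet_Ioc]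
      exact integrable_finsetSum _ fun z _ => (hi1 z).1
    · exact integrable_finsetSum _ fun y _ => (hki x y).1
    · have e1 : ∫ s in (0 : ℝ)..t,
          τ s * ∫ ω, contraction r (fun x y => α s x y * E x y) (X s.toNNReal ω) ∂P
          = ∑ z : 𝒳 × 𝒳, ∫ s in (0 : ℝ)..t,
            (τ s * E z.1 z.2 * π z.1) • (α s z.1 z.2 * r z.1 z.2) := by
        rw [← intervalIntegral.integral_finsetSum fun z _ => hi1 z]
        refine intervalIntegral.integral_congr fun s hs => h1 s ?_
        rw [uIcc_of_le t.coe_nonneg] at hs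
        exact hs.1
      simp only [hsum, (hconv _ _).2, h2]
      rw [e1, intervalIntegral.integral_finsetSum fun z _ => hi2 z, ← Finset.sum_add_distrib]
      refine HasDerivAt.fun_sum fun z _ => ?_
      -- The two integrals combine because the derivative at zero of `exp (l τ E) * p` is `τ E π +
      -- ρ`: a direct effect on the rates plus the response of the law.
      rw [← intervalIntegral.integral_add (hi1 z) (hi2 z)]
      simp only [← add_smul]
      exact hasDerivAt_integral_exp_mul_smul hπ0 hpm hp1 hρc.measurable hR hC0 hC
        (ham z.1 z.2) (haZ z.1 z.2) z.1 t.coe_nonneg (hki z.1 z.2)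
  · have hqT : Function.Periodic (q l) T := fun s => by
      ext x y
      simp only [hq, perturbedRate, hτ_per s]
    have e1 := hmean l v (t + T.toNNReal : ℝ≥0)
    have e2 := hmean l v t
    rw [Real.toNNReal_coe] at e1 e2
    rw [e1, e2, NNReal.coe_add, Real.coe_toNNReal _ hT.le,
      forward_equation_periodic hT (hqm l) (hK l) (hqK l) hqT (hpc l) (hpT l) (hpe l) t.coe_nonneg]
  · simp only [hmean]
    exact (continuous_finsetSum _ fun x _ =>
      ((continuous_apply x).comp (hpc l)).mul continuous_const).intervalIntegrable _ _
  -- Writing the coefficient with the complex exponential as a vector-valued weight allows the real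
  -- differentiation lemma to be used with values in `ℂ`.
  · have hf (a : ℝ → ℝ) : fourierCoefficient T k a = (1 / T : ℂ) * ∫ t in (0 : ℝ)..T,
        a t • Complex.exp (-(Complex.I * k * (2 * Real.pi / T : ℝ) * t)) := by
      rw [fourierCoefficient]
      congr 1
      exact intervalIntegral.integral_congr fun t _ => by
        simp only [Complex.real_smul]; exact mul_comm _ _
    have hcv := fourierCoefficient_convolution hT hτ_meas hτc hτ_per
      (integrableOn_sum_semigroup hγ hdec v) k
    have e : EqOn (fun s : ℝ => fourierCoefficient T k τ *
          Complex.exp (-(Complex.I * k * (2 * Real.pi / T : ℝ) * s)) *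
            (correlation P X v (responseFunction π r E) s : ℂ))
        (fun s : ℝ => fourierCoefficient T k τ *
          Complex.exp (-(Complex.I * k * (2 * Real.pi / T : ℝ) * s)) *
            ((∑ x, v x * semigroup (forwardOperator r) s w x : ℝ) : ℂ)) (Ioi 0) :=
      fun s hs => by simp only [hcorr v s hs]
    refine ⟨(integrableOn_congr_fun e measurableSet_Ioi).2 hcv.1, ?_⟩
    have hρv : (fun t => ∫ s in Ioi (0 : ℝ),
        τ (t - s) * ∑ x, v x * semigroup (forwardOperator r) s w x) = fun t => ∑ x, ρ t x * v x :=
      funext fun t => by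
        rw [(integral_mul_sum_semigroup hτ_meas hτc hγ hdec v t).2]
        exact Finset.sum_congr rfl fun x _ => mul_comm _ _
    rw [setIntegral_congr_fun measurableSet_Ioi e, ← hcv.2, hρv]
    simp only [hf, hmean]
    exact (hasDerivAt_integral_sum_mul_smul hπ0 hpm hp1 hρc.measurable hR hC v hT.le
      (Continuous.intervalIntegrable (by fun_prop) _ _)).const_mul _
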